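/- **Setting.** Let $G$ be a countable group, embedded in a finitely generated group $H$ with finite generating set $S$ (if $G$ is finitely generated one may take $H=G$). Equip $G$ with the left-invariant metric $d(g,h)=\ell(g^{-1}h)$, where $\ell$ is the restriction to $G$ of the word length of $H$ with respect to $S$. For $T\subseteq G$ and $k\in\mathbb{N}$ let $VR_k(T)$ be the simplicial set whose $q$-simplices are the tuples $(g_0,\dots,g_q)\in T^{q+1}$ with $d(g_i,g_j)\le k$ for all $i,j$, and let $\pi_q(VR_k(T))$ denote the homotopy groups of its geometric realization. For $k\le l$ we say that $\pi_q(VR_k(T))$ *vanishes in* $\pi_q(VR_l(T))$ if the map induced by the inclusion is trivial for every base point (for $q=0$: any two points of $|VR_k(T)|$ lie in one path component of $|VR_l(T)|$). A nonempty $T$ is *of type $F_m$* if for all $q=0,\dots,m-1$ and all $k$ there is $l\ge k$ such that $\pi_q(VR_k(T))$ vanishes in $\pi_q(VR_l(T))$. Let $\operatorname{Hom}(G,\mathbb{R})$ carry the topology of pointwise convergence, and for $m\ge 0$ let $\Sigma^m(G)$ be the set of $\chi\in\operatorname{Hom}(G,\mathbb{R})$ such that $G_\chi=\{g\in G\mid\chi(g)\ge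 0\}$ is of type $F_m$. A *homotopical connecting vector* for $G$ is a tuple $(k_0,\dots,k_m)\in\mathbb{N}^{m+1}$ with $k_q\le k_{q+1}$ such that $\pi_q(VR_{k_q}(G))$ vanishes in $\pi_q(VR_{k_{q+1}}(G))$ for $q=0,\dots,m-1$. For simplicial sets $A,B$ let $\operatorname{Map}(A,B)$ be the set of simplicial maps $A'\to B$ with $A'$ an iterated ($n$-fold, for some $n\ge 0$) barycentric subdivision of $A$. Let $X^{(m)}$ denote the $m$-skeleton of $X$. For $\varphi\in\operatorname{Map}(VR_k(G)^{(m)},VR_k(G))$ and a simplex $\sigma$ of $VR_k(G)$ of dimension at most $m$ let $\varphi(\sigma)^{(0)}\subseteq G$ be the finite set of vertices of the image under $\varphi$ of the subdivided simplex $\sigma$. For a character $\chi$ put $v_\chi(g_0,\dots,g_q)=\min_i\chi(g_i)$ and $v_\chi(\varphi(\sigma))=\min_{g\in\varphi(\sigma)^{(0)}}\chi(g)$. We say that $\varphi$ *raises the valuation of $\chi$* if $v_\chi(\varphi(\sigma))-v_\chi(\sigma)>0$ for every simplex $\sigma$ of $VR_k(G)$ of dimension at most $m$. Finally put $$u_\varphi(\chi)=\min_{\sigma=(1,g_1,\dots,g_q)\in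 VR_k(G)_q,\ 0\le q\le m}\bigl(v_\chi(\varphi(\sigma))-v_\chi(\sigma)\bigr),\qquad U(\varphi)=u_\varphi^{-1}\bigl((0,\infty)\bigr)\subseteq\operatorname{Hom}(G,\mathbb{R}).$$ **Theorem.** Let $m\ge 0$. 1. $\Sigma^m(G)\setminus\{0\}$ is open in $\operatorname{Hom}(G,\mathbb{R})$, and $\Sigma^m(G)$ is a cone: for every $\lambda>0$ and every character $\chi$ one has $\lambda\chi\in\Sigma^m(G)$ if and only if $\chi\in\Sigma^m(G)$; and if $\Sigma^m(G)\ne\emptyset$ then $0\in\Sigma^m(G)$. 2. Let $(k_0,\dots,k_m)$ be a homotopical connecting vector for $G$, let $k=\max(k_0,\dots,k_m)$ and let $\varphi\in\operatorname{Map}(VR_k(G)^{(m)},VR_k(G))$ be $G$-equivariant with respect to left translation (for instance the restriction of a $G$-equivariant element of $\operatorname{Map}(VR_k(G),VR_k(G))$). Then $U(\varphi)$ is open, $U(\varphi)$ is exactly the set of characters whose valuation is raised by $\varphi$, and $U(\varphi)\subseteq\Sigma^m(G)$. In particular, if $\varphi$ raises the valuation of a character $\chi$, then $U(\varphi)$ is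 an open neighbourhood of $\chi$ contained in $\Sigma^m(G)$, and $\varphi$ raises the valuation of every character in $U(\varphi)$. -/

import Mathlib

open CategoryTheory Opposite
open scoped Topology

universe u v

noncomputable section

namespace BNSR

/-! ### Word length -/

/-- The word length of `h` with respect to a subset `S`: the least `n` such that `h` is a product
of `n` elements of `S ∪ S⁻¹`. It is only used when `S` generates the group. -/
def wordLength {H : Type v} [Group H] (S : Set H) (h : H) : ℕ :=
  sInf {n | ∃ w : List H, w.length = n ∧ (∀ x ∈ w, x ∈ S ∨ x⁻¹ ∈ S) ∧ w.prod = h}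

/-- The length function on `G` obtained by restricting the word length of `H` along a homomorphism
`j : G →* H`. In all definitions below a group `G` is equipped with a function `ℓ : G → ℕ` and
the distance of `g` and `h` is `ℓ (g⁻¹ * h)`. -/
def inducedLength {G : Type u} {H : Type v} [Group G] [Group H] (S : Set H) (j : G →* H) :
    G → ℕ :=
  fun g => wordLength S (j g)

/-! ### The free simplicial set and Vietoris-Rips complexes -/

/-- The free simplicial set `E T` on `T`: its `q`-simplices are all `(q+1)`-tuples in `T`, faces
omit entries and degeneracies repeat entries. -/
def freeSSet (T : Type u) : SSet.{u} where
  obj n := Fin (n.unop.len + 1) → T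
  map f := ↾fun x => x ∘ f.unop.toOrderHom
  map_id _ := rfl
  map_comp _ _ := rfl

/-- Left translation by `g` on `E G`. -/
def translate {G : Type u} [Group G] (g : G) : freeSSet G ⟶ freeSSet G where
  app _ := ↾fun x i => g * x i
  naturality _ _ _ := rfl

/-- The Vietoris-Rips complex of the subspace `T` of `G` for the value `k`, as a subcomplex
of `E G`: its simplices are the tuples in `T` whose entries have pairwise distance at most `k`. -/
def vietorisRips {G : Type u} [Group G] (ℓ : G → ℕ) (T : Set G) (k : ℕ) :
    (freeSSet G).Subcomplex where
  obj n := {x : Fin (n.unop.len + 1) → G |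
    (∀ i, x i ∈ T) ∧ ∀ i j, ℓ ((x i)⁻¹ * x j) ≤ k}
  map _ _ hx := ⟨fun _ => hx.1 _, fun _ _ => hx.2 _ _⟩

lemma vietorisRips_mono {G : Type u} [Group G] (ℓ : G → ℕ) (T : Set G) {k l : ℕ} (h : k ≤ l) :
    vietorisRips ℓ T k ≤ vietorisRips ℓ T l :=
  fun _ _ hx => ⟨hx.1, fun i j => (hx.2 i j).trans h⟩

/-- The Vietoris-Rips complex of the whole group `G` as a simplicial set. -/
abbrev VR {G : Type u} [Group G] (ℓ : G → ℕ) (k : ℕ) : SSet.{u} :=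
  (vietorisRips ℓ Set.univ k).toSSet

/-- Left translation by `g` on the Vietoris-Rips complex of `G`. -/
def translateVR {G : Type u} [Group G] (ℓ : G → ℕ) (k : ℕ) (g : G) : VR ℓ k ⟶ VR ℓ k :=
  SSet.Subcomplex.lift ((vietorisRips ℓ Set.univ k).ι ≫ translate g) (by
    rintro n _ ⟨x, rfl⟩
    refine ⟨fun _ => Set.mem_univ _, fun i j => ?_⟩
    have h := x.2.2 i j
    have e : ((g * x.1 i)⁻¹ * (g * x.1 j) : G) = (x.1 i)⁻¹ * x.1 j := by group
    exact (congrArg ℓ e).trans_le h)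

/-! ### Skeleta -/

/-- The `m`-skeleton of a simplicial set (Mathlib's `X.skeleton n` is generated by the simplices
of dimension `< n`). -/
abbrev skel (X : SSet.{u}) (m : ℕ) : SSet.{u} :=
  (X.skeleton (m + 1)).toSSet

lemma image_skeleton_le {X Y : SSet.{u}} (f : X ⟶ Y) (n : ℕ) :
    (X.skeleton n).image f ≤ Y.skeleton n := by
  rw [SSet.Subcomplex.image_le_iff]
  refine iSup_le fun i => iSup_le fun x => ?_
  rw [← SSet.Subcomplex.image_le_iff, SSet.Subcomplex.image_ofSimplex]
  exact Y.ofSimplex_le_skeleton _ i.2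

/-- The map induced on `m`-skeleta by a simplicial map. -/
def skelMap {X Y : SSet.{u}} (f : X ⟶ Y) (m : ℕ) : skel X m ⟶ skel Y m :=
  SSet.Subcomplex.lift ((X.skeleton (m + 1)).ι ≫ f) (by
    rw [← SSet.Subcomplex.image_eq_range]
    exact image_skeleton_le f (m + 1))

/-! ### Homotopy groups, finiteness properties and the invariant -/

/-- The map `π_q(X, x) → π_q(Y, f x)` induced by a continuous map `f`. -/
def piMap {X Y : Type u} [TopologicalSpace X] [TopologicalSpace Y] (f : C(X, Y)) (q : ℕ) (x : X) :
    π_ q X x → π_ q Y (f x) :=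
  Quotient.map (fun γ => ⟨f.comp γ.1, fun y hy => congrArg f (γ.2 y hy)⟩)
    (fun _ _ h => h.map fun H => H.compContinuousMap f)

/-- The continuous map between the geometric realizations of the Vietoris-Rips complexes of `T`
for the values `k ≤ l` induced by the inclusion. -/
def realizationIncl {G : Type u} [Group G] (ℓ : G → ℕ) (T : Set G) {k l : ℕ} (h : k ≤ l) :
    C(SSet.toTop.obj (vietorisRips ℓ T k).toSSet, SSet.toTop.obj (vietorisRips ℓ T l).toSSet) :=
  (SSet.toTop.map (SSet.Subcomplex.homOfLE (vietorisRips_mono ℓ T h))).hom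

/-- `π_q` of the Vietoris-Rips complex of `T` for the value `k` vanishes in `π_q` of the
Vietoris-Rips complex of `T` for the value `l ≥ k`: at every base point, the map induced by the
inclusion is trivial. For `q = 0` this says that any two points of the smaller complex lie in the
same path component of the larger one. -/
def PiVanishes {G : Type u} [Group G] (ℓ : G → ℕ) (T : Set G) (q : ℕ) {k l : ℕ} (h : k ≤ l) :
    Prop :=
  ∀ (x : SSet.toTop.obj (vietorisRips ℓ T k).toSSet) (a : π_ q _ x),
    piMap (realizationIncl ℓ T h) q x a =
      (⟦GenLoop.const⟧ : π_ q _ (realizationIncl ℓ T h x))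

/-- The nonempty metric subspace `T` of `G` is of type `F_m`: the direct systems
`(π_q(VR_k(T)))_k` are essentially trivial for `q = 0, …, m-1`. -/
def IsTypeF {G : Type u} [Group G] (ℓ : G → ℕ) (T : Set G) (m : ℕ) : Prop :=
  ∀ q < m, ∀ k : ℕ, ∃ l : ℕ, ∃ h : k ≤ l, PiVanishes ℓ T q h

/-- The real vector space `Hom(G, ℝ)` of characters of `G`. -/
abbrev Character (G : Type u) [Group G] : Type u := Additive G →+ ℝ

/-- `Hom(G, ℝ)` carries the topology of pointwise convergence. If `G` is generated by
`x₁, …, xₙ`, this is the topology induced by `χ ↦ (χ x₁, …, χ xₙ) ∈ ℝⁿ`. -/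
instance characterTopology (G : Type u) [Group G] : TopologicalSpace (Character G) :=
  TopologicalSpace.induced (fun χ (g : G) => χ (Additive.ofMul g)) Pi.topologicalSpace

/-- The invariant `Σ^m(G)`: the characters `χ` for which `G_χ = {g | χ(g) ≥ 0}`, with the metric
inherited from `G`, is of type `F_m`. -/
def sigmaInvariant {G : Type u} [Group G] (ℓ : G → ℕ) (m : ℕ) : Set (Character G) :=
  {χ | IsTypeF ℓ {g : G | 0 ≤ χ (Additive.ofMul g)} m}

/-- `(k₀, …, k_m)` is a homotopical connecting vector for `G`: for `q = 0, …, m-1` one has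
`k_q ≤ k_{q+1}` and `π_q(VR_{k_q}(G))` vanishes in `π_q(VR_{k_{q+1}}(G))`. -/
def IsConnectingVector {G : Type u} [Group G] (ℓ : G → ℕ) {m : ℕ} (k : Fin (m + 1) → ℕ) : Prop :=
  ∀ q : Fin m, ∃ h : k q.castSucc ≤ k q.succ, PiVanishes ℓ Set.univ q h

/-! ### Simplicial maps on iterated barycentric subdivisions -/

/-- The `n`-fold barycentric subdivision of simplicial sets. -/
def sdIter : ℕ → (SSet.{u} ⥤ SSet.{u})
  | 0 => 𝟭 _
  | n + 1 => sdIter n ⋙ SSet.sd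

/-- `Map(A, B)`: the simplicial maps `A' ⟶ B` where `A'` is obtained from `A` by finitely many
barycentric subdivisions. -/
structure SdMap (A B : SSet.{u}) where
  /-- The number of subdivisions. -/
  depth : ℕ
  /-- The simplicial map. -/
  hom : (sdIter depth).obj A ⟶ B

section Simplices

open scoped Simplicial

/-- The `i`-th vertex of a simplex of the Vietoris-Rips complex. -/
def vertex {G : Type u} [Group G] {ℓ : G → ℕ} {k q : ℕ} (σ : (VR ℓ k) _⦋q⦌) (i : Fin (q + 1)) :
    G :=
  (show Fin (q + 1) → G from σ.1) i

/-- A simplex of dimension at most `m` regarded as a simplex of the `m`-skeleton. -/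
def toSkel {X : SSet.{u}} {m q : ℕ} (hq : q ≤ m) (σ : X _⦋q⦌) : (skel X m) _⦋q⦌ :=
  ⟨σ, X.mem_skeleton σ (Nat.lt_succ_of_le hq)⟩

/-- The restriction `φ ∘ σ ∈ Map(Δ^q, B)` of `φ ∈ Map(A, B)` to a `q`-simplex `σ` of `A`. -/
def SdMap.restrict {A B : SSet.{u}} (φ : SdMap A B) {q : ℕ} (σ : A _⦋q⦌) : SdMap Δ[q] B where
  depth := φ.depth
  hom := (sdIter φ.depth).map (SSet.yonedaEquiv.symm σ) ≫ φ.hom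

/-- The elements of `Map(VR_k(G)^{(m)}, VR_k(G))`. -/
abbrev SkelMap {G : Type u} [Group G] (ℓ : G → ℕ) (m k : ℕ) : Type u :=
  SdMap (skel (VR ℓ k) m) (VR ℓ k)

/-- `φ` commutes with the left translation action of `G`. -/
def IsEquivariant {G : Type u} [Group G] {ℓ : G → ℕ} {m k : ℕ} (φ : SkelMap ℓ m k) : Prop :=
  ∀ g : G, (sdIter φ.depth).map (skelMap (translateVR ℓ k g) m) ≫ φ.hom =
    φ.hom ≫ translateVR ℓ k g

/-- The finite nonempty set `φ(σ)^{(0)} ⊆ G` of vertices of the image under `φ` of the subdivided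
`q`-simplex `σ` of `VR_k(G)`, where `q ≤ m`. -/
def imageVertices {G : Type u} [Group G] {ℓ : G → ℕ} {m k : ℕ} (φ : SkelMap ℓ m k) {q : ℕ}
    (hq : q ≤ m) (σ : (VR ℓ k) _⦋q⦌) : Set G :=
  Set.range fun x : ((sdIter φ.depth).obj Δ[q]) _⦋0⦌ =>
    vertex ((φ.restrict (toSkel hq σ)).hom.app (op ⦋0⦌) x) 0

/-- The valuation `v(σ) = min_i χ(g_i)` of a simplex `σ = (g_0, …, g_q)`. -/
def val {G : Type u} [Group G] (χ : Character G) {ℓ : G → ℕ} {k q : ℕ} (σ : (VR ℓ k) _⦋q⦌) : ℝ :=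
  ⨅ i : Fin (q + 1), χ (Additive.ofMul (vertex σ i))

/-- The valuation `v(φ(σ))`, i.e. the minimum of `χ` on the vertices of `φ(σ)`. -/
def valImage {G : Type u} [Group G] (χ : Character G) {ℓ : G → ℕ} {m k : ℕ} (φ : SkelMap ℓ m k)
    {q : ℕ} (hq : q ≤ m) (σ : (VR ℓ k) _⦋q⦌) : ℝ :=
  ⨅ g : imageVertices φ hq σ, χ (Additive.ofMul g.1)

/-- `φ` raises the valuation of `χ`: `v(φ(σ)) - v(σ) > 0` for every simplex `σ` of `VR_k(G)` of
dimension at most `m`. -/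
def RaisesVal {G : Type u} [Group G] {ℓ : G → ℕ} {m k : ℕ} (φ : SkelMap ℓ m k)
    (χ : Character G) : Prop :=
  ∀ (q : ℕ) (hq : q ≤ m) (σ : (VR ℓ k) _⦋q⦌), 0 < valImage χ φ hq σ - val χ σ

/-- The simplices `(1, g_1, …, g_q)` of `VR_k(G)` with `q = 0, …, m`; there are finitely many. -/
def BasedSimplex {G : Type u} [Group G] (ℓ : G → ℕ) (m k : ℕ) : Type u :=
  Σ q : Fin (m + 1), {σ : (VR ℓ k) _⦋q⦌ // vertex σ 0 = 1}

/-- `u_φ(χ)`: the minimum of `v(φ(σ)) - v(σ)` over the simplices `σ = (1, g_1, …, g_q)` of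
`VR_k(G)` with `q = 0, …, m`. -/
def minRaise {G : Type u} [Group G] {ℓ : G → ℕ} {m k : ℕ} (φ : SkelMap ℓ m k)
    (χ : Character G) : ℝ :=
  ⨅ s : BasedSimplex ℓ m k,
    (valImage χ φ (Nat.le_of_lt_succ s.1.2) s.2.1 - val χ s.2.1)

/-- `U(φ) = u_φ⁻¹(0, ∞)`. -/
def witnessSet {G : Type u} [Group G] {ℓ : G → ℕ} {m k : ℕ} (φ : SkelMap ℓ m k) :
    Set (Character G) :=
  minRaise φ ⁻¹' Set.Ioi 0

end Simplices

end BNSR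

end

/-! Spheres in $|VR_k(T)|$ are replaced by lattice maps: functions $f:\mathbb{Z}^q\to T$, constant
far out, moving adjacent lattice points at most $k$ apart. Subdivision becomes precomposition with
`coarse`, which rounds by powers of three. Multilinear interpolation turns a lattice map into a
continuous one. Conversely, labelling the points of a fine grid by vertices with a large barycentric
coordinate discretizes a continuous map. So vanishing of $\pi_q$ yields fillings of lattice cubes
(`PiVanishes.cubeFill`), fillings yield lattice null-homotopies (`CubeFill.null`), and these yield
vanishing of $\pi_q$ (`piVanishes_of_null`).

The central notion is `Raise ℓ χ k n`: every mesh-$k$ map of $\mathbb{Z}^n$ can be moved, after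
subdivision, by a bounded distance to a mesh-$k$ map whose valuation is larger by a fixed $c>0$. It
has four properties.

It is open in $\chi$: a bounded displacement only involves $\chi$ on a ball, and balls are finite
(`isOpen_setOf_raise`).

It follows from fillings in $G_\chi$ when $\chi\neq 0$ (`raise_of_cubeFill`). Right multiplication
by $g$ with $\chi(g)>0$ raises the vertices, and the result is repaired over one skeleton after
another. A sphere translated so that its lowest vertex is $1$ lies in $G_\chi$, hence has a filling
that does not go below the sphere. Up to translation there are finitely many spheres of bounded
diameter, so all constants are uniform.

It follows from an equivariant $\varphi$ that raises the valuation (`IsEquivariant.raise`):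
simplicial approximation carries lattice maps into the iterated subdivision, where $\varphi$ can be
applied.

Together with fillings in $G$ it puts $\chi$ in the invariant (`Raise.exists_piVanishes`). A sphere
in $G_\chi$ is null-homotopic in $G$; raising this null-homotopy often enough pushes it into
$G_\chi$. The sphere itself is joined to its raised version by one jump of bounded length followed
by small steps that all stay in $G_\chi$. Only the length of that jump affects the mesh, and it does
not depend on the sphere.

Openness combines the second, first and fourth properties, since fillings in $G_\chi$ translate to
fillings in $G$ (`CubeFill.univ`), which also handles the zero character. The inclusion
$U(\varphi)\subseteq\Sigma^m(G)$ combines the third and fourth. -/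

noncomputable section

namespace BNSR

/-! ### Geometric realizations tested on simplices -/

section Realization

variable {X Y : SSet.{u}}

/-- The characteristic map of a simplex of `X` in the geometric realization. -/
def cell {n : SimplexCategory} (σ : X.obj (op n)) :
    C(stdSimplex ℝ (Fin (n.len + 1)), SSet.toTop.obj X) :=
  TopCat.toSSetObjEquiv _ (op n) ((sSetTopAdj.unit.app X).app (op n) σ)

lemma cell_map {n m : SimplexCategory} (f : n ⟶ m) (σ : X.obj (op m))
    (p : stdSimplex ℝ (Fin (n.len + 1))) :
    cell (X.map f.op σ) p = cell σ (stdSimplex.map f p) := by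
  have h := ConcreteCategory.congr_hom ((sSetTopAdj.unit.app X).naturality f.op) σ
  have h' := congrArg (fun z => TopCat.toSSetObjEquiv _ (op n) z p) h
  exact h'.trans (TopCat.toSSetObjEquiv_naturality_apply f _ p)

lemma toTop_map_cell (g : X ⟶ Y) {n : SimplexCategory} (σ : X.obj (op n))
    (p : stdSimplex ℝ (Fin (n.len + 1))) :
    (SSet.toTop.map g).hom (cell σ p) = cell (g.app (op n) σ) p := by
  have h := ConcreteCategory.congr_hom (NatTrans.congr_app
    (sSetTopAdj.unit.naturality g) (op n)) σ
  have h' := congrArg (fun z => TopCat.toSSetObjEquiv _ (op n) z p) h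
  exact h'.symm

/-- The map out of the geometric realization determined by a compatible family of maps on
simplices. -/
def descSSet {Z : Type u} [TopologicalSpace Z]
    (h : ∀ n : SimplexCategory, X.obj (op n) → C(stdSimplex ℝ (Fin (n.len + 1)), Z))
    (hh : ∀ (n m : SimplexCategory) (f : n ⟶ m) (σ : X.obj (op m))
      (p : stdSimplex ℝ (Fin (n.len + 1))), h n (X.map f.op σ) p = h m σ (stdSimplex.map f p)) :
    X ⟶ TopCat.toSSet.obj (TopCat.of Z) where
  app n := ↾fun σ => (TopCat.toSSetObjEquiv (TopCat.of Z) n).symm (h n.unop σ)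
  naturality n m f := by
    ext σ
    apply (TopCat.toSSetObjEquiv (TopCat.of Z) m).injective
    ext p
    refine Eq.trans ?_ (TopCat.toSSetObjEquiv_naturality_apply f.unop _ p).symm
    exact hh _ _ f.unop σ p

/-- The continuous map out of the geometric realization determined by a compatible family of
continuous maps on simplices. -/
def desc {Z : Type u} [TopologicalSpace Z]
    (h : ∀ n : SimplexCategory, X.obj (op n) → C(stdSimplex ℝ (Fin (n.len + 1)), Z))
    (hh : ∀ (n m : SimplexCategory) (f : n ⟶ m) (σ : X.obj (op m))
      (p : stdSimplex ℝ (Fin (n.len + 1))), h n (X.map f.op σ) p = h m σ (stdSimplex.map f p)) :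
    C(SSet.toTop.obj X, Z) :=
  ((sSetTopAdj.homEquiv X (TopCat.of Z)).symm (descSSet h hh)).hom

lemma homEquiv_cell {Z : TopCat.{u}} (f : SSet.toTop.obj X ⟶ Z) {n : SimplexCategory}
    (σ : X.obj (op n)) (p : stdSimplex ℝ (Fin (n.len + 1))) :
    TopCat.toSSetObjEquiv _ (op n) ((sSetTopAdj.homEquiv X Z f).app (op n) σ) p =
      f.hom (cell σ p) := by
  rw [Adjunction.homEquiv_unit]
  rfl

@[simp]
lemma desc_cell {Z : Type u} [TopologicalSpace Z]
    (h : ∀ n : SimplexCategory, X.obj (op n) → C(stdSimplex ℝ (Fin (n.len + 1)), Z))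
    (hh : ∀ (n m : SimplexCategory) (f : n ⟶ m) (σ : X.obj (op m))
      (p : stdSimplex ℝ (Fin (n.len + 1))), h n (X.map f.op σ) p = h m σ (stdSimplex.map f p))
    {n : SimplexCategory} (σ : X.obj (op n)) (p : stdSimplex ℝ (Fin (n.len + 1))) :
    desc h hh (cell σ p) = h n σ p := by
  have := homEquiv_cell ((sSetTopAdj.homEquiv X (TopCat.of Z)).symm (descSSet h hh)) σ p
  rw [Equiv.apply_symm_apply] at this
  rw [desc, ← this]
  exact congrFun (congrArg DFunLike.coe
    ((TopCat.toSSetObjEquiv (TopCat.of Z) (op n)).apply_symm_apply (h n σ))) p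

lemma hom_ext_cell {Z : Type u} [TopologicalSpace Z] {f g : C(SSet.toTop.obj X, Z)}
    (h : ∀ (n : SimplexCategory) (σ : X.obj (op n)) (p : stdSimplex ℝ (Fin (n.len + 1))),
      f (cell σ p) = g (cell σ p)) : f = g := by
  have : TopCat.ofHom f = TopCat.ofHom g := by
    apply (sSetTopAdj.homEquiv X (TopCat.of Z)).injective
    ext n σ
    apply (TopCat.toSSetObjEquiv (TopCat.of Z) n).injective
    ext p
    exact (homEquiv_cell _ _ _).trans ((h _ _ _).trans (homEquiv_cell _ _ _).symm)
  exact congrArg TopCat.Hom.hom this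

/-- Membership in the union of the cells is encoded as a map to an indiscrete space, where
continuity is free. It agrees with the constant map `True` on every cell, hence everywhere. -/
lemma exists_cell (x : SSet.toTop.obj X) :
    ∃ (n : SimplexCategory) (σ : X.obj (op n)) (p : stdSimplex ℝ (Fin (n.len + 1))),
      cell σ p = x := by
  let _ : TopologicalSpace (ULift.{u} Prop) := ⊤
  let f : C(SSet.toTop.obj X, ULift.{u} Prop) := ⟨fun _ => ⟨True⟩, continuous_top⟩
  let g : C(SSet.toTop.obj X, ULift.{u} Prop) :=
    ⟨fun x => ⟨∃ (n : SimplexCategory) (σ : X.obj (op n))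
      (p : stdSimplex ℝ (Fin (n.len + 1))), cell σ p = x⟩, continuous_top⟩
  have h : f = g := hom_ext_cell fun n σ p => by
    apply ULift.ext
    exact (eq_true ⟨n, σ, p, rfl⟩).symm
  have := congrArg ULift.down (DFunLike.congr_fun h x)
  exact this.mp trivial

/-- The function out of the geometric realization determined by a compatible family of
functions on simplices. -/
lemma exists_desc_fun {Z : Type u}
    (h : ∀ n : SimplexCategory, X.obj (op n) → stdSimplex ℝ (Fin (n.len + 1)) → Z)
    (hh : ∀ (n m : SimplexCategory) (f : n ⟶ m) (σ : X.obj (op m))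
      (p : stdSimplex ℝ (Fin (n.len + 1))), h n (X.map f.op σ) p = h m σ (stdSimplex.map f p)) :
    ∃ F : SSet.toTop.obj X → Z, ∀ (n : SimplexCategory) (σ : X.obj (op n))
      (p : stdSimplex ℝ (Fin (n.len + 1))), F (cell σ p) = h n σ p := by
  -- Every function into an indiscrete space is continuous, so `desc` also glues mere functions.
  let _ : TopologicalSpace Z := ⊤
  refine ⟨desc (fun n σ => ⟨h n σ, continuous_top⟩) hh, fun n σ p => ?_⟩
  simp

/-- Continuous maps to `Prop` with its Sierpiński topology are the same as open sets, so compatible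
open subsets of simplices can be glued by `desc`. -/
lemma isOpen_of_cell {s : Set (SSet.toTop.obj X)}
    (h : ∀ (n : SimplexCategory) (σ : X.obj (op n)), IsOpen (cell σ ⁻¹' s)) : IsOpen s := by
  let F : C(SSet.toTop.obj X, ULift.{u} Prop) :=
    desc (fun n σ => ⟨fun p => ⟨cell σ p ∈ s⟩,
      continuous_uliftUp.comp (continuous_Prop.mpr (h n σ))⟩)
      (fun n m f σ p => by
        apply ULift.ext
        exact congrArg (· ∈ s) (cell_map f σ p))
  have e : s = {x | (F x).down} := by
    ext x
    obtain ⟨n, σ, p, rfl⟩ := exists_cell x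
    simp [F]
  rw [e]
  exact continuous_Prop.mp (continuous_uliftDown.comp F.continuous)

lemma isClosed_of_cell {s : Set (SSet.toTop.obj X)}
    (h : ∀ (n : SimplexCategory) (σ : X.obj (op n)), IsClosed (cell σ ⁻¹' s)) : IsClosed s :=
  isOpen_compl_iff.mp (isOpen_of_cell fun n σ => (h n σ).isOpen_compl)

lemma continuous_of_cell {Z : Type*} [TopologicalSpace Z] {f : SSet.toTop.obj X → Z}
    (h : ∀ (n : SimplexCategory) (σ : X.obj (op n)), Continuous (f ∘ cell σ)) : Continuous f :=
  ⟨fun _ hs => isOpen_of_cell fun n σ => hs.preimage (h n σ)⟩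

end Realization

/-! ### Barycentric coordinates on the realization of the free simplicial set -/

section Barycentric

/-- The geometric realization of the free simplicial set on `T`. -/
abbrev FreeSpace (T : Type u) : Type u := SSet.toTop.obj (freeSSet T)

/-- A tuple in `T` as a simplex of the free simplicial set. -/
def freeSimplex {T : Type u} {n : SimplexCategory} (σ : Fin (n.len + 1) → T) :
    (freeSSet T).obj (op n) := σ

lemma stdSimplex_map_apply {X Y : Type*} [Fintype X] [Fintype Y] [DecidableEq Y] (f : X → Y)
    (p : stdSimplex ℝ X) (y : Y) :
    stdSimplex.map f p y = ∑ x, if f x = y then p x else 0 := by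
  rw [stdSimplex.map_coe, FunOnFinite.linearMap_apply_apply, Finset.sum_filter]

open Classical in
/-- The total weight of `t` for a weighted finite family in `T`. -/
def weight {T : Type*} {V : Type*} [Fintype V] (f : V → T) (p : V → ℝ) (t : T) : ℝ :=
  ∑ v, if f v = t then p v else 0

/-- This compatibility with the simplicial operators is what makes barycentric coordinates well
defined on the realization. -/
lemma weight_map {T : Type*} {V W : Type*} [Fintype V] [Fintype W] (e : V → W) (f : W → T)
    (p : stdSimplex ℝ V) (t : T) : weight f (stdSimplex.map e p) t = weight (f ∘ e) p t := by
  classical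
  simp only [weight, stdSimplex_map_apply]
  rw [Finset.sum_congr rfl (g := fun w => ∑ x, if e x = w then (if f w = t then p x else 0) else 0)
    (fun w _ => by split_ifs <;> simp), Finset.sum_comm]
  refine Finset.sum_congr rfl fun x _ => ?_
  simp

lemma continuous_weight {T V : Type*} [Fintype V] (f : V → T) (t : T) :
    Continuous fun p : V → ℝ => weight f p t := by
  classical
  unfold weight
  refine continuous_finsetSum _ fun v _ => ?_
  split_ifs <;> fun_prop

lemma weight_pos_iff {T V : Type*} [Fintype V] {f : V → T} {p : V → ℝ} (hp : ∀ v, 0 ≤ p v)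
    {t : T} : 0 < weight f p t ↔ ∃ v, f v = t ∧ 0 < p v := by
  classical
  constructor
  · intro h
    by_contra! hc
    refine absurd h (not_lt.mpr (Finset.sum_nonpos fun v _ => ?_))
    split_ifs with hv
    · exact hc v hv
    · exact le_rfl
  · rintro ⟨v, hv, hpv⟩
    refine hpv.trans_le ?_
    have := Finset.single_le_sum (f := fun v => if f v = t then p v else 0)
      (fun w _ => by split_ifs <;> simp [hp]) (Finset.mem_univ v)
    simpa [hv, weight] using this

lemma le_weight {T V : Type*} [Fintype V] {f : V → T} {p : V → ℝ} (hp : ∀ v, 0 ≤ p v) (v : V) :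
    p v ≤ weight f p (f v) := by
  classical
  have := Finset.single_le_sum (f := fun w => if f w = f v then p w else 0)
    (fun w _ => by split_ifs <;> simp [hp]) (Finset.mem_univ v)
  simpa [weight] using this

variable {T : Type u}

lemma exists_lam : ∃ F : FreeSpace T → T → ℝ, ∀ (n : SimplexCategory)
    (σ : (freeSSet T).obj (op n)) (p : stdSimplex ℝ (Fin (n.len + 1))),
      F (cell σ p) = weight (show Fin (n.len + 1) → T from σ) p :=
  exists_desc_fun (X := freeSSet T) (fun n σ p => weight (show Fin (n.len + 1) → T from σ) p)
    (fun _ m f σ p => by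
      ext t; exact (weight_map f (show Fin (m.len + 1) → T from σ) p t).symm)

/-- The barycentric coordinates of a point of the realization of the free simplicial set. -/
def lam (x : FreeSpace T) : T → ℝ := exists_lam.choose x

lemma lam_cell {n : SimplexCategory} (σ : Fin (n.len + 1) → T)
    (p : stdSimplex ℝ (Fin (n.len + 1))) : lam (cell (freeSimplex σ) p) = weight σ p :=
  exists_lam.choose_spec n σ p

lemma exists_free_cell (x : FreeSpace T) : ∃ (n : SimplexCategory) (σ : Fin (n.len + 1) → T)
    (p : stdSimplex ℝ (Fin (n.len + 1))), cell (freeSimplex σ) p = x := exists_cell x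

lemma continuous_lam (t : T) : Continuous fun x : FreeSpace T => lam x t := by
  refine continuous_of_cell fun n σ => ?_
  have : (fun x : FreeSpace T => lam x t) ∘ cell σ =
      fun p : stdSimplex ℝ (Fin (n.len + 1)) => weight (show Fin (n.len + 1) → T from σ) p t := by
    ext p; exact congrFun (lam_cell (n := n) σ p) t
  rw [this]
  exact (continuous_weight _ t).comp continuous_subtype_val

lemma lam_nonneg (x : FreeSpace T) (t : T) : 0 ≤ lam x t := by
  obtain ⟨n, σ, p, rfl⟩ := exists_free_cell x
  rw [lam_cell]
  exact Finset.sum_nonneg fun v _ => by split_ifs <;> simp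

lemma exists_lam_pos (x : FreeSpace T) : ∃ t, 0 < lam x t := by
  obtain ⟨n, σ, p, rfl⟩ := exists_free_cell x
  obtain ⟨v, hv⟩ : ∃ v, 0 < p v := by
    by_contra! h
    have := stdSimplex.sum_eq_one p
    have h2 : ∑ v, p v ≤ 0 := Finset.sum_nonpos fun v _ => h v
    linarith
  exact ⟨σ v, by rw [lam_cell]; exact (weight_pos_iff fun _ => stdSimplex.zero_le p _).2 ⟨v, rfl, hv⟩⟩

/-- The support of a point. -/
def supp (x : FreeSpace T) : Set T := {t | 0 < lam x t}

lemma mem_supp_cell {n : SimplexCategory} {σ : Fin (n.len + 1) → T}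
    {p : stdSimplex ℝ (Fin (n.len + 1))} {t : T} :
    t ∈ supp (cell (freeSimplex σ) p) ↔ ∃ v, σ v = t ∧ 0 < p v := by
  rw [supp, Set.mem_ofPred_eq, lam_cell]
  exact weight_pos_iff fun _ => stdSimplex.zero_le p _

end Barycentric

/-! ### Monotone retractions onto the support of a point -/

section Retraction

variable {n : ℕ}

/-- The monotone retraction of `Fin (n+1)` onto a nonempty subset. -/
def retr (S : Finset (Fin (n + 1))) (hS : S.Nonempty) : Fin (n + 1) →o Fin (n + 1) where
  toFun i := if h : (S.filter (· ≤ i)).Nonempty then (S.filter (· ≤ i)).max' h else S.min' hS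
  monotone' i j hij := by
    dsimp only
    have hsub : S.filter (· ≤ i) ⊆ S.filter (· ≤ j) := fun x hx => by
      rw [Finset.mem_filter] at hx ⊢
      exact ⟨hx.1, hx.2.trans hij⟩
    split_ifs with h1 h2 h2
    · exact Finset.max'_subset _ hsub
    · exact absurd (h1.mono hsub) h2
    · exact Finset.min'_le _ _ (Finset.mem_filter.1 (Finset.max'_mem _ h2)).1
    · exact le_rfl

lemma retr_mem (S : Finset (Fin (n + 1))) (hS : S.Nonempty) (i : Fin (n + 1)) :
    retr S hS i ∈ S := by
  change dite _ _ _ ∈ S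
  split_ifs with h
  · exact (Finset.mem_filter.1 (Finset.max'_mem _ h)).1
  · exact Finset.min'_mem _ _

lemma retr_eq (S : Finset (Fin (n + 1))) (hS : S.Nonempty) {i : Fin (n + 1)} (hi : i ∈ S) :
    retr S hS i = i := by
  have h : (S.filter (· ≤ i)).Nonempty := ⟨i, by simp [hi]⟩
  change dite _ _ _ = i
  rw [dif_pos h]
  exact le_antisymm (Finset.max'_le _ _ _ fun y hy => (Finset.mem_filter.1 hy).2)
    (Finset.le_max' _ _ (by simp [hi]))

/-- The set of indices with positive weight. -/
def posSet (p : stdSimplex ℝ (Fin (n + 1))) : Finset (Fin (n + 1)) :=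
  Finset.univ.filter fun i => 0 < p i

lemma posSet_nonempty (p : stdSimplex ℝ (Fin (n + 1))) : (posSet p).Nonempty := by
  by_contra h
  rw [Finset.not_nonempty_iff_eq_empty] at h
  have h1 := stdSimplex.sum_eq_one p
  have h2 : ∑ v, p v ≤ 0 := Finset.sum_nonpos fun v _ => by
    by_contra hv
    have : v ∈ posSet p := by simpa [posSet] using hv
    simp [h] at this
  linarith

/-- Applied to `retr (posSet p)`, this allows a tuple to be precomposed with that retraction without
moving the point `p`; monotonicity of `retr` makes it a legitimate simplicial operator. -/
lemma stdSimplex_map_eq_self {p : stdSimplex ℝ (Fin (n + 1))} {f : Fin (n + 1) → Fin (n + 1)}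
    (h : ∀ i, 0 < p i → f i = i) : stdSimplex.map f p = p := by
  ext j
  rw [stdSimplex_map_apply]
  rw [Finset.sum_eq_single j]
  · split_ifs with hj
    · rfl
    · by_contra hne
      exact hj (h j (lt_of_le_of_ne (stdSimplex.zero_le p j) hne))
  · intro i _ hij
    split_ifs with hfi
    · by_contra hne
      exact hij ((h i (lt_of_le_of_ne (stdSimplex.zero_le p i) (Ne.symm hne))).symm.trans hfi)
    · rfl
  · simp

end Retraction

/-! ### Independence of labels of weight zero -/

section Support

variable {G : Type u}

lemma cell_free_map {n m : SimplexCategory} (f : Fin (n.len + 1) →o Fin (m.len + 1))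
    (σ : Fin (m.len + 1) → G) (p : stdSimplex ℝ (Fin (n.len + 1))) :
    cell (freeSimplex (σ ∘ f)) p = cell (freeSimplex σ) (stdSimplex.map f p) :=
  cell_map (SimplexCategory.Hom.mk f) (freeSimplex σ) p

lemma range_comp_retr {n : ℕ} {σ : Fin (n + 1) → G} {p : stdSimplex ℝ (Fin (n + 1))} :
    Set.range (σ ∘ retr (posSet p) (posSet_nonempty p)) = σ '' {i | 0 < p i} := by
  ext g
  constructor
  · rintro ⟨i, rfl⟩
    have := retr_mem (posSet p) (posSet_nonempty p) i
    exact ⟨_, by simpa [posSet] using this, rfl⟩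
  · rintro ⟨i, hi, rfl⟩
    exact ⟨i, congrArg σ (retr_eq _ _ (by simpa [posSet] using hi))⟩

lemma image_pos_map {n m : ℕ} (f : Fin (n + 1) → Fin (m + 1)) (σ : Fin (m + 1) → G)
    (p : stdSimplex ℝ (Fin (n + 1))) :
    (σ ∘ f) '' {i | 0 < p i} = σ '' {j | 0 < stdSimplex.map f p j} := by
  have key : ∀ j, 0 < stdSimplex.map f p j ↔ ∃ i, f i = j ∧ 0 < p i := fun j => by
    rw [stdSimplex_map_apply]
    have := weight_pos_iff (f := f) (p := p) (fun _ => stdSimplex.zero_le p _) (t := j)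
    rw [← this, weight]
    have : (∑ x, if f x = j then p x else 0) = ∑ v, @ite _ (f v = j) (Classical.propDecidable _) (p v) 0 :=
      Finset.sum_congr rfl fun x _ => by congr
    rw [this]
  ext g
  constructor
  · rintro ⟨i, hi, rfl⟩
    exact ⟨f i, (key _).2 ⟨i, rfl, hi⟩, rfl⟩
  · rintro ⟨j, hj, rfl⟩
    obtain ⟨i, rfl, hi⟩ := (key j).1 hj
    exact ⟨i, hi, rfl⟩

lemma cell_free_congr {n : SimplexCategory} {σ τ : Fin (n.len + 1) → G}
    {p : stdSimplex ℝ (Fin (n.len + 1))} (h : ∀ i, 0 < p i → σ i = τ i) :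
    cell (freeSimplex σ) p = cell (freeSimplex τ) p := by
  have hp : stdSimplex.map (retr (posSet p) (posSet_nonempty p)) p = p :=
    stdSimplex_map_eq_self fun i hi => retr_eq _ _ (by simpa [posSet] using hi)
  have e : σ ∘ retr (posSet p) (posSet_nonempty p) = τ ∘ retr (posSet p) (posSet_nonempty p) := by
    funext i
    have := retr_mem (posSet p) (posSet_nonempty p) i
    exact h _ (by simpa [posSet] using this)
  rw [← hp, ← cell_free_map, ← cell_free_map, e]

lemma supp_cell {n : SimplexCategory} {σ : Fin (n.len + 1) → G}
    {p : stdSimplex ℝ (Fin (n.len + 1))} :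
    supp (cell (freeSimplex σ) p) = σ '' {i | 0 < p i} := by
  ext t
  rw [mem_supp_cell]
  exact ⟨fun ⟨v, h1, h2⟩ => ⟨v, h2, h1⟩, fun ⟨v, h1, h2⟩ => ⟨v, h2, h1⟩⟩

end Support

/-! ### Vietoris-Rips realizations as closed subspaces of the free space -/

section Embedding

variable {G : Type u} [Group G] (ℓ : G → ℕ) (T : Set G) (k : ℕ)

/-- The set `S` is contained in `T` and has diameter at most `k`. -/
def Clique (S : Set G) : Prop := S ⊆ T ∧ ∀ a ∈ S, ∀ b ∈ S, ℓ (a⁻¹ * b) ≤ k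

variable {ℓ T k}

lemma Clique.mono {S S' : Set G} (h : Clique ℓ T k S') (hS : S ⊆ S') : Clique ℓ T k S :=
  ⟨hS.trans h.1, fun a ha b hb => h.2 a (hS ha) b (hS hb)⟩

variable (ℓ T k) in
/-- The realization of the Vietoris-Rips complex. -/
abbrev VRSpace : Type u := SSet.toTop.obj (vietorisRips ℓ T k).toSSet

variable (ℓ T k) in
/-- The inclusion of the realization of the Vietoris-Rips complex in that of the free simplicial
set. -/
def inclE : C(VRSpace ℓ T k, FreeSpace G) := (SSet.toTop.map (vietorisRips ℓ T k).ι).hom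

/-- A tuple with range a clique as a simplex of the Vietoris-Rips complex. -/
def vrSimplex {n : SimplexCategory} (σ : Fin (n.len + 1) → G) (h : Clique ℓ T k (Set.range σ)) :
    (vietorisRips ℓ T k).toSSet.obj (op n) :=
  ⟨σ, fun i => h.1 ⟨i, rfl⟩, fun i j => h.2 _ ⟨i, rfl⟩ _ ⟨j, rfl⟩⟩

lemma clique_of_vr {n : SimplexCategory} (σ : (vietorisRips ℓ T k).toSSet.obj (op n)) :
    Clique ℓ T k (Set.range (show Fin (n.len + 1) → G from σ.1)) := by
  refine ⟨?_, ?_⟩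
  · rintro _ ⟨i, rfl⟩; exact σ.2.1 i
  · rintro _ ⟨i, rfl⟩ _ ⟨j, rfl⟩; exact σ.2.2 i j

lemma inclE_cell {n : SimplexCategory} (σ : Fin (n.len + 1) → G)
    (h : Clique ℓ T k (Set.range σ)) (p : stdSimplex ℝ (Fin (n.len + 1))) :
    inclE ℓ T k (cell (vrSimplex σ h) p) = cell (freeSimplex σ) p :=
  toTop_map_cell _ _ _

lemma exists_vr_cell (x : VRSpace ℓ T k) : ∃ (n : SimplexCategory) (σ : Fin (n.len + 1) → G)
    (h : Clique ℓ T k (Set.range σ)) (p : stdSimplex ℝ (Fin (n.len + 1))),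
      cell (vrSimplex σ h) p = x := by
  obtain ⟨n, σ, p, rfl⟩ := exists_cell x
  exact ⟨n, σ.1, clique_of_vr σ, p, rfl⟩

lemma Clique.comp {α β : Type*} {σ : α → G} (h : Clique ℓ T k (Set.range σ)) (f : β → α) :
    Clique ℓ T k (Set.range (σ ∘ f)) :=
  h.mono (Set.range_comp_subset_range f σ)

lemma cell_vr_map {n m : SimplexCategory} (f : Fin (n.len + 1) →o Fin (m.len + 1))
    (σ : Fin (m.len + 1) → G) (h : Clique ℓ T k (Set.range σ))
    (p : stdSimplex ℝ (Fin (n.len + 1))) :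
    cell (vrSimplex (σ ∘ f) (h.comp f)) p = cell (vrSimplex σ h) (stdSimplex.map f p) :=
  cell_map (SimplexCategory.Hom.mk f) (vrSimplex σ h) p

lemma cell_vr_congr {n : SimplexCategory} {σ τ : Fin (n.len + 1) → G}
    (hσ : Clique ℓ T k (Set.range σ)) (hτ : Clique ℓ T k (Set.range τ))
    {p : stdSimplex ℝ (Fin (n.len + 1))} (h : ∀ i, 0 < p i → σ i = τ i) :
    cell (vrSimplex σ hσ) p = cell (vrSimplex τ hτ) p := by
  have hp : stdSimplex.map (retr (posSet p) (posSet_nonempty p)) p = p :=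
    stdSimplex_map_eq_self fun i hi => retr_eq _ _ (by simpa [posSet] using hi)
  have e : σ ∘ retr (posSet p) (posSet_nonempty p) = τ ∘ retr (posSet p) (posSet_nonempty p) := by
    funext i
    have := retr_mem (posSet p) (posSet_nonempty p) i
    exact h _ (by simpa [posSet] using this)
  rw [← hp, ← cell_vr_map, ← cell_vr_map]
  congr 2
  exact Subtype.ext e

-- A left inverse of `inclE`, defined exactly on the points whose support is a clique. The tuple is
-- first retracted to the indices of positive weight, because a tuple representing such a point in
-- the free space may also have entries outside the clique.
open Classical in
lemma exists_partial_inverse : ∃ F : FreeSpace G → Option (VRSpace ℓ T k),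
    ∀ (n : SimplexCategory) (σ : Fin (n.len + 1) → G) (p : stdSimplex ℝ (Fin (n.len + 1))),
      F (cell (freeSimplex σ) p) =
        if h : Clique ℓ T k (Set.range (σ ∘ retr (posSet p) (posSet_nonempty p))) then
          some (cell (vrSimplex _ h) p) else none := by
  refine exists_desc_fun (X := freeSSet G) (fun n (σ : Fin (n.len + 1) → G) p =>
    if h : Clique ℓ T k (Set.range (σ ∘
      retr (posSet p) (posSet_nonempty p))) then
          some (cell (vrSimplex _ h) p) else none) ?_
  intro n m f σ p
  set σ' : Fin (m.len + 1) → G := σ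
  change (if h : Clique ℓ T k (Set.range ((σ' ∘ f) ∘ retr (posSet p) (posSet_nonempty p))) then
    some (cell (vrSimplex _ h) p) else none) = _
  have e := image_pos_map f σ' p
  rw [← range_comp_retr, ← range_comp_retr] at e
  by_cases h : Clique ℓ T k (Set.range ((σ' ∘ f) ∘ retr (posSet p) (posSet_nonempty p)))
  · rw [dif_pos h, dif_pos (e ▸ h)]
    refine congrArg some (Eq.trans ?_ (cell_vr_map f.toOrderHom _ (e ▸ h) p))
    refine cell_vr_congr _ _ fun i hi => ?_
    rw [Function.comp_apply, retr_eq _ _ (by simpa [posSet] using hi), Function.comp_apply,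
      Function.comp_apply, Function.comp_apply, retr_eq]
    · rfl
    · rw [posSet, Finset.mem_filter]
      refine ⟨Finset.mem_univ _, ?_⟩
      rw [stdSimplex_map_apply]
      refine hi.trans_le ?_
      have := Finset.single_le_sum (f := fun x => if f x = f i then p x else 0)
        (fun w _ => by split_ifs <;> simp) (Finset.mem_univ i)
      rw [if_pos rfl] at this
      exact this
  · rw [dif_neg h, dif_neg (by rwa [← e])]

lemma inclE_injective : Function.Injective (inclE ℓ T k) := by
  obtain ⟨F, hF⟩ := exists_partial_inverse (ℓ := ℓ) (T := T) (k := k)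
  have key : ∀ x, F (inclE ℓ T k x) = some x := fun x => by
    obtain ⟨n, σ, h, p, rfl⟩ := exists_vr_cell x
    rw [inclE_cell, hF, dif_pos (h.comp _)]
    congr 1
    refine cell_vr_congr _ _ fun i hi => ?_
    rw [Function.comp_apply, retr_eq _ _ (by simpa [posSet] using hi)]
  intro x y h
  have := key x
  rw [h, key y] at this
  exact (Option.some.inj this).symm

lemma clique_supp_inclE (x : VRSpace ℓ T k) : Clique ℓ T k (supp (inclE ℓ T k x)) := by
  obtain ⟨n, σ, h, p, rfl⟩ := exists_vr_cell x
  rw [inclE_cell, supp_cell]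
  exact h.mono (Set.image_subset_range _ _)

lemma exists_inclE_eq {x : FreeSpace G} (hx : Clique ℓ T k (supp x)) :
    ∃ y, inclE ℓ T k y = x := by
  obtain ⟨n, σ, p, rfl⟩ := exists_free_cell x
  rw [supp_cell, ← range_comp_retr] at hx
  refine ⟨cell (vrSimplex _ hx) p, ?_⟩
  rw [inclE_cell]
  refine cell_free_congr fun i hi => ?_
  rw [Function.comp_apply, retr_eq _ _ (by simpa [posSet] using hi)]

/-- On a single simplex of the free space the image of a closed set is a finite union over the faces
whose vertices form a clique. On each such face it is cut out by vanishing coordinates and by the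
preimage of `C` under a cell map. -/
lemma inclE_isClosedMap : IsClosedMap (inclE ℓ T k) := by
  intro C hC
  refine isClosed_of_cell fun n σ => ?_
  set σ' : Fin (n.len + 1) → G := σ
  have e : cell σ ⁻¹' (inclE ℓ T k '' C) =
      ⋃ S : {S : Finset (Fin (n.len + 1)) // ∃ hS : S.Nonempty,
        Clique ℓ T k (Set.range (σ' ∘ retr S hS))},
        {p | (∀ i, i ∉ S.1 → p i = 0) ∧ cell (vrSimplex _ S.2.choose_spec) p ∈ C} := by
    ext p
    simp only [Set.mem_preimage, Set.mem_iUnion, Set.mem_ofPred_eq]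
    constructor
    · rintro ⟨c, hc, hcp⟩
      have hcl := clique_supp_inclE c
      rw [hcp] at hcl
      have hcl' : Clique ℓ T k (Set.range (σ' ∘ retr (posSet p) (posSet_nonempty p))) := by
        rw [range_comp_retr, ← supp_cell]; exact hcl
      refine ⟨⟨posSet p, posSet_nonempty p, hcl'⟩, fun i hi => ?_, ?_⟩
      · by_contra hne
        exact hi (by simpa [posSet] using lt_of_le_of_ne (stdSimplex.zero_le p i) (Ne.symm hne))
      · convert hc
        apply inclE_injective
        rw [inclE_cell, hcp]
        refine cell_free_congr (τ := σ') fun i hi => ?_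
        rw [Function.comp_apply, retr_eq _ _ (by simpa [posSet] using hi)]
    · rintro ⟨⟨S, hS⟩, h0, hC'⟩
      refine ⟨_, hC', ?_⟩
      rw [inclE_cell]
      refine cell_free_congr (τ := σ') fun i hi => ?_
      rw [Function.comp_apply, retr_eq]
      by_contra hne
      exact absurd (h0 i hne) hi.ne'
  rw [e]
  refine isClosed_iUnion_of_finite fun S => ?_
  refine IsClosed.inter ?_ (hC.preimage (cell _).continuous)
  change IsClosed {p : stdSimplex ℝ (Fin (n.len + 1)) | ∀ i, i ∉ S.1 → p i = 0}
  simp only [Set.ofPred_forall]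
  refine isClosed_iInter fun i => isClosed_iInter fun _ => isClosed_eq ?_ continuous_const
  exact (continuous_apply i).comp continuous_subtype_val

lemma inclE_isClosedEmbedding : Topology.IsClosedEmbedding (inclE ℓ T k) :=
  .of_continuous_injective_isClosedMap (inclE ℓ T k).continuous inclE_injective inclE_isClosedMap

/-- A continuous map to the free space whose values are supported on cliques lifts to the
Vietoris-Rips complex. -/
def liftVR {Y : Type*} [TopologicalSpace Y] (h : C(Y, FreeSpace G))
    (hh : ∀ y, Clique ℓ T k (supp (h y))) : C(Y, VRSpace ℓ T k) where
  toFun y := (exists_inclE_eq (hh y)).choose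
  continuous_toFun := by
    rw [inclE_isClosedEmbedding.isInducing.continuous_iff]
    convert h.continuous
    ext y
    exact (exists_inclE_eq (hh y)).choose_spec

@[simp]
lemma inclE_liftVR {Y : Type*} [TopologicalSpace Y] (h : C(Y, FreeSpace G))
    (hh : ∀ y, Clique ℓ T k (supp (h y))) (y : Y) : inclE ℓ T k (liftVR h hh y) = h y :=
  (exists_inclE_eq (hh y)).choose_spec

lemma inclE_realizationIncl {k l : ℕ} (h : k ≤ l) (x : VRSpace ℓ T k) :
    inclE ℓ T l (realizationIncl ℓ T h x) = inclE ℓ T k x := by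
  obtain ⟨n, σ, hσ, p, rfl⟩ := exists_vr_cell x
  rw [inclE_cell, realizationIncl, toTop_map_cell]
  exact toTop_map_cell _ _ _

end Embedding

/-! ### Straight-line homotopies from a point to a finite simplex -/

section Join

variable {T : Type u}

lemma stdSimplex_continuous_apply {V : Type*} [Fintype V] (v : V) :
    Continuous fun p : stdSimplex ℝ V => p v :=
  (continuous_apply v).comp continuous_subtype_val

/-- The convex combination of two points of a simplex. -/
def mix {V : Type*} [Fintype V] (p q : stdSimplex ℝ V) (s : unitInterval) : stdSimplex ℝ V :=
  ⟨fun v => (1 - s) * p v + s * q v, fun v => add_nonneg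
      (mul_nonneg (sub_nonneg.2 s.2.2) (stdSimplex.zero_le p v))
      (mul_nonneg s.2.1 (stdSimplex.zero_le q v)), by
    rw [Finset.sum_add_distrib, ← Finset.mul_sum, ← Finset.mul_sum]
    simp⟩

lemma mix_apply {V : Type*} [Fintype V] (p q : stdSimplex ℝ V) (s : unitInterval) (v : V) :
    mix p q s v = (1 - s) * p v + s * q v := rfl

lemma map_mix {V W : Type*} [Fintype V] [Fintype W] (f : V → W) (p q : stdSimplex ℝ V)
    (s : unitInterval) :
    stdSimplex.map f (mix p q s) = mix (stdSimplex.map f p) (stdSimplex.map f q) s := by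
  classical
  ext w
  rw [mix_apply, stdSimplex_map_apply, stdSimplex_map_apply, stdSimplex_map_apply,
    Finset.mul_sum, Finset.mul_sum, ← Finset.sum_add_distrib]
  refine Finset.sum_congr rfl fun v _ => ?_
  split_ifs <;> simp [mix_apply]

lemma mix_zero {V : Type*} [Fintype V] (p q : stdSimplex ℝ V) : mix p q 0 = p := by
  ext v; simp [mix_apply]

lemma mix_one {V : Type*} [Fintype V] (p q : stdSimplex ℝ V) : mix p q 1 = q := by
  ext v; simp [mix_apply]

lemma weight_mix {V : Type*} [Fintype V] (f : V → T) (p q : stdSimplex ℝ V) (s : unitInterval)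
    (t : T) : weight f (mix p q s) t = (1 - s) * weight f p t + s * weight f q t := by
  classical
  rw [weight, weight, weight, Finset.mul_sum, Finset.mul_sum, ← Finset.sum_add_distrib]
  refine Finset.sum_congr rfl fun v _ => ?_
  split_ifs <;> simp [mix_apply]

lemma continuous_mix {V : Type*} [Fintype V] :
    Continuous fun z : stdSimplex ℝ V × stdSimplex ℝ V × unitInterval => mix z.1 z.2.1 z.2.2 := by
  refine Continuous.subtype_mk (continuous_pi fun v => ?_) _
  have h1 : Continuous fun z : stdSimplex ℝ V × stdSimplex ℝ V × unitInterval => z.1 v :=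
    (stdSimplex_continuous_apply v).comp continuous_fst
  have h2 : Continuous fun z : stdSimplex ℝ V × stdSimplex ℝ V × unitInterval => z.2.1 v :=
    (stdSimplex_continuous_apply v).comp (continuous_fst.comp continuous_snd)
  fun_prop

/-- The simplex of the join of two simplices, as an object of the simplex category. -/
abbrev joinDim (n : SimplexCategory) (N : ℕ) : SimplexCategory := SimplexCategory.mk (n.len + 1 + N)

/-- The inclusion of the first simplex in the join. -/
def joinLeft (n : SimplexCategory) (N : ℕ) : Fin (n.len + 1) →o Fin ((joinDim n N).len + 1) where
  toFun := Fin.castAdd (N + 1)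
  monotone' _ _ h := h

/-- The inclusion of the second simplex in the join. -/
def joinRight (n : SimplexCategory) (N : ℕ) :
    Fin ((SimplexCategory.mk N).len + 1) →o Fin ((joinDim n N).len + 1) where
  toFun := Fin.natAdd (n.len + 1)
  monotone' _ _ h := Nat.add_le_add_left h _

/-- The concatenation of two tuples. -/
def joinTuple {n : SimplexCategory} {N : ℕ} (σ : Fin (n.len + 1) → T) (a : Fin (N + 1) → T) :
    Fin ((joinDim n N).len + 1) → T :=
  Fin.append (m := n.len + 1) (n := N + 1) σ a

lemma joinTuple_left {n : SimplexCategory} {N : ℕ} (σ : Fin (n.len + 1) → T)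
    (a : Fin (N + 1) → T) : joinTuple σ a ∘ joinLeft n N = σ :=
  funext fun i => Fin.append_left (m := n.len + 1) (n := N + 1) σ a i

lemma joinTuple_right {n : SimplexCategory} {N : ℕ} (σ : Fin (n.len + 1) → T)
    (a : Fin (N + 1) → T) : joinTuple σ a ∘ joinRight n N = a :=
  funext fun i => Fin.append_right (m := n.len + 1) (n := N + 1) σ a i

/-- The join of a monotone map with an identity. -/
def joinMap {n m : SimplexCategory} (f : Fin (n.len + 1) →o Fin (m.len + 1)) (N : ℕ) :
    Fin ((joinDim n N).len + 1) →o Fin ((joinDim m N).len + 1) where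
  toFun := Fin.append (m := n.len + 1) (n := N + 1) (Fin.castAdd (N + 1) ∘ f) (Fin.natAdd (m.len + 1))
  monotone' := by
    intro i j
    refine Fin.addCases (m := n.len + 1) (n := N + 1) (fun i => ?_) (fun i => ?_) i <;>
      refine Fin.addCases (m := n.len + 1) (n := N + 1) (fun j => ?_) (fun j => ?_) j <;> intro h
    · rw [Fin.append_left, Fin.append_left]
      exact f.monotone h
    · rw [Fin.append_left, Fin.append_right]
      have := (f i).2
      simp only [Fin.le_def, Function.comp_apply, Fin.val_castAdd, Fin.val_natAdd]
      lia
    · have := j.2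
      simp only [Fin.le_def, Fin.val_castAdd, Fin.val_natAdd] at h
      lia
    · rw [Fin.append_right, Fin.append_right]
      simp only [Fin.le_def, Fin.val_natAdd] at h ⊢
      lia

lemma joinMap_left {n m : SimplexCategory} (f : Fin (n.len + 1) →o Fin (m.len + 1)) (N : ℕ) :
    joinMap f N ∘ joinLeft n N = joinLeft m N ∘ f :=
  funext fun i => Fin.append_left (m := n.len + 1) (n := N + 1) _ _ i

lemma joinMap_right {n m : SimplexCategory} (f : Fin (n.len + 1) →o Fin (m.len + 1)) (N : ℕ) :
    joinMap f N ∘ joinRight n N = joinRight m N :=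
  funext fun i => Fin.append_right (m := n.len + 1) (n := N + 1) _ _ i

lemma joinTuple_map {n m : SimplexCategory} (f : Fin (n.len + 1) →o Fin (m.len + 1)) {N : ℕ}
    (σ : Fin (m.len + 1) → T) (a : Fin (N + 1) → T) :
    joinTuple σ a ∘ joinMap f N = joinTuple (σ ∘ f) a := by
  funext i
  refine Fin.addCases (m := n.len + 1) (n := N + 1) (fun i => ?_) (fun i => ?_) i
  · have h1 := congrFun (joinMap_left f N) i
    have h2 := congrFun (joinTuple_left σ a) (f i)
    have h3 := congrFun (joinTuple_left (σ ∘ f) a) i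
    exact (congrArg (joinTuple σ a) h1).trans (h2.trans h3.symm)
  · have h1 := congrFun (joinMap_right f N) i
    have h2 := congrFun (joinTuple_right σ a) i
    have h3 := congrFun (joinTuple_right (σ ∘ f) a) i
    exact (congrArg (joinTuple σ a) h1).trans (h2.trans h3.symm)

/-- The straight line homotopy in the join of two simplices. -/
def joinPt {n : SimplexCategory} {N : ℕ} (p : stdSimplex ℝ (Fin (n.len + 1)))
    (q : stdSimplex ℝ (Fin (N + 1))) (s : unitInterval) :
    stdSimplex ℝ (Fin ((joinDim n N).len + 1)) :=
  mix (stdSimplex.map (joinLeft n N) p) (stdSimplex.map (joinRight n N) q) s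

lemma map_joinPt {n m : SimplexCategory} (f : Fin (n.len + 1) →o Fin (m.len + 1)) {N : ℕ}
    (p : stdSimplex ℝ (Fin (n.len + 1))) (q : stdSimplex ℝ (Fin (N + 1))) (s : unitInterval) :
    stdSimplex.map (joinMap f N) (joinPt p q s) = joinPt (stdSimplex.map f p) q s := by
  rw [joinPt, joinPt, map_mix, stdSimplex.map_comp_apply, stdSimplex.map_comp_apply,
    stdSimplex.map_comp_apply, joinMap_left, joinMap_right]

lemma continuous_joinPt (n : SimplexCategory) (N : ℕ) :
    Continuous fun z : stdSimplex ℝ (Fin (n.len + 1)) × stdSimplex ℝ (Fin (N + 1)) × unitInterval =>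
      joinPt z.1 z.2.1 z.2.2 :=
  continuous_mix.comp (((stdSimplex.continuous_map _).comp continuous_fst).prodMk
    (((stdSimplex.continuous_map _).comp (continuous_fst.comp continuous_snd)).prodMk
      (continuous_snd.comp continuous_snd)))

/-- The straight line homotopy from a point of the free space to the points of a simplex. -/
def joinCurried {N : ℕ} (a : Fin (N + 1) → T) :
    C(FreeSpace T, C(stdSimplex ℝ (Fin (N + 1)) × unitInterval, FreeSpace T)) :=
  -- A product with a realization is not glued directly. The homotopy is glued as a map into a
  -- function space instead, and uncurrying remains continuous because the parameter space is
  -- locally compact.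
  desc (X := freeSSet T) (fun n (σ : Fin (n.len + 1) → T) => ContinuousMap.curry
      ⟨fun z : stdSimplex ℝ (Fin (n.len + 1)) × stdSimplex ℝ (Fin (N + 1)) × unitInterval =>
        cell (freeSimplex (joinTuple σ a)) (joinPt z.1 z.2.1 z.2.2),
      (cell _).continuous.comp (continuous_joinPt n N)⟩) (fun n m f σ p => by
    ext z
    change cell (freeSimplex (joinTuple ((show Fin (m.len + 1) → T from σ) ∘ f.toOrderHom) a))
      (joinPt p z.1 z.2) = cell (freeSimplex (joinTuple (show Fin (m.len + 1) → T from σ) a))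
        (joinPt (stdSimplex.map f.toOrderHom p) z.1 z.2)
    rw [← joinTuple_map, cell_free_map (joinMap f.toOrderHom N), map_joinPt])

lemma joinCurried_cell {N : ℕ} (a : Fin (N + 1) → T) {n : SimplexCategory}
    (σ : Fin (n.len + 1) → T) (p : stdSimplex ℝ (Fin (n.len + 1)))
    (q : stdSimplex ℝ (Fin (N + 1))) (s : unitInterval) :
    joinCurried a (cell (freeSimplex σ) p) (q, s) =
      cell (freeSimplex (joinTuple σ a)) (joinPt p q s) := by
  exact DFunLike.congr_fun (desc_cell (X := freeSSet T) _ _ (freeSimplex σ) p) (q, s)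

variable {V : Type*} [Fintype V] [Nonempty V]

/-- An enumeration of a nonempty finite type. -/
def enumV (V : Type*) [Fintype V] [Nonempty V] : V ≃ Fin ((Fintype.card V - 1) + 1) :=
  Fintype.equivFinOfCardEq (Nat.sub_add_cancel Fintype.card_pos).symm

/-- The simplex spanned by a finite family of points. -/
def real (f : V → T) : C(stdSimplex ℝ V, FreeSpace T) where
  toFun w := cell (n := SimplexCategory.mk (Fintype.card V - 1))
    (freeSimplex (f ∘ (enumV V).symm)) (stdSimplex.map (enumV V) w)
  continuous_toFun := (cell _).continuous.comp (stdSimplex.continuous_map _)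

lemma lam_real (f : V → T) (w : stdSimplex ℝ V) : lam (real f w) = weight f w := by
  have : lam (real f w) = weight (f ∘ (enumV V).symm) (stdSimplex.map (enumV V) w) :=
    lam_cell _ _
  ext t
  rw [this, weight_map]
  congr 1
  ext v; simp

/-- The straight line homotopy from a point of the free space to the points of a simplex. -/
def join (f : V → T) : C(FreeSpace T × stdSimplex ℝ V × unitInterval, FreeSpace T) :=
  (ContinuousMap.uncurry (joinCurried (f ∘ (enumV V).symm))).comp
    ⟨fun z => (z.1, stdSimplex.map (enumV V) z.2.1, z.2.2),
      continuous_fst.prodMk (((stdSimplex.continuous_map _).comp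
        (continuous_fst.comp continuous_snd)).prodMk (continuous_snd.comp continuous_snd))⟩

lemma join_apply (f : V → T) (x : FreeSpace T) (w : stdSimplex ℝ V) (s : unitInterval) :
    join f (x, w, s) = joinCurried (f ∘ (enumV V).symm) x (stdSimplex.map (enumV V) w, s) := rfl

lemma join_zero (f : V → T) (x : FreeSpace T) (w : stdSimplex ℝ V) : join f (x, w, 0) = x := by
  obtain ⟨n, σ, p, rfl⟩ := exists_free_cell x
  rw [join_apply, joinCurried_cell, joinPt, mix_zero, ← cell_free_map, joinTuple_left]

lemma join_one (f : V → T) (x : FreeSpace T) (w : stdSimplex ℝ V) :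
    join f (x, w, 1) = real f w := by
  obtain ⟨n, σ, p, rfl⟩ := exists_free_cell x
  rw [join_apply, joinCurried_cell, joinPt, mix_one]
  have := cell_free_map (n := SimplexCategory.mk (Fintype.card V - 1)) (joinRight n _)
    (joinTuple σ (f ∘ (enumV V).symm)) (stdSimplex.map (enumV V) w)
  rw [← this, joinTuple_right]
  rfl

lemma lam_join (f : V → T) (x : FreeSpace T) (w : stdSimplex ℝ V) (s : unitInterval) (t : T) :
    lam (join f (x, w, s)) t = (1 - s) * lam x t + s * weight f w t := by
  obtain ⟨n, σ, p, rfl⟩ := exists_free_cell x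
  rw [join_apply, joinCurried_cell, joinPt, lam_cell, weight_mix, weight_map, weight_map,
    joinTuple_left, lam_cell]
  have h : weight (joinTuple σ (f ∘ (enumV V).symm) ∘ joinRight n (Fintype.card V - 1))
      (stdSimplex.map (enumV V) w) t = weight f w t := by
    rw [joinTuple_right, weight_map]
    congr 1
    ext v; simp
  rw [h]

lemma supp_real (f : V → T) (w : stdSimplex ℝ V) : supp (real f w) = f '' {v | 0 < w v} := by
  ext t
  rw [supp, Set.mem_ofPred_eq, lam_real, weight_pos_iff fun _ => stdSimplex.zero_le w _]
  exact ⟨fun ⟨v, h1, h2⟩ => ⟨v, h2, h1⟩, fun ⟨v, h1, h2⟩ => ⟨v, h2, h1⟩⟩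

lemma supp_join_subset (f : V → T) (x : FreeSpace T) (w : stdSimplex ℝ V) (s : unitInterval) :
    supp (join f (x, w, s)) ⊆ supp x ∪ f '' {v | 0 < w v} := by
  intro t ht
  rw [← supp_real]
  by_contra h
  rw [Set.mem_union, not_or, supp, supp, Set.mem_ofPred_eq, Set.mem_ofPred_eq, not_lt, not_lt,
    lam_real] at h
  rw [supp, Set.mem_ofPred_eq, lam_join] at ht
  have h1 : (1 - (s : ℝ)) * lam x t ≤ 0 :=
    mul_nonpos_of_nonneg_of_nonpos (sub_nonneg.2 s.2.2) h.1
  have h2 : (s : ℝ) * weight f w t ≤ 0 := mul_nonpos_of_nonneg_of_nonpos s.2.1 h.2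
  linarith

end Join

/-! ### From null-homotopic loops to extensions over the ball -/

section SphereFilling

open unitInterval

/-- The open embedding of `ℝ^q` as the interior of the unit cube. -/
def cubeChart (q : ℕ) (x : Fin q → ℝ) : Fin q → I := fun i =>
  ⟨Real.arctan (x i) / Real.pi + 1 / 2, by
    have hpi := Real.pi_pos
    have h1 := Real.neg_pi_div_two_lt_arctan (x i)
    have h2 := Real.arctan_lt_pi_div_two (x i)
    have e : Real.arctan (x i) = Real.pi * (Real.arctan (x i) / Real.pi) := by field_simp
    constructor <;> nlinarith⟩

lemma continuous_cubeChart (q : ℕ) : Continuous (cubeChart q) := by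
  refine continuous_pi fun i => Continuous.subtype_mk ?_ _
  have : Continuous fun x : Fin q → ℝ => Real.arctan (x i) :=
    Real.continuous_arctan.comp (continuous_apply i)
  fun_prop

lemma cubeChart_injective (q : ℕ) : Function.Injective (cubeChart q) := by
  intro x y h
  funext i
  have := congrArg Subtype.val (congrFun h i)
  simp only [cubeChart, add_left_inj] at this
  have hpi := Real.pi_pos
  exact Real.arctan_injective ((div_left_inj' hpi.ne').1 this)

/-- The inverse of the chart of the interior of the cube. -/
def cubeChartInv (q : ℕ) (u : Fin q → I) : Fin q → ℝ := fun i =>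
  Real.tan (Real.pi * ((u i : ℝ) - 1 / 2))

lemma not_boundary_iff {q : ℕ} {u : Fin q → I} :
    u ∉ Cube.boundary (Fin q) ↔ ∀ i, 0 < (u i : ℝ) ∧ (u i : ℝ) < 1 := by
  constructor
  · intro h i
    constructor
    · refine lt_of_le_of_ne (u i).2.1 fun h0 => h ⟨i, Or.inl (Subtype.ext h0.symm)⟩
    · refine lt_of_le_of_ne (u i).2.2 fun h0 => h ⟨i, Or.inr (Subtype.ext h0)⟩
  · rintro h ⟨i, hi | hi⟩
    · have := (h i).1; rw [hi] at this; simp at this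
    · have := (h i).2; rw [hi] at this; simp at this

lemma cubeChart_not_boundary (q : ℕ) (x : Fin q → ℝ) : cubeChart q x ∉ Cube.boundary (Fin q) := by
  rw [not_boundary_iff]
  intro i
  have hpi := Real.pi_pos
  have h1 := Real.neg_pi_div_two_lt_arctan (x i)
  have h2 := Real.arctan_lt_pi_div_two (x i)
  have e : Real.arctan (x i) = Real.pi * (Real.arctan (x i) / Real.pi) := by field_simp
  simp only [cubeChart]
  constructor <;> nlinarith

lemma cubeChart_inv {q : ℕ} {u : Fin q → I} (h : u ∉ Cube.boundary (Fin q)) :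
    cubeChart q (cubeChartInv q u) = u := by
  rw [not_boundary_iff] at h
  funext i
  apply Subtype.ext
  have hpi := Real.pi_pos
  have := h i
  simp only [cubeChart, cubeChartInv]
  rw [Real.arctan_tan (by nlinarith) (by nlinarith)]
  field_simp
  ring

lemma isOpen_compl_boundary (q : ℕ) : IsOpen (Cube.boundary (Fin q))ᶜ := by
  have : (Cube.boundary (Fin q))ᶜ = ⋂ i, {u : Fin q → I | 0 < (u i : ℝ) ∧ (u i : ℝ) < 1} := by
    ext u
    rw [Set.mem_compl_iff, not_boundary_iff, Set.mem_iInter]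
    rfl
  rw [this]
  refine isOpen_iInter_of_finite fun i => ?_
  have hc : Continuous fun u : Fin q → I => (u i : ℝ) :=
    continuous_subtype_val.comp (continuous_apply i)
  exact (isOpen_lt continuous_const hc).inter (isOpen_lt hc continuous_const)

lemma continuousOn_cubeChartInv (q : ℕ) :
    ContinuousOn (cubeChartInv q) (Cube.boundary (Fin q))ᶜ := by
  refine continuousOn_pi.2 fun i => ?_
  intro u hu
  have h := not_boundary_iff.1 hu i
  have hpi := Real.pi_pos
  have hc : Real.cos (Real.pi * ((u i : ℝ) - 1 / 2)) ≠ 0 :=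
    (Real.cos_pos_of_mem_Ioo ⟨by nlinarith, by nlinarith⟩).ne'
  have hcont : Continuous fun u : Fin q → I => (u i : ℝ) :=
    continuous_subtype_val.comp (continuous_apply i)
  refine ContinuousAt.continuousWithinAt ?_
  exact (Real.continuousAt_tan.2 hc).comp (f := fun u : Fin q → I => Real.pi * ((u i : ℝ) - 1 / 2))
    (continuous_const.mul (hcont.sub continuous_const)).continuousAt

open Classical in
/-- The map collapsing the boundary of the cube to a point. -/
def collapse (q : ℕ) (u : Fin q → I) : OnePoint (Fin q → ℝ) :=
  if u ∈ Cube.boundary (Fin q) then OnePoint.infty else (cubeChartInv q u : OnePoint (Fin q → ℝ))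

lemma collapse_boundary {q : ℕ} {u : Fin q → I} (h : u ∈ Cube.boundary (Fin q)) :
    collapse q u = OnePoint.infty := if_pos h

lemma collapse_chart (q : ℕ) (x : Fin q → ℝ) : collapse q (cubeChart q x) = x := by
  have h := cubeChart_not_boundary q x
  rw [collapse, if_neg h]
  exact congrArg _ (cubeChart_injective q (cubeChart_inv h))

/-- A neighbourhood of infinity has compact complement in $\mathbb{R}^q$, whose image in the cube is
closed. An open set missing infinity pulls back inside the open interior, where the inverse chart is
continuous. -/
lemma continuous_collapse (q : ℕ) : Continuous (collapse q) := by
  refine continuous_def.2 fun s hs => ?_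
  by_cases h : OnePoint.infty ∈ s
  · have hs' := (OnePoint.isOpen_iff_of_mem h).1 hs
    have e : (collapse q ⁻¹' s)ᶜ = cubeChart q '' (((↑) : (Fin q → ℝ) → OnePoint _) ⁻¹' s)ᶜ := by
      ext u
      by_cases hu : u ∈ Cube.boundary (Fin q)
      · simp only [Set.mem_compl_iff, Set.mem_preimage, collapse_boundary hu, h, not_true,
          Set.mem_image, false_iff, not_exists, not_and]
        rintro x - rfl
        exact cubeChart_not_boundary q x hu
      · rw [← cubeChart_inv hu, (cubeChart_injective q).mem_set_image]
        simp [collapse_chart]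
    rw [← isClosed_compl_iff, e]
    exact (hs'.2.image (continuous_cubeChart q)).isClosed
  · have hs' := (OnePoint.isOpen_iff_of_notMem h).1 hs
    have e : collapse q ⁻¹' s = (Cube.boundary (Fin q))ᶜ ∩
        cubeChartInv q ⁻¹' (((↑) : (Fin q → ℝ) → OnePoint _) ⁻¹' s) := by
      ext u
      by_cases hu : u ∈ Cube.boundary (Fin q)
      · simp [collapse_boundary hu, h, hu]
      · simp [collapse, hu]
    rw [e]
    exact (continuousOn_cubeChartInv q).isOpen_inter_preimage (isOpen_compl_boundary q) hs'

/-- If `π_q` of `X` vanishes in `π_q` of `Z`, then every map from a `q`-sphere to `X` extends, as a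
map to `Z`, to the ball. -/
lemma exists_extension_ball {X Z : Type u} [TopologicalSpace X] [TopologicalSpace Z] (r : C(X, Z))
    {q : ℕ} (hvan : ∀ (x : X) (a : π_ q X x), piMap r q x a = ⟦GenLoop.const⟧)
    {ι : Type*} [Fintype ι] (hι : Fintype.card ι = q + 1)
    (b : C(Metric.sphere (0 : EuclideanSpace ℝ ι) 1, X)) :
    ∃ F : C(Metric.closedBall (0 : EuclideanSpace ℝ ι) 1, Z),
      ∀ y : Metric.sphere (0 : EuclideanSpace ℝ ι) 1,
        F ⟨y.1, Metric.sphere_subset_closedBall y.2⟩ = r (b y) := by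
  have hrank : Module.finrank ℝ (Fin q → ℝ) + 1 = Fintype.card ι := by simp [hι]
  let h := onePointEquivSphereOfFinrankEq (ι := ι) (V := Fin q → ℝ) hrank
  let x := b (h OnePoint.infty)
  let γ : GenLoop (Fin q) X x := ⟨⟨fun u => b (h (collapse q u)),
    b.continuous.comp (h.continuous.comp (continuous_collapse q))⟩, fun u hu => by
      simp only [ContinuousMap.coe_mk, collapse_boundary hu, x]⟩
  have hγ : piMap r q x ⟦γ⟧ = ⟦GenLoop.const⟧ := hvan x _
  obtain ⟨H⟩ : GenLoop.Homotopic _ _ := Quotient.exact hγ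
  have H0 : ∀ u, H (0, u) = r (b (h (collapse q u))) := fun u => H.apply_zero u
  have H1 : ∀ u, H (1, u) = r x := fun u => H.apply_one u
  have Hb : ∀ t u, u ∈ Cube.boundary (Fin q) → H (t, u) = r x := fun t u hu => by
    rw [H.eq_fst t hu]
    exact congrArg (fun z => r (b (h z))) (collapse_boundary hu)
  let K : Type _ := Metric.closedBall (0 : EuclideanSpace ℝ ι) 1
  let cone : I → Metric.sphere (0 : EuclideanSpace ℝ ι) 1 → K := fun s y =>
    ⟨(1 - (s : ℝ)) • y.1, by
      have hy : ‖y.1‖ = 1 := by simp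
      rw [mem_closedBall_zero_iff, norm_smul, hy, mul_one, Real.norm_eq_abs,
        abs_of_nonneg (sub_nonneg.2 s.2.2)]
      linarith [s.2.1]⟩
  have cone_cont : Continuous fun z : I × Metric.sphere (0 : EuclideanSpace ℝ ι) 1 =>
      cone z.1 z.2 := by
    refine Continuous.subtype_mk ?_ _
    fun_prop
  have cone_norm : ∀ s y, ‖(cone s y).1‖ = 1 - s := fun s y => by
    have hy : ‖y.1‖ = 1 := by simp
    rw [norm_smul, hy, mul_one, Real.norm_eq_abs, abs_of_nonneg (sub_nonneg.2 s.2.2)]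
  have cone_inj : ∀ s y s' y', cone s y = cone s' y' → s = s' ∧ (s ≠ 1 → y = y') := by
    intro s y s' y' e
    have h1 := cone_norm s y
    rw [e, cone_norm] at h1
    have hs : s = s' := Subtype.ext (by linarith)
    subst hs
    refine ⟨rfl, fun hs1 => ?_⟩
    have hne : (1 - (s : ℝ)) ≠ 0 := fun h0 => hs1 (Subtype.ext (by
      rw [Set.Icc.coe_one]; linarith))
    exact Subtype.ext (smul_right_injective _ hne (congrArg Subtype.val e))
  -- The ball is a quotient of a compact space: the cone over the collapsed cube. The second summand
  -- covers the ray to infinity, which the cube misses when `q = 0` because its boundary is then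
  -- empty.
  let Q₀ : (I × (Fin q → I)) ⊕ I → K := Sum.elim (fun z => cone z.1 (h (collapse q z.2)))
    (fun s => cone s (h OnePoint.infty))
  have Qcont : Continuous Q₀ := by
    refine continuous_sum_dom.2 ⟨?_, ?_⟩
    · exact cone_cont.comp (continuous_fst.prodMk
        (h.continuous.comp ((continuous_collapse q).comp continuous_snd)))
    · exact cone_cont.comp (continuous_id.prodMk continuous_const)
  let Q : C((I × (Fin q → I)) ⊕ I, K) := ⟨Q₀, Qcont⟩
  have cone_surj : ∀ z : K, ∃ s y, cone s y = z := by
    intro z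
    by_cases hz : z.1 = 0
    · refine ⟨1, h OnePoint.infty, Subtype.ext ?_⟩
      simp [cone, hz]
    · have hz' : ‖z.1‖ ≠ 0 := norm_ne_zero_iff.2 hz
      refine ⟨⟨1 - ‖z.1‖, sub_nonneg.2 (mem_closedBall_zero_iff.1 z.2),
        by linarith [norm_nonneg z.1]⟩, ⟨‖z.1‖⁻¹ • z.1, ?_⟩, Subtype.ext ?_⟩
      · rw [mem_sphere_zero_iff_norm, norm_smul, norm_inv, norm_norm, inv_mul_cancel₀ hz']
      · simp [cone, smul_smul, hz']
  have Qsurj : Function.Surjective Q := by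
    intro z
    obtain ⟨s, y, rfl⟩ := cone_surj z
    obtain ⟨w, rfl⟩ := h.surjective y
    induction w using OnePoint.rec with
    | infty => exact ⟨Sum.inr s, rfl⟩
    | coe v => exact ⟨Sum.inl (s, cubeChart q v), by
        change cone s (h (collapse q (cubeChart q v))) = _
        rw [collapse_chart]⟩
  have hQ : Topology.IsQuotientMap Q := Topology.IsQuotientMap.of_surjective_continuous Qsurj Q.continuous
  let H' : C((I × (Fin q → I)) ⊕ I, Z) := ⟨Sum.elim (fun z => H z) (fun _ => r x),
    continuous_sum_dom.2 ⟨H.continuous, continuous_const⟩⟩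
  -- Two points with the same image have the same cone parameter. They agree below the apex up to
  -- collapsing the boundary, where `H` is constant, and at the apex `H` is constant everywhere.
  have hfib : ∀ ⦃a c⦄, Q a = Q c → H' a = H' c := by
    have aux : ∀ (s : I) (u : Fin q → I) (y : Metric.sphere (0 : EuclideanSpace ℝ ι) 1) (s' : I),
        cone s (h (collapse q u)) = cone s' y → y = h OnePoint.infty → H (s, u) = r x := by
      intro s u y s' e hy
      obtain ⟨rfl, h2⟩ := cone_inj _ _ _ _ e
      by_cases hs : s = 1
      · rw [hs, H1]
      · refine Hb s u ?_
        by_contra hu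
        have := h2 hs
        rw [hy] at this
        have := h.injective this
        simp [collapse, hu] at this
    rintro (⟨s, u⟩ | s) (⟨s', u'⟩ | s') e
    · change H (s, u) = H (s', u')
      obtain ⟨hs, h2⟩ := cone_inj _ _ _ _ e
      subst hs
      by_cases hs : s = 1
      · rw [hs, H1, H1]
      · have h3 := h.injective (h2 hs)
        by_cases hu : u ∈ Cube.boundary (Fin q)
        · rw [Hb s u hu]
          exact (aux s u' (h OnePoint.infty) s (by
            rw [← h3, collapse_boundary hu]) rfl).symm
        · by_cases hu' : u' ∈ Cube.boundary (Fin q)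
          · simp [collapse, hu, hu'] at h3
          · simp only [collapse, hu, hu', if_false, OnePoint.coe_eq_coe] at h3
            rw [← cubeChart_inv hu, h3, cubeChart_inv hu']
    · exact aux s u _ s' e rfl
    · exact (aux s' u' _ s e.symm rfl).symm
    · rfl
  refine ⟨hQ.lift H' @hfib, fun y => ?_⟩
  obtain ⟨w, rfl⟩ := h.surjective y
  have lift_eq : ∀ a, hQ.lift H' @hfib (Q a) = H' a := fun a =>
    DFunLike.congr_fun (hQ.lift_comp H' @hfib) a
  induction w using OnePoint.rec with
  | infty =>
    refine Eq.trans ?_ (lift_eq (Sum.inr 0))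
    congr 1
    exact Subtype.ext (by simp [Q, Q₀, cone])
  | coe v =>
    refine Eq.trans ?_ ((lift_eq (Sum.inl (0, cubeChart q v))).trans ?_)
    · congr 1
      exact Subtype.ext (by simp [Q, Q₀, cone, collapse_chart])
    · change H (0, cubeChart q v) = _
      rw [H0, collapse_chart]

end SphereFilling

/-! ### Boxes in place of balls -/

section Box

variable {ι : Type*} [Fintype ι]

/-- The box `[0, M]^ι`. -/
def box (ι : Type*) (M : ℝ) : Set (ι → ℝ) := {y | ∀ i, 0 ≤ y i ∧ y i ≤ M}

/-- The boundary of the box `[0, M]^ι`. -/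
def boxBdry (ι : Type*) (M : ℝ) : Set (ι → ℝ) := {y | y ∈ box ι M ∧ ∃ i, y i = 0 ∨ y i = M}

/-- A bounded convex set with nonempty interior is carried to the unit ball by a homeomorphism of
the ambient space that respects closure and frontier. -/
lemma exists_box_homeomorph {M : ℝ} (hM : 0 < M) : ∃ e : (ι → ℝ) ≃ₜ EuclideanSpace ℝ ι,
    (∀ y, y ∈ box ι M ↔ e y ∈ Metric.closedBall (0 : EuclideanSpace ℝ ι) 1) ∧
    (∀ y, y ∈ boxBdry ι M ↔ e y ∈ Metric.sphere (0 : EuclideanSpace ℝ ι) 1) := by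
  let c : (ι → ℝ) ≃L[ℝ] EuclideanSpace ℝ ι := (EuclideanSpace.equiv ι ℝ).symm
  have hbox : box ι M = Set.univ.pi fun _ => Set.Icc 0 M := by
    ext y; simp only [box, Set.mem_pi, Set.mem_univ, true_implies, Set.mem_Icc, Set.mem_ofPred_eq]
  have hconv : Convex ℝ (box ι M) := by
    rw [hbox]; exact convex_pi fun _ _ => convex_Icc 0 M
  have hint : interior (box ι M) = Set.univ.pi fun _ => Set.Ioo 0 M := by
    rw [hbox, interior_pi_set Set.finite_univ]
    simp
  have hclosed : IsClosed (box ι M) := by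
    rw [hbox]; exact isClosed_set_pi fun _ _ => isClosed_Icc
  have hcomp : IsCompact (box ι M) := by
    rw [hbox]; exact isCompact_univ_pi fun _ => isCompact_Icc
  have himg : c.toHomeomorph '' interior (box ι M) = interior (c.toHomeomorph '' box ι M) :=
    c.toHomeomorph.image_interior _
  obtain ⟨h, h1, h2, h3⟩ := exists_homeomorph_image_interior_closure_frontier_eq_unitBall
    (E := EuclideanSpace ℝ ι) (s := c.toHomeomorph '' box ι M)
    (hconv.linear_image c.toLinearMap)
    (by
      rw [← himg]
      refine Set.Nonempty.image _ ?_
      rw [hint]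
      exact ⟨fun _ => M / 2, fun _ _ => ⟨by positivity, by linarith⟩⟩)
    (hcomp.image c.continuous).isBounded
  have hbd : frontier (box ι M) = boxBdry ι M := by
    rw [frontier, hclosed.closure_eq, hint]
    ext y
    simp only [Set.mem_sdiff, boxBdry, Set.mem_pi, Set.mem_univ, true_implies, Set.mem_Ioo,
      not_forall, Set.mem_ofPred_eq, and_congr_right_iff]
    refine fun hy => exists_congr fun i => ?_
    have := hy i
    constructor
    · intro h
      by_contra! h'
      exact h ⟨lt_of_le_of_ne this.1 (Ne.symm h'.1), lt_of_le_of_ne this.2 h'.2⟩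
    · rintro (h | h) ⟨h1, h2⟩ <;> linarith
  refine ⟨c.toHomeomorph.trans h, fun y => ?_, fun y => ?_⟩
  · rw [← h2, (hclosed.preimage c.symm.continuous |> fun H => by
      rwa [← c.toHomeomorph.isClosed_image] at hclosed : IsClosed
        (c.toHomeomorph '' box ι M)).closure_eq]
    simp
  · rw [← h3, ← c.toHomeomorph.image_frontier, hbd]
    simp

/-- If `π_q` of `X` vanishes in `π_q` of `Z`, then every map from the boundary of a
`(q+1)`-dimensional box to `X` extends, as a map to `Z`, to the box. -/
lemma exists_extension_box {X Z : Type u} [TopologicalSpace X] [TopologicalSpace Z] (r : C(X, Z))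
    {q : ℕ} (hvan : ∀ (x : X) (a : π_ q X x), piMap r q x a = ⟦GenLoop.const⟧)
    (hι : Fintype.card ι = q + 1) {M : ℝ} (hM : 0 < M) (b : C(boxBdry ι M, X)) :
    ∃ F : C(box ι M, Z), ∀ y : boxBdry ι M, F ⟨y.1, y.2.1⟩ = r (b y) := by
  obtain ⟨e, e1, e2⟩ := exists_box_homeomorph (ι := ι) hM
  obtain ⟨F, hF⟩ := exists_extension_ball r hvan hι (b.comp
    ⟨fun y => ⟨e.symm y.1, (e2 _).2 (by simp)⟩, Continuous.subtype_mk (by fun_prop) _⟩)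
  refine ⟨F.comp ⟨fun y => ⟨e y.1, (e1 _).1 y.2⟩, Continuous.subtype_mk (by fun_prop) _⟩,
    fun y => ?_⟩
  have := hF ⟨e y.1, (e2 _).1 y.2⟩
  simp only [ContinuousMap.comp_apply, ContinuousMap.coe_mk] at this ⊢
  rw [this]
  congr 2
  simp

end Box

/-! ### Lattice points and their coarsening by powers of three -/

section Lattice

/-- Adjacency of lattice points: the coordinates differ by at most one. -/
def Adj {ι : Type*} (v w : ι → ℤ) : Prop := ∀ i, |v i - w i| ≤ 1

lemma Adj.refl {ι : Type*} (v : ι → ℤ) : Adj v v := fun i => by simp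

lemma Adj.symm {ι : Type*} {v w : ι → ℤ} (h : Adj v w) : Adj w v := fun i => by
  rw [abs_sub_comm]; exact h i

/-- Division by three, rounding to the nearest integer. -/
def third (x : ℤ) : ℤ := (x + 1) / 3

/-- The coarsening of the lattice by a factor `3 ^ j`, rounding to the nearest point. -/
def coarse {ι : Type*} (j : ℕ) (v : ι → ℤ) : ι → ℤ := fun i => third^[j] (v i)

lemma third_iterate_add (j : ℕ) (x a : ℤ) : third^[j] (x + 3 ^ j * a) = third^[j] x + a := by
  induction j generalizing x with
  | zero => simp
  | succ j ih =>
    rw [Function.iterate_succ_apply, Function.iterate_succ_apply, ← ih]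
    congr 1
    simp only [third, pow_succ]
    lia

lemma third_iterate_zero (j : ℕ) : third^[j] 0 = 0 := by
  induction j with
  | zero => rfl
  | succ j ih => rw [Function.iterate_succ_apply]; exact ih

lemma third_iterate_mul (j : ℕ) (a : ℤ) : third^[j] (3 ^ j * a) = a := by
  have := third_iterate_add j 0 a
  rwa [zero_add, third_iterate_zero, zero_add] at this

/-- Rounding errors accumulate as $1+3\cdot(3^j-1)/2=(3^{j+1}-1)/2$, so iterated rounding is still
rounding to the nearest point. An odd factor excludes ties. -/
lemma third_iterate_near (j : ℕ) (x : ℤ) : 2 * |x - 3 ^ j * third^[j] x| < 3 ^ j := by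
  induction j generalizing x with
  | zero => simp
  | succ j ih =>
    rw [Function.iterate_succ_apply, pow_succ]
    have h1 := ih (third x)
    have h2 : |x - 3 * third x| ≤ 1 := by simp only [third]; rw [abs_le]; lia
    have h3 : x - 3 ^ j * 3 * third^[j] (third x) =
      (x - 3 * third x) + 3 * (third x - 3 ^ j * third^[j] (third x)) := by ring
    rw [h3]
    have h4 := abs_add_le (x - 3 * third x) (3 * (third x - 3 ^ j * third^[j] (third x)))
    rw [abs_mul, abs_of_pos (by norm_num : (0 : ℤ) < 3)] at h4
    lia

lemma third_iterate_mono (j : ℕ) : Monotone third^[j] := by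
  refine Monotone.iterate ?_ j
  intro x y h
  simp only [third]
  lia

lemma third_iterate_adj (j : ℕ) {x y : ℤ} (h : |x - y| ≤ 1) : |third^[j] x - third^[j] y| ≤ 1 := by
  induction j generalizing x y with
  | zero => exact h
  | succ j ih =>
    rw [Function.iterate_succ_apply, Function.iterate_succ_apply]
    apply ih
    simp only [third]
    rw [abs_le] at h ⊢
    lia

lemma coarse_coarse {ι : Type*} (i j : ℕ) (v : ι → ℤ) :
    coarse i (coarse j v) = coarse (i + j) v :=
  funext fun a => (Function.iterate_add_apply third i j (v a)).symm

@[simp]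
lemma coarse_zero {ι : Type*} (v : ι → ℤ) : coarse 0 v = v := rfl

lemma Adj.coarse {ι : Type*} {v w : ι → ℤ} (h : Adj v w) (j : ℕ) :
    Adj (coarse j v) (coarse j w) := fun i => third_iterate_adj j (h i)

/-- The lattice points of the box `[0, M]^ι`. -/
def latBox (ι : Type*) (M : ℕ) : Set (ι → ℤ) := {v | ∀ i, 0 ≤ v i ∧ v i ≤ M}

/-- The lattice points of the boundary of the box `[0, M]^ι`. -/
def latBdry (ι : Type*) (M : ℕ) : Set (ι → ℤ) :=
  {v | v ∈ latBox ι M ∧ ∃ i, v i = 0 ∨ v i = M}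

/-- Adjacency of two lattice points on a common proper face of the box `[0, M]^ι`. -/
def FaceAdj {ι : Type*} (M : ℕ) (v w : ι → ℤ) : Prop :=
  v ∈ latBox ι M ∧ w ∈ latBox ι M ∧ Adj v w ∧ ∃ i, v i = w i ∧ (v i = 0 ∨ v i = M)

lemma third_iterate_mem (j : ℕ) (M : ℕ) {x : ℤ} (h : 0 ≤ x ∧ x ≤ (M * 3 ^ j : ℕ)) :
    0 ≤ third^[j] x ∧ third^[j] x ≤ M := by
  constructor
  · rw [← third_iterate_zero j]
    exact third_iterate_mono j h.1
  · have := third_iterate_mono j h.2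
    push_cast at this
    rwa [mul_comm, third_iterate_mul] at this

lemma coarse_mem_latBox {ι : Type*} (j : ℕ) {M : ℕ} {v : ι → ℤ} (h : v ∈ latBox ι (M * 3 ^ j)) :
    coarse j v ∈ latBox ι M := fun i => third_iterate_mem j M (h i)

lemma third_iterate_end (j M : ℕ) : third^[j] ((M * 3 ^ j : ℕ) : ℤ) = M := by
  push_cast
  rw [mul_comm, third_iterate_mul]

lemma coarse_mem_latBdry {ι : Type*} (j : ℕ) {M : ℕ} {v : ι → ℤ}
    (h : v ∈ latBdry ι (M * 3 ^ j)) : coarse j v ∈ latBdry ι M := by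
  refine ⟨coarse_mem_latBox j h.1, ?_⟩
  obtain ⟨i, hi | hi⟩ := h.2
  · exact ⟨i, Or.inl (by rw [coarse, hi, third_iterate_zero])⟩
  · exact ⟨i, Or.inr (by rw [coarse, hi, third_iterate_end])⟩

end Lattice

/-! ### Lengths, Lipschitz lattice maps and fillings of cubes -/

section Length

variable {G : Type u} [Group G]

/-- The properties of the restriction of a word length used below. -/
structure IsLength (ℓ : G → ℕ) : Prop where
  one : ℓ 1 = 0
  inv : ∀ g, ℓ g⁻¹ = ℓ g
  mul_le : ∀ g h, ℓ (g * h) ≤ ℓ g + ℓ h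
  finite_ball : ∀ n, {g | ℓ g ≤ n}.Finite

variable {ℓ : G → ℕ}

lemma IsLength.dist_comm (hℓ : IsLength ℓ) (a b : G) : ℓ (a⁻¹ * b) = ℓ (b⁻¹ * a) := by
  rw [← hℓ.inv, mul_inv_rev, inv_inv]

lemma IsLength.dist_self (hℓ : IsLength ℓ) (a : G) : ℓ (a⁻¹ * a) = 0 := by
  rw [inv_mul_cancel, hℓ.one]

lemma IsLength.dist_triangle (hℓ : IsLength ℓ) (a b c : G) :
    ℓ (a⁻¹ * c) ≤ ℓ (a⁻¹ * b) + ℓ (b⁻¹ * c) := by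
  have := hℓ.mul_le (a⁻¹ * b) (b⁻¹ * c)
  rwa [mul_assoc, mul_inv_cancel_left] at this

lemma dist_translate (ℓ : G → ℕ) (g a b : G) : ℓ ((g * a)⁻¹ * (g * b)) = ℓ (a⁻¹ * b) := by
  congr 1; group

/-- A map from a lattice that moves adjacent points at most `k` apart. -/
def Lip (ℓ : G → ℕ) {ι : Type*} (k : ℕ) (f : (ι → ℤ) → G) : Prop :=
  ∀ v w, Adj v w → ℓ ((f v)⁻¹ * f w) ≤ k

/-- Every lattice sphere of mesh `k` in `T`, given on the boundary of a cube, is filled, after a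
subdivision, by a lattice ball of mesh `l` in `T`. -/
def CubeFill (ℓ : G → ℕ) (T : Set G) (ι : Type) (k l : ℕ) : Prop :=
  ∀ M : ℕ, 0 < M → ∀ b : (ι → ℤ) → G, (∀ v ∈ latBdry ι M, b v ∈ T) →
    (∀ v w, FaceAdj M v w → ℓ ((b v)⁻¹ * b w) ≤ k) →
    ∃ (j : ℕ) (F : (ι → ℤ) → G), (∀ v ∈ latBox ι (M * 3 ^ j), F v ∈ T) ∧
      (∀ v ∈ latBox ι (M * 3 ^ j), ∀ w ∈ latBox ι (M * 3 ^ j), Adj v w →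
        ℓ ((F v)⁻¹ * F w) ≤ l) ∧
      ∀ v ∈ latBdry ι (M * 3 ^ j), F v = b (coarse j v)

end Length

/-! ### Multilinear interpolation of lattice maps -/

section Multilinear

/-- The clamping of a real number to `[0, 1]`. -/
def ramp (t : ℝ) : ℝ := max 0 (min 1 t)

/-- The hat function, supported on `(-1, 1)`. -/
def hat (t : ℝ) : ℝ := ramp (t + 1) - ramp t

lemma continuous_hat : Continuous hat := by unfold hat ramp; fun_prop

lemma hat_nonneg (t : ℝ) : 0 ≤ hat t := by
  unfold hat ramp
  exact sub_nonneg.2 (max_le_max_left _ (min_le_min_left _ (by linarith)))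

lemma ramp_of_nonpos {t : ℝ} (h : t ≤ 0) : ramp t = 0 :=
  max_eq_left ((min_le_right _ _).trans h)

lemma ramp_of_one_le {t : ℝ} (h : 1 ≤ t) : ramp t = 1 := by
  rw [ramp, min_eq_left h]; simp

lemma ramp_of_mem {t : ℝ} (h0 : 0 ≤ t) (h1 : t ≤ 1) : ramp t = t := by
  rw [ramp, min_eq_right h1, max_eq_right h0]

lemma abs_lt_one_of_hat_pos {t : ℝ} (h : 0 < hat t) : |t| < 1 := by
  by_contra hc
  rw [not_lt, le_abs] at hc
  rcases hc with hc | hc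
  · rw [hat, ramp_of_one_le hc, ramp_of_one_le (by linarith)] at h
    simp at h
  · rw [hat, ramp_of_nonpos (by linarith : t ≤ 0), ramp_of_nonpos (by linarith)] at h
    simp at h

lemma half_le_hat {t : ℝ} (h : |t| ≤ 1 / 2) : 1 / 2 ≤ hat t := by
  rw [abs_le] at h
  rcases le_total 0 t with ht | ht
  · rw [hat, ramp_of_one_le (by linarith), ramp_of_mem ht (by linarith)]
    linarith
  · rw [hat, ramp_of_nonpos ht, ramp_of_mem (by linarith) (by linarith)]
    linarith

/-- Hats are differences of consecutive ramps, so the sum telescopes. -/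
lemma sum_hat {M : ℕ} {x : ℝ} (h0 : 0 ≤ x) (h1 : x ≤ M) :
    ∑ n : Fin (M + 1), hat (x - (n : ℕ)) = 1 := by
  rw [Fin.sum_univ_eq_sum_range (fun n => hat (x - (n : ℕ)))]
  have : ∀ n ∈ Finset.range (M + 1), hat (x - (n : ℕ)) =
      ramp (x + 1 - (n : ℕ)) - ramp (x + 1 - ((n + 1 : ℕ) : ℝ)) := fun n _ => by
    rw [hat]; push_cast; congr 2 <;> ring
  rw [Finset.sum_congr rfl this, Finset.sum_range_sub' (fun n : ℕ => ramp (x + 1 - (n : ℕ))),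
    ramp_of_one_le (by push_cast; linarith), ramp_of_nonpos (by push_cast; linarith)]
  simp

/-- A vertex of the box as a lattice point. -/
def latOf {ι : Type*} {M : ℕ} (v : ι → Fin (M + 1)) : ι → ℤ := fun i => ((v i : ℕ) : ℤ)

lemma latOf_mem {ι : Type*} {M : ℕ} (v : ι → Fin (M + 1)) : latOf v ∈ latBox ι M := fun i =>
  ⟨by simp [latOf], by have := (v i).2; simp only [latOf]; lia⟩

lemma exists_latOf {ι : Type*} {M : ℕ} {v : ι → ℤ} (h : v ∈ latBox ι M) :
    ∃ w : ι → Fin (M + 1), latOf w = v :=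
  ⟨fun i => ⟨(v i).toNat, by have := h i; lia⟩, funext fun i => by
    have := h i; simp only [latOf]; lia⟩

/-- Lattice points carrying weight at a common point are adjacent; hence the interpolation of a
Lipschitz lattice map is supported on cliques. -/
lemma adj_of_near {ι : Type*} {y : ι → ℝ} {v w : ι → ℤ} (hv : ∀ i, |y i - v i| < 1)
    (hw : ∀ i, |y i - w i| < 1) : Adj v w := fun i => by
  have h1 := hv i
  have h2 := hw i
  have h3 : |((v i - w i : ℤ) : ℝ)| < 2 := by
    push_cast
    rw [abs_lt] at *
    constructor <;> linarith
  have h4 : |v i - w i| < 2 := by exact_mod_cast h3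
  lia

variable {ι : Type*} [Fintype ι] [DecidableEq ι]

/-- The multilinear barycentric coordinates of a point of the box. -/
def boxWeight (M : ℕ) (y : box ι M) : stdSimplex ℝ (ι → Fin (M + 1)) :=
  ⟨fun v => ∏ i, hat (y.1 i - ((v i : ℕ) : ℝ)), fun v => Finset.prod_nonneg fun i _ => hat_nonneg _, by
    have := Finset.prod_univ_sum (fun _ : ι => (Finset.univ : Finset (Fin (M + 1))))
      (fun i n => hat (y.1 i - ((n : ℕ) : ℝ)))
    rw [Fintype.piFinset_univ] at this
    rw [← this]
    exact Finset.prod_eq_one fun i _ => sum_hat (y.2 i).1 (y.2 i).2⟩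

lemma boxWeight_apply (M : ℕ) (y : box ι M) (v : ι → Fin (M + 1)) :
    boxWeight M y v = ∏ i, hat (y.1 i - ((v i : ℕ) : ℝ)) := rfl

lemma continuous_boxWeight (M : ℕ) : Continuous (boxWeight (ι := ι) M) := by
  refine Continuous.subtype_mk (continuous_pi fun v => continuous_finsetProd _ fun i _ => ?_) _
  refine continuous_hat.comp ?_
  have : Continuous fun y : box ι M => y.1 i := (continuous_apply i).comp continuous_subtype_val
  exact this.sub continuous_const

lemma abs_sub_lt_of_boxWeight_pos {M : ℕ} {y : box ι M} {v : ι → Fin (M + 1)}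
    (h : 0 < boxWeight M y v) (i : ι) : |y.1 i - ((v i : ℕ) : ℝ)| < 1 := by
  refine abs_lt_one_of_hat_pos (lt_of_le_of_ne (hat_nonneg _) fun h0 => ?_)
  rw [boxWeight_apply, Finset.prod_eq_zero (Finset.mem_univ i) h0.symm] at h
  exact lt_irrefl _ h

lemma le_boxWeight {M : ℕ} {y : box ι M} {v : ι → Fin (M + 1)}
    (h : ∀ i, |y.1 i - ((v i : ℕ) : ℝ)| ≤ 1 / 2) :
    (1 / 2) ^ Fintype.card ι ≤ boxWeight M y v := by
  rw [boxWeight_apply, ← Finset.card_univ, ← Finset.prod_const]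
  exact Finset.prod_le_prod (fun _ _ => by norm_num) fun i _ => half_le_hat (h i)

variable {T : Type u}

/-- The realization of a lattice map on a box. -/
def boxReal (M : ℕ) (f : (ι → ℤ) → T) : C(box ι M, FreeSpace T) :=
  (real (f ∘ latOf)).comp ⟨boxWeight M, continuous_boxWeight M⟩

lemma mem_supp_boxReal {M : ℕ} {f : (ι → ℤ) → T} {y : box ι M} {t : T} :
    t ∈ supp (boxReal M f y) ↔ ∃ v : ι → Fin (M + 1), f (latOf v) = t ∧ 0 < boxWeight M y v := by
  have : supp (boxReal M f y) = _ := supp_real (f ∘ latOf) (boxWeight M y)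
  rw [this]
  exact ⟨fun ⟨v, h1, h2⟩ => ⟨v, h2, h1⟩, fun ⟨v, h1, h2⟩ => ⟨v, h2, h1⟩⟩

lemma exists_of_mem_supp_boxReal {M : ℕ} {f : (ι → ℤ) → T} {y : box ι M} {t : T}
    (h : t ∈ supp (boxReal M f y)) :
    ∃ v : ι → ℤ, v ∈ latBox ι M ∧ f v = t ∧ ∀ i, |y.1 i - v i| < 1 := by
  obtain ⟨v, h1, h2⟩ := mem_supp_boxReal.1 h
  exact ⟨latOf v, latOf_mem v, h1, fun i => by
    have := abs_sub_lt_of_boxWeight_pos h2 i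
    simpa [latOf] using this⟩

lemma le_lam_boxReal {M : ℕ} (f : (ι → ℤ) → T) {y : box ι M} {v : ι → ℤ} (hv : v ∈ latBox ι M)
    (h : ∀ i, |y.1 i - v i| ≤ 1 / 2) :
    (1 / 2) ^ Fintype.card ι ≤ lam (boxReal M f y) (f v) := by
  obtain ⟨w, rfl⟩ := exists_latOf hv
  have e : lam (boxReal M f y) = _ := lam_real (f ∘ latOf) (boxWeight M y)
  rw [e]
  have h1 : (1 / 2) ^ Fintype.card ι ≤ boxWeight M y w :=
    le_boxWeight fun i => by simpa [latOf] using h i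
  have h2 := le_weight (f := f ∘ latOf) (p := ⇑(boxWeight M y))
    (fun v => stdSimplex.zero_le _ v) w
  exact h1.trans h2

end Multilinear

/-! ### Finitely many barycentric coordinates control a map of a compact space -/

section Discretize

variable {T : Type u}

/-- Over a compact space, a map to the free space is controlled by finitely many barycentric
coordinates. -/
lemma exists_discretization {K : Type*} [PseudoMetricSpace K] [CompactSpace K]
    (F : C(K, FreeSpace T)) {L₀ : Set T} (hL₀ : L₀.Finite) {c : ℝ} (hc : 0 < c) :
    ∃ (L : Finset T) (ε δ : ℝ), L₀ ⊆ L ∧ 0 < ε ∧ ε ≤ c ∧ 0 < δ ∧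
      (∀ y, ∃ t ∈ L, ε ≤ lam (F y) t) ∧
      ∀ y y', dist y y' < δ → ∀ t ∈ L, ε ≤ lam (F y) t → 0 < lam (F y') t := by
  classical
  obtain ⟨L₁, hL₁⟩ := isCompact_univ.elim_finite_subcover
    (fun t : T => {y : K | 0 < lam (F y) t})
    (fun t => isOpen_lt continuous_const ((continuous_lam t).comp F.continuous))
    (fun y _ => by
      obtain ⟨t, ht⟩ := exists_lam_pos (F y)
      exact Set.mem_iUnion.2 ⟨t, ht⟩)
  let L := L₁ ∪ hL₀.toFinset
  have hpos : ∀ y, 0 < ∑ t ∈ L, lam (F y) t := fun y => by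
    obtain ⟨t, ht1, ht2⟩ := Set.mem_iUnion₂.1 (hL₁ (Set.mem_univ y))
    exact lt_of_lt_of_le ht2 (Finset.single_le_sum (f := fun t => lam (F y) t)
      (fun s _ => lam_nonneg _ s) (Finset.mem_union_left _ ht1))
  have hcont : Continuous fun y => ∑ t ∈ L, lam (F y) t :=
    continuous_finsetSum _ fun t _ => (continuous_lam t).comp F.continuous
  obtain ⟨m, hm, hmle⟩ : ∃ m : ℝ, 0 < m ∧ ∀ y, m ≤ ∑ t ∈ L, lam (F y) t := by
    rcases isEmpty_or_nonempty K with hK | hK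
    · exact ⟨1, one_pos, fun y => isEmptyElim y⟩
    · obtain ⟨y₀, -, hy₀⟩ := isCompact_univ.exists_isMinOn Set.univ_nonempty hcont.continuousOn
      exact ⟨_, hpos y₀, fun y => hy₀ (Set.mem_univ y)⟩
  -- If all coordinates in `L` were below `m / (L.card + 1)`, their sum would be less than `m`. The
  -- bound by `c` lets a label known to have weight at least `c` qualify as well.
  let ε := min c (m / (L.card + 1))
  have hcard : (0 : ℝ) < L.card + 1 := by positivity
  have hε : 0 < ε := lt_min hc (div_pos hm hcard)
  let Φ : K → (L → ℝ) := fun y t => lam (F y) t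
  have hΦ : Continuous Φ := continuous_pi fun t => (continuous_lam t.1).comp F.continuous
  have hu := CompactSpace.uniformContinuous_of_continuous hΦ
  rw [Metric.uniformContinuous_iff] at hu
  obtain ⟨δ, hδ, hδ'⟩ := hu ε hε
  refine ⟨L, ε, δ, ?_, hε, min_le_left _ _, hδ, fun y => ?_, fun y y' hyy t ht hle => ?_⟩
  · intro t ht
    exact Finset.mem_coe.2 (Finset.mem_union_right _ (hL₀.mem_toFinset.2 ht))
  · by_contra! h
    have h1 : ∑ t ∈ L, lam (F y) t ≤ ∑ _t ∈ L, ε := Finset.sum_le_sum fun t ht => (h t ht).le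
    rw [Finset.sum_const, nsmul_eq_mul] at h1
    have h2 : (L.card : ℝ) * ε ≤ L.card * (m / (L.card + 1)) :=
      mul_le_mul_of_nonneg_left (min_le_right _ _) (by positivity)
    have h3 : (L.card : ℝ) * (m / (L.card + 1)) < m := by
      rw [mul_div_assoc', div_lt_iff₀ hcard]
      nlinarith
    linarith [hmle y]
  · have h1 := (dist_pi_lt_iff hε).1 (hδ' hyy) ⟨t, ht⟩
    rw [Real.dist_eq, abs_lt] at h1
    simp only [Φ] at h1
    linarith [h1.2]

end Discretize

/-! ### Vanishing homotopy groups fill lattice spheres -/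

section Fill

variable {G : Type u} [Group G] {ℓ : G → ℕ} {T : Set G}

/-- A real point of the box close to a lattice point of the subdivided box. -/
lemma scaled_mem_box {ι : Type*} {M j : ℕ} {v : ι → ℤ} (hv : v ∈ latBox ι (M * 3 ^ j)) :
    (fun i => (v i : ℝ) / 3 ^ j) ∈ box ι M := fun i => by
  have h1 : (0 : ℝ) ≤ v i := by exact_mod_cast (hv i).1
  have h2 : (v i : ℝ) ≤ M * 3 ^ j := by exact_mod_cast (hv i).2
  exact ⟨by positivity, by rw [div_le_iff₀ (by positivity)]; exact h2⟩

lemma abs_div_sub_third_le (j : ℕ) (x : ℤ) : |(x : ℝ) / 3 ^ j - third^[j] x| ≤ 1 / 2 := by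
  have h := third_iterate_near j x
  have h' : (2 : ℝ) * |(x : ℝ) - 3 ^ j * third^[j] x| < 3 ^ j := by exact_mod_cast h
  have e : (x : ℝ) / 3 ^ j - third^[j] x = ((x : ℝ) - 3 ^ j * third^[j] x) / 3 ^ j := by
    field_simp
  rw [e, abs_div, abs_of_pos (by positivity : (0 : ℝ) < 3 ^ j), div_le_iff₀ (by positivity)]
  linarith

lemma exists_inv_pow_lt {δ : ℝ} (hδ : 0 < δ) : ∃ j : ℕ, 1 / (3 : ℝ) ^ j < δ := by
  obtain ⟨j, hj⟩ := exists_pow_lt_of_lt_one hδ (by norm_num : (1 / 3 : ℝ) < 1)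
  exact ⟨j, by rwa [one_div_pow] at hj⟩

lemma dist_scaled_lt {ι : Type*} [Fintype ι] {j : ℕ} {δ : ℝ} (hj : 1 / (3 : ℝ) ^ j < δ)
    {v w : ι → ℤ} (h : Adj v w) :
    dist (fun i => (v i : ℝ) / 3 ^ j) (fun i => (w i : ℝ) / 3 ^ j) < δ := by
  refine lt_of_le_of_lt ((dist_pi_le_iff (by positivity)).2 fun i => ?_) hj
  have h1 : |(v i : ℝ) - w i| ≤ 1 := by exact_mod_cast h i
  rw [Real.dist_eq, ← sub_div, abs_div, abs_of_pos (by positivity : (0 : ℝ) < 3 ^ j)]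
  gcongr

instance {ι : Type*} [Fintype ι] (M : ℝ) : CompactSpace (box ι M) := by
  rw [← isCompact_iff_compactSpace]
  have : box ι M = Set.univ.pi fun _ => Set.Icc 0 M := by
    ext y; simp only [box, Set.mem_pi, Set.mem_univ, true_implies, Set.mem_Icc, Set.mem_ofPred_eq]
  rw [this]
  exact isCompact_univ_pi fun _ => isCompact_Icc

lemma latBox_finite (ι : Type*) [Finite ι] (M : ℕ) : (latBox ι M).Finite := by
  have : latBox ι M = Set.univ.pi fun _ => Set.Icc 0 (M : ℤ) := by
    ext y; simp [latBox, Pi.le_def, forall_and]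
  rw [this]
  exact Set.Finite.pi fun _ => Set.finite_Icc _ _

/-- Vanishing of homotopy groups yields fillings of lattice spheres. -/
lemma PiVanishes.cubeFill {q k l : ℕ} {h : k ≤ l} (hpi : PiVanishes ℓ T q h) {ι : Type}
    [Fintype ι] (hι : Fintype.card ι = q + 1) : CubeFill ℓ T ι k l := by
  classical
  intro M hM b hbT hbk
  have hM' : (0 : ℝ) < M := by exact_mod_cast hM
  let β : C(boxBdry ι (M : ℝ), FreeSpace G) :=
    (boxReal M b).comp ⟨fun y => ⟨y.1, y.2.1⟩, Continuous.subtype_mk continuous_subtype_val _⟩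
  -- At a point of a face of the box only lattice points of that same face carry weight, which is
  -- why `FaceAdj` is enough to control the boundary map.
  have hend : ∀ (y : boxBdry ι (M : ℝ)) (v : ι → ℤ) (i : ι), |y.1 i - v i| < 1 →
      (y.1 i = 0 → v i = 0) ∧ (y.1 i = M → v i = M) := by
    intro y v i hv
    constructor
    · intro h0
      rw [h0, zero_sub, abs_neg] at hv
      have : |v i| < 1 := by exact_mod_cast hv
      exact Int.abs_lt_one_iff.1 this
    · intro h0
      rw [h0] at hv
      have : |(M : ℤ) - v i| < 1 := by exact_mod_cast hv
      have := Int.abs_lt_one_iff.1 this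
      lia
  have hβ : ∀ y, Clique ℓ T k (supp (β y)) := by
    intro y
    obtain ⟨i, hi⟩ := y.2.2
    constructor
    · intro t ht
      obtain ⟨v, hv1, rfl, hv2⟩ := exists_of_mem_supp_boxReal ht
      have := hend y v i (hv2 i)
      exact hbT v ⟨hv1, i, hi.imp this.1 this.2⟩
    · intro s hs t ht
      obtain ⟨v, hv1, rfl, hv2⟩ := exists_of_mem_supp_boxReal hs
      obtain ⟨w, hw1, rfl, hw2⟩ := exists_of_mem_supp_boxReal ht
      have h1 := hend y v i (hv2 i)
      have h2 := hend y w i (hw2 i)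
      refine hbk v w ⟨hv1, hw1, adj_of_near hv2 hw2, i, ?_, hi.imp h1.1 h1.2⟩
      rcases hi with hi | hi
      · rw [h1.1 hi, h2.1 hi]
      · rw [h1.2 hi, h2.2 hi]
  obtain ⟨F, hF⟩ := exists_extension_box (realizationIncl ℓ T h) hpi hι hM' (liftVR β hβ)
  let E : C(box ι (M : ℝ), FreeSpace G) := (inclE ℓ T l).comp F
  have hE : ∀ y, Clique ℓ T l (supp (E y)) := fun y => clique_supp_inclE _
  have hEb : ∀ y : boxBdry ι (M : ℝ), E ⟨y.1, y.2.1⟩ = boxReal M b ⟨y.1, y.2.1⟩ := fun y => by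
    change inclE ℓ T l (F ⟨y.1, y.2.1⟩) = _
    rw [hF, inclE_realizationIncl, inclE_liftVR]
    rfl
  -- The boundary labels are forced into `L`; `(1 / 2) ^ Fintype.card ι` is a lower bound for the
  -- weight of a lattice point at distance at most one half in each coordinate.
  obtain ⟨L, ε, δ, hL, hε, hεc, hδ, hex, hnear⟩ := exists_discretization E
    ((latBox_finite ι M).image b) (c := (1 / 2) ^ Fintype.card ι) (by positivity)
  obtain ⟨j, hj⟩ := exists_inv_pow_lt hδ
  let pt : latBox ι (M * 3 ^ j) → box ι (M : ℝ) := fun v => ⟨_, scaled_mem_box v.2⟩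
  have hbd : ∀ v : latBox ι (M * 3 ^ j), v.1 ∈ latBdry ι (M * 3 ^ j) →
      b (coarse j v.1) ∈ L ∧ ε ≤ lam (E (pt v)) (b (coarse j v.1)) := by
    intro v hv
    have hc := coarse_mem_latBdry j hv
    refine ⟨hL ⟨_, hc.1, rfl⟩, hεc.trans ?_⟩
    have hmem : (pt v).1 ∈ boxBdry ι (M : ℝ) := by
      refine ⟨(pt v).2, ?_⟩
      obtain ⟨i, hi⟩ := hv.2
      refine ⟨i, hi.imp (fun h0 => ?_) (fun h0 => ?_)⟩
      · simp [pt, h0]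
      · simp only [pt, h0]
        push_cast
        field_simp
    have e := hEb ⟨_, hmem⟩
    have e' : E (pt v) = boxReal M b (pt v) := e
    rw [e']
    exact le_lam_boxReal b hc.1 fun i => abs_div_sub_third_le j (v.1 i)
  -- Interior points receive any label of weight at least `ε`; on the boundary the prescribed label
  -- already has that weight. Adjacent points are closer than `δ`, so their two labels lie in the
  -- support of one point, which is a clique.
  let F' : (ι → ℤ) → G := fun v =>
    if v ∈ latBdry ι (M * 3 ^ j) then b (coarse j v) else
      if hv : v ∈ latBox ι (M * 3 ^ j) then (hex (pt ⟨v, hv⟩)).choose else 1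
  have hF' : ∀ v : latBox ι (M * 3 ^ j), F' v.1 ∈ L ∧ ε ≤ lam (E (pt v)) (F' v.1) := by
    intro v
    by_cases hv : v.1 ∈ latBdry ι (M * 3 ^ j)
    · simp only [F', if_pos hv]
      exact hbd v hv
    · simp only [F', if_neg hv, dif_pos v.2]
      exact (hex (pt v)).choose_spec
  refine ⟨j, F', fun v hv => ?_, fun v hv w hw hvw => ?_, fun v hv => if_pos hv⟩
  · exact (hE (pt ⟨v, hv⟩)).1 (lt_of_lt_of_le hε (hF' ⟨v, hv⟩).2)
  · have h1 := hF' ⟨v, hv⟩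
    have h2 := hF' ⟨w, hw⟩
    refine (hE (pt ⟨w, hw⟩)).2 _ ?_ _ (lt_of_lt_of_le hε h2.2)
    exact hnear (pt ⟨v, hv⟩) (pt ⟨w, hw⟩) (dist_scaled_lt hj hvw) _ h1.1 h1.2

end Fill

/-! ### Free and based null-homotopies of lattice maps -/

section Null

variable {G : Type u} [Group G]

/-- The lattice map `f`, equal to `t₀` far out, is freely null-homotopic in `T` at mesh `l`:
the homotopy is allowed to move the value at infinity along a path `p`. -/
def FreeNull (ℓ : G → ℕ) (T : Set G) (l : ℕ) {q : ℕ} (t₀ : G) (f : (Fin q → ℤ) → G) : Prop :=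
  ∃ (j R S : ℕ) (p : ℤ → G) (F : (Fin (q + 1) → ℤ) → G),
    Lip ℓ l F ∧ (∀ v, F v ∈ T) ∧
    (∀ s s', |s - s'| ≤ 1 → ℓ ((p s)⁻¹ * p s') ≤ l) ∧ (∀ s, p s ∈ T) ∧
    (∀ s ≤ 0, p s = t₀) ∧
    (∀ s ≤ 0, ∀ v, F (Fin.cons s v) = f (coarse j v)) ∧
    (∀ s ≥ (S : ℤ), ∀ v, F (Fin.cons s v) = p S) ∧
    (∀ s v, (∃ i, (R : ℤ) ≤ |v i|) → F (Fin.cons s v) = p s)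

/-- The lattice map `f`, equal to `t₀` far out, is null-homotopic in `T` at mesh `l`. -/
def Null (ℓ : G → ℕ) (T : Set G) (l : ℕ) {q : ℕ} (t₀ : G) (f : (Fin q → ℤ) → G) : Prop :=
  ∃ (j R S : ℕ) (F : (Fin (q + 1) → ℤ) → G),
    Lip ℓ l F ∧ (∀ v, F v ∈ T) ∧
    (∀ s ≤ 0, ∀ v, F (Fin.cons s v) = f (coarse j v)) ∧
    (∀ s ≥ (S : ℤ), ∀ v, F (Fin.cons s v) = t₀) ∧
    (∀ s v, (∃ i, (R : ℤ) ≤ |v i|) → F (Fin.cons s v) = t₀)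

/-- The maximum norm of a lattice point. -/
def latNorm {q : ℕ} (v : Fin q → ℤ) : ℕ := Finset.univ.sup fun i => (v i).natAbs

lemma le_latNorm {q : ℕ} (v : Fin q → ℤ) (i : Fin q) : |v i| ≤ latNorm v := by
  rw [Int.abs_eq_natAbs]
  exact_mod_cast Finset.le_sup (f := fun i => (v i).natAbs) (Finset.mem_univ i)

lemma latNorm_adj {q : ℕ} {v w : Fin q → ℤ} (h : Adj v w) : latNorm v ≤ latNorm w + 1 := by
  refine Finset.sup_le fun i _ => ?_
  have h1 := le_latNorm w i
  have h2 := h i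
  rw [Int.abs_eq_natAbs] at h1
  rw [abs_le] at h2
  lia

lemma exists_le_of_le_latNorm {q : ℕ} {v : Fin q → ℤ} {R : ℕ} (hR : 0 < R) (h : R ≤ latNorm v) :
    ∃ i, (R : ℤ) ≤ |v i| := by
  obtain ⟨i, -, hi⟩ := (Finset.le_sup_iff (show (⊥ : ℕ) < R from hR)).1 h
  exact ⟨i, by rw [Int.abs_eq_natAbs]; exact_mod_cast hi⟩

lemma adj_cons {q : ℕ} {s s' : ℤ} {v w : Fin q → ℤ} :
    Adj (Fin.cons s v : Fin (q + 1) → ℤ) (Fin.cons s' w) ↔ |s - s'| ≤ 1 ∧ Adj v w := by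
  simp [Adj, Fin.forall_fin_succ]

lemma lip_cons_iff {ℓ : G → ℕ} {q l : ℕ} {F : (Fin (q + 1) → ℤ) → G} :
    Lip ℓ l F ↔ ∀ s s' v w, |s - s'| ≤ 1 → Adj v w →
      ℓ ((F (Fin.cons s v))⁻¹ * F (Fin.cons s' w)) ≤ l := by
  constructor
  · exact fun h s s' v w hs hv => h _ _ (adj_cons.2 ⟨hs, hv⟩)
  · intro h v w hvw
    rw [← Fin.cons_self_tail v, ← Fin.cons_self_tail w] at hvw ⊢
    exact h _ _ _ _ (adj_cons.1 hvw).1 (adj_cons.1 hvw).2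

/-- A free null-homotopy can be replaced by one fixing the value at infinity. -/
lemma FreeNull.null {ℓ : G → ℕ} {T : Set G} {l q : ℕ} {t₀ : G} {f : (Fin q → ℤ) → G}
    (h : FreeNull ℓ T l t₀ f) : Null ℓ T l t₀ f := by
  obtain ⟨j, R, S, p, F, hF, hFT, hp, hpT, hp0, hF0, hFS, hFR⟩ := h
  rw [lip_cons_iff] at hF
  -- The homotopy is stopped at time `a v`, which drops with slope one beyond radius `R`, where `F`
  -- already follows `p`. After time `S` the path is run backwards as `p (2 * S - s)`, so the top
  -- and the far region end at `p 0 = t₀`.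
  let a : (Fin q → ℤ) → ℤ := fun v => S - max 0 ((latNorm v : ℤ) - R)
  have ha : ∀ v w, Adj v w → |a v - a w| ≤ 1 := fun v w hvw => by
    have h1 := latNorm_adj hvw
    have h2 := latNorm_adj hvw.symm
    simp only [a]
    rw [abs_le]
    lia
  have haS : ∀ v, a v ≤ S := fun v => by simp only [a]; lia
  let K : (Fin (q + 1) → ℤ) → G := fun z =>
    if z 0 ≤ S then F (Fin.cons (min (z 0) (a (Fin.tail z))) (Fin.tail z)) else
      p (min (a (Fin.tail z)) (2 * S - z 0))
  have hK1 : ∀ s v, s ≤ (S : ℤ) → K (Fin.cons s v) = F (Fin.cons (min s (a v)) v) :=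
    fun s v hs => by simp [K, hs]
  -- Both formulas agree at `s = S`: inside radius `R` because `a v = S` and `F` has become
  -- constant, outside because `F` equals `p`.
  have hK2 : ∀ s v, (S : ℤ) ≤ s → K (Fin.cons s v) = p (min (a v) (2 * S - s)) := by
    intro s v hs
    rcases eq_or_lt_of_le hs with rfl | hs'
    · rw [hK1 _ _ le_rfl, min_eq_right (haS v), min_eq_left (by have := haS v; lia)]
      by_cases hv : ∃ i, (R : ℤ) ≤ |v i|
      · exact hFR _ _ hv
      · have : a v = S := by
          by_cases hR : 0 < R
          · have : ¬ R ≤ latNorm v := fun h => hv (exists_le_of_le_latNorm hR h)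
            simp only [a]; lia
          · have hR0 : R = 0 := by lia
            have : latNorm v = 0 := by
              refine Nat.eq_zero_of_not_pos fun hpos => hv ?_
              obtain ⟨i, -⟩ := exists_le_of_le_latNorm (v := v) (R := 1) one_pos hpos
              exact ⟨i, by rw [hR0]; simp⟩
            simp only [a]; lia
        rw [this, hFS _ le_rfl]
    · simp [K, not_le.2 hs']
  refine ⟨j, R + S, 2 * S, K, ?_, ?_, ?_, ?_, ?_⟩
  · rw [lip_cons_iff]
    intro s s' v w hs hv
    have hav := ha v w hv
    by_cases h1 : s ≤ S ∧ s' ≤ S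
    · rw [hK1 _ _ h1.1, hK1 _ _ h1.2]
      refine hF _ _ _ _ ?_ hv
      rw [abs_le] at *
      lia
    · have h2 : (S : ℤ) ≤ s ∧ (S : ℤ) ≤ s' := by rw [abs_le] at hs; lia
      rw [hK2 _ _ h2.1, hK2 _ _ h2.2]
      refine hp _ _ ?_
      rw [abs_le] at *
      lia
  · intro z
    simp only [K]
    split_ifs
    · exact hFT _
    · exact hpT _
  · intro s hs v
    rw [hK1 _ _ (by lia), hF0 _ (by lia)]
  · intro s hs v
    rw [hK2 _ _ (by push_cast at hs; lia), hp0]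
    push_cast at hs
    lia
  · rintro s v ⟨i, hi⟩
    have h1 := le_latNorm v i
    have hav : a v ≤ 0 := by simp only [a]; push_cast at hi; lia
    rcases le_total s S with hs | hs
    · rw [hK1 _ _ hs, hFR _ _ ⟨i, by push_cast at hi; lia⟩, hp0]
      lia
    · rw [hK2 _ _ hs, hp0]
      lia

end Null

/-! ### Straight paths to a vertex -/

section Vertices

variable {T : Type u}

/-- The vertex of the free space at `t`. -/
def vtx (t : T) : FreeSpace T := real (fun _ : Unit => t) default

lemma eq_vtx {x : FreeSpace T} {t : T} (h : supp x ⊆ {t}) : x = vtx t := by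
  have key : ∀ {n : SimplexCategory} (p : stdSimplex ℝ (Fin (n.len + 1))),
      cell (freeSimplex (fun _ : Fin (n.len + 1) => t)) p =
        cell (n := SimplexCategory.mk 0) (freeSimplex (fun _ => t)) default := by
    intro n p
    have := cell_free_map (n := n) (m := SimplexCategory.mk 0) (OrderHom.const _ 0)
      (fun _ => t) p
    refine Eq.trans this ?_
    congr 1
    exact Subsingleton.elim (α := stdSimplex ℝ (Fin 1)) _ _
  obtain ⟨n, σ, p, rfl⟩ := exists_free_cell x
  rw [supp_cell] at h
  rw [cell_free_congr (τ := fun _ => t) fun i hi => h ⟨i, hi, rfl⟩, key]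
  exact (key (n := SimplexCategory.mk (Fintype.card Unit - 1)) _).symm

lemma joinPt_right {n : SimplexCategory} {N : ℕ} (p : stdSimplex ℝ (Fin (n.len + 1)))
    (q : stdSimplex ℝ (Fin (N + 1))) (s : unitInterval) (i : Fin (N + 1)) :
    joinPt p q s (joinRight n N i) = s * q i := by
  have h1 : stdSimplex.map (joinLeft n N) p (joinRight n N i) = 0 := by
    rw [stdSimplex_map_apply]
    refine Finset.sum_eq_zero fun x _ => if_neg fun h => ?_
    have h2 : (x : ℕ) = n.len + 1 + i := congrArg Fin.val h
    have := x.2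
    lia
  have h2 : stdSimplex.map (joinRight n N) q (joinRight n N i) = q i := by
    rw [stdSimplex_map_apply, Finset.sum_eq_single i]
    · simp
    · intro x _ hx
      refine if_neg fun h => hx ?_
      have h2 : n.len + 1 + (x : ℕ) = n.len + 1 + i := congrArg Fin.val h
      exact Fin.ext (by lia)
    · simp
  rw [joinPt, mix_apply, h1, h2]
  ring

/-- The straight path from a point to a vertex. -/
def joinVtx (t : T) : C(FreeSpace T × unitInterval, FreeSpace T) :=
  (join (fun _ : Unit => t)).comp ⟨fun z => (z.1, default, z.2), by fun_prop⟩

/-- The monotone map collapsing the second simplex of a join. -/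
def joinCollapse (n : SimplexCategory) (N : ℕ) :
    Fin ((joinDim n N).len + 1) →o Fin ((joinDim n 0).len + 1) where
  toFun := Fin.append (m := n.len + 1) (n := N + 1) (Fin.castAdd 1) (fun _ => Fin.natAdd (n.len + 1) 0)
  monotone' := by
    intro i j
    refine Fin.addCases (m := n.len + 1) (n := N + 1) (fun i => ?_) (fun i => ?_) i <;>
      refine Fin.addCases (m := n.len + 1) (n := N + 1) (fun j => ?_) (fun j => ?_) j <;> intro h
    · rw [Fin.append_left, Fin.append_left]
      exact h
    · rw [Fin.append_left, Fin.append_right]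
      simp only [Fin.le_def, Fin.val_castAdd, Fin.val_natAdd]
      lia
    · have := j.2
      simp only [Fin.le_def, Fin.val_castAdd, Fin.val_natAdd] at h
      lia
    · rw [Fin.append_right, Fin.append_right]

lemma joinCollapse_left (n : SimplexCategory) (N : ℕ) (i : Fin (n.len + 1)) :
    joinCollapse n N (joinLeft n N i) = joinLeft n 0 i :=
  Fin.append_left (m := n.len + 1) (n := N + 1) (Fin.castAdd 1)
    (fun _ => Fin.natAdd (n.len + 1) 0) i

lemma joinCollapse_right (n : SimplexCategory) (N : ℕ) (i : Fin (N + 1)) :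
    joinCollapse n N (joinRight n N i) = joinRight n 0 0 :=
  Fin.append_right (m := n.len + 1) (n := N + 1) (Fin.castAdd 1)
    (fun _ => Fin.natAdd (n.len + 1) 0) i

/-- Collapsing the second factor of the join to one vertex is monotone and preserves straight lines.
This identifies the homotopy far out with the path travelled by the base point. -/
lemma join_eq_joinVtx {V : Type*} [Fintype V] [Nonempty V] {f : V → T} {t : T}
    {w : stdSimplex ℝ V} (h : ∀ v, 0 < w v → f v = t) (x : FreeSpace T) (s : unitInterval) :
    join f (x, w, s) = joinVtx t (x, s) := by
  have key : ∀ {n : SimplexCategory} (N : ℕ) (σ : Fin (n.len + 1) → T)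
      (p : stdSimplex ℝ (Fin (n.len + 1))) (q : stdSimplex ℝ (Fin (N + 1))),
      cell (freeSimplex (joinTuple σ (fun _ : Fin (N + 1) => t))) (joinPt p q s) =
        cell (freeSimplex (joinTuple σ (fun _ : Fin (0 + 1) => t))) (joinPt p default s) := by
    intro n N σ p q
    have h1 : joinTuple σ (fun _ : Fin (0 + 1) => t) ∘ joinCollapse n N =
        joinTuple σ (fun _ : Fin (N + 1) => t) := by
      funext i
      refine Fin.addCases (m := n.len + 1) (n := N + 1) (fun i => ?_) (fun i => ?_) i
      · exact (congrArg (joinTuple σ (fun _ : Fin (0 + 1) => t)) (joinCollapse_left n N i)).trans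
          ((congrFun (joinTuple_left σ (fun _ : Fin (0 + 1) => t)) i).trans
            (congrFun (joinTuple_left σ (fun _ : Fin (N + 1) => t)) i).symm)
      · exact (congrArg (joinTuple σ (fun _ : Fin (0 + 1) => t)) (joinCollapse_right n N i)).trans
          ((congrFun (joinTuple_right σ (fun _ : Fin (0 + 1) => t)) 0).trans
            (congrFun (joinTuple_right σ (fun _ : Fin (N + 1) => t)) i).symm)
    have h3 : stdSimplex.map (joinCollapse n N) (joinPt p q s) = joinPt p default s := by
      have e1 : joinCollapse n N ∘ joinLeft n N = joinLeft n 0 :=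
        funext (joinCollapse_left n N)
      have e2 : joinCollapse n N ∘ joinRight n N = joinRight n 0 ∘ fun _ => 0 :=
        funext (joinCollapse_right n N)
      rw [joinPt, joinPt, map_mix, stdSimplex.map_comp_apply, stdSimplex.map_comp_apply, e1, e2,
        ← stdSimplex.map_comp_apply]
      congr 2
      exact Subsingleton.elim (α := stdSimplex ℝ (Fin 1)) _ _
    rw [← h3, ← cell_free_map, h1]
  obtain ⟨n, σ, p, rfl⟩ := exists_free_cell x
  have hw : ∀ i, 0 < stdSimplex.map (enumV V) w i → (f ∘ (enumV V).symm) i = t := by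
    intro i hi
    rw [stdSimplex_map_apply] at hi
    obtain ⟨v, -, hv⟩ := Finset.exists_ne_zero_of_sum_ne_zero hi.ne'
    have hvi : enumV V v = i := by by_contra hne; simp [hne] at hv
    rw [if_pos hvi] at hv
    rw [← hvi, Function.comp_apply, Equiv.symm_apply_apply]
    exact h v (lt_of_le_of_ne (stdSimplex.zero_le _ _) (Ne.symm hv))
  have hR : joinVtx t (cell (freeSimplex σ) p, s) =
      cell (freeSimplex (joinTuple σ (fun _ : Fin (Fintype.card Unit - 1 + 1) => t)))
        (joinPt p (stdSimplex.map (enumV Unit) default) s) := joinCurried_cell _ σ p _ s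
  rw [hR, key, join_apply, joinCurried_cell]
  refine Eq.trans ?_ (key (Fintype.card V - 1) σ p (stdSimplex.map (enumV V) w))
  · refine cell_free_congr fun i => ?_
    refine Fin.addCases (m := n.len + 1) (n := Fintype.card V - 1 + 1) (fun i _ => ?_)
      (fun i hi => ?_) i
    · exact (congrFun (joinTuple_left σ (f ∘ (enumV V).symm)) i).trans
        (congrFun (joinTuple_left σ (fun _ => t)) i).symm
    · refine (congrFun (joinTuple_right σ (f ∘ (enumV V).symm)) i).trans (Eq.trans ?_
        (congrFun (joinTuple_right σ (fun _ => t)) i).symm)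
      refine hw i ?_
      have hi' : 0 < joinPt p (stdSimplex.map (enumV V) w) s (joinRight n _ i) := hi
      rw [joinPt_right] at hi'
      exact pos_of_mul_pos_right hi' s.2.1

lemma joinVtx_zero (t : T) (x : FreeSpace T) : joinVtx t (x, 0) = x :=
  join_zero (fun _ : Unit => t) x default

lemma joinVtx_one (t : T) (x : FreeSpace T) : joinVtx t (x, 1) = vtx t :=
  join_one (fun _ : Unit => t) x default

lemma supp_joinVtx_subset (t : T) (x : FreeSpace T) (s : unitInterval) :
    supp (joinVtx t (x, s)) ⊆ supp x ∪ {t} := by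
  refine (supp_join_subset (fun _ : Unit => t) x default s).trans (Set.union_subset_union_right _ ?_)
  rintro _ ⟨_, _, rfl⟩
  rfl

end Vertices

/-! ### Null-homotopies in which the base point moves -/

section Debase

open unitInterval

lemma abs_projIcc_sub_projIcc_le (x y : ℝ) :
    |(Set.projIcc (0 : ℝ) 1 zero_le_one x : ℝ) - Set.projIcc (0 : ℝ) 1 zero_le_one y| ≤ |x - y| := by
  rw [Set.coe_projIcc, Set.coe_projIcc]
  exact (abs_max_sub_max_le_max _ _ _ _).trans (max_le (by simp)
    ((abs_min_sub_min_le_max _ _ _ _).trans (by simp)))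

/-- The clamping of the coordinates of a point to the unit cube. -/
def clampPt {q : ℕ} (z : Fin q → ℝ) : Fin q → I := fun i => Set.projIcc 0 1 zero_le_one (z i)

lemma continuous_clampPt {q : ℕ} : Continuous (clampPt (q := q)) :=
  continuous_pi fun i => continuous_projIcc.comp (continuous_apply i)

lemma clampPt_boundary {q : ℕ} {z : Fin q → ℝ} {i : Fin q} (h : z i ≤ 0 ∨ 1 ≤ z i) :
    clampPt z ∈ Cube.boundary (Fin q) :=
  ⟨i, h.imp (fun h => Set.projIcc_of_le_left _ h) fun h => Set.projIcc_of_right_le _ h⟩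

lemma clampPt_coe {q : ℕ} (u : Fin q → I) : clampPt (fun i => (u i : ℝ)) = u :=
  funext fun i => Set.projIcc_val zero_le_one (u i)

/-- A homotopy of a loop, extended to all of `ℝ ^ q`, to a constant map, under which the value at
infinity moves along a path, yields a null-homotopy relative to the boundary. -/
lemma homotopic_const_of_far {Z : Type*} [TopologicalSpace Z] {q : ℕ} {x : Z}
    (γ : GenLoop (Fin q) Z x) {D R : ℝ} (hD : 0 < D) (hR : D ≤ R) (p : C(I, Z))
    (H : C(I × (Fin q → ℝ), Z)) (hp : p 0 = x)
    (h0 : ∀ z, H (0, z) = γ (clampPt fun i => z i / D)) (h1 : ∀ z, H (1, z) = p 1)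
    (hfar : ∀ s z, (∃ i, R ≤ |z i|) → H (s, z) = p s) : GenLoop.Homotopic γ GenLoop.const := by
  let A : C(Fin q → I, Fin q → ℝ) :=
    ⟨fun u i => 2 * (R + 1) * (u i : ℝ) - (R + 1), by fun_prop⟩
  have hA : ∀ u ∈ Cube.boundary (Fin q), ∃ i, (u i = 0 ∧ A u i = -(R + 1)) ∨
      (u i = 1 ∧ A u i = R + 1) := by
    rintro u ⟨i, hi | hi⟩
    · exact ⟨i, Or.inl ⟨hi, by simp [A, hi]⟩⟩
    · exact ⟨i, Or.inr ⟨hi, by simp [A, hi]; ring⟩⟩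
  -- A cutoff that vanishes on the boundary of the large cube and equals one unless some coordinate
  -- has absolute value at least `R`.
  let a : C(Fin q → ℝ, I) :=
    ⟨fun z => Set.projIcc 0 1 zero_le_one (R + 1 - ‖z‖), continuous_projIcc.comp (by fun_prop)⟩
  have ha0 : ∀ u ∈ Cube.boundary (Fin q), a (A u) = 0 := by
    intro u hu
    obtain ⟨i, hi⟩ := hA u hu
    have h2 : R + 1 ≤ ‖A u i‖ := by
      rw [Real.norm_eq_abs]
      rcases hi with hi | hi
      · rw [hi.2, abs_neg]; exact le_abs_self _
      · rw [hi.2]; exact le_abs_self _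
    exact Set.projIcc_of_le_left zero_le_one (by linarith [norm_le_pi_norm (A u) i])
  have ha1 : ∀ z, a z = 1 ∨ ∃ i, R ≤ |z i| := by
    intro z
    by_cases hz : ∃ i, R ≤ |z i|
    · exact Or.inr hz
    · left
      push Not at hz
      refine Set.projIcc_of_right_le zero_le_one ?_
      have := (pi_norm_le_iff_of_nonneg (x := z) (hD.le.trans hR)).2 fun i => (hz i).le
      linarith
  -- the loop spread over a larger cube
  let γ₁ : C(Fin q → I, Z) := ⟨fun u => H (0, A u), by fun_prop⟩
  let γ₂ : C(Fin q → I, Z) := ⟨fun u => p (a (A u)), by fun_prop⟩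
  -- The parameter is interpolated linearly; boundary points never enter the open unit cube on the
  -- way, so the base point is kept.
  have e1 : γ.1.HomotopicRel γ₁ (Cube.boundary (Fin q)) := by
    refine ⟨⟨⟨⟨fun w => γ.1 (clampPt fun i =>
      (1 - (w.1 : ℝ)) * (w.2 i : ℝ) + w.1 * (A w.2 i / D)), ?_⟩, fun u => ?_, fun u => ?_⟩,
      fun θ u hu => ?_⟩⟩
    · refine γ.1.continuous.comp (continuous_clampPt.comp ?_)
      fun_prop
    · simp only [Set.Icc.coe_zero, sub_zero, one_mul, zero_mul, add_zero]
      rw [clampPt_coe]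
    · simp only [Set.Icc.coe_one, sub_self, one_mul, zero_mul, zero_add]
      exact (h0 (A u)).symm
    · have hu' : γ.1 u = x := γ.2 u hu
      refine Eq.trans (γ.2 _ ?_) hu'.symm
      obtain ⟨i, hi⟩ := hA u hu
      have hDR : 1 ≤ (R + 1) / D := by rw [one_le_div hD]; linarith
      refine clampPt_boundary (i := i) (hi.imp (fun hi => ?_) fun hi => ?_)
      · change (1 - (θ : ℝ)) * (u i : ℝ) + θ * (A u i / D) ≤ 0
        rw [hi.1, hi.2, neg_div]
        have := θ.2.1
        simp only [Set.Icc.coe_zero, mul_zero, zero_add]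
        nlinarith
      · change 1 ≤ (1 - (θ : ℝ)) * (u i : ℝ) + θ * (A u i / D)
        rw [hi.1, hi.2]
        have := θ.2.1
        simp only [Set.Icc.coe_one, mul_one]
        nlinarith
  -- Running `H` only up to time `a` keeps the boundary fixed. What remains at the end is `p ∘ a`,
  -- because `H` follows `p` wherever `a` differs from one; `e3` then contracts this path to its
  -- start.
  have e2 : γ₁.HomotopicRel γ₂ (Cube.boundary (Fin q)) := by
    refine ⟨⟨⟨⟨fun w => H (min w.1 (a (A w.2)), A w.2), ?_⟩, fun u => ?_, fun u => ?_⟩,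
      fun θ u hu => ?_⟩⟩
    · fun_prop
    · simp only [min_eq_left (unitInterval.nonneg' (t := a (A u)))]
      rfl
    · simp only [min_eq_right (unitInterval.le_one' (t := a (A u)))]
      change _ = p (a (A u))
      rcases ha1 (A u) with h | h
      · rw [h, h1]
      · rw [hfar _ _ h]
    · simp only [ContinuousMap.coe_mk, ha0 u hu, min_eq_right (unitInterval.nonneg' (t := θ))]
      rfl
  have e3 : γ₂.HomotopicRel (ContinuousMap.const _ x) (Cube.boundary (Fin q)) := by
    refine ⟨⟨⟨⟨fun w => p (min (σ w.1) (a (A w.2))), ?_⟩, fun u => ?_, fun u => ?_⟩,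
      fun θ u hu => ?_⟩⟩
    · fun_prop
    · simp only [unitInterval.symm_zero, min_eq_right (unitInterval.le_one' (t := a (A u)))]
      rfl
    · simp only [unitInterval.symm_one, min_eq_left (unitInterval.nonneg' (t := a (A u)))]
      exact hp
    · simp only [ContinuousMap.coe_mk, ha0 u hu, min_eq_right (unitInterval.nonneg' (t := σ θ))]
      change _ = p (a (A u))
      rw [ha0 u hu]
  exact (e1.trans e2).trans e3

end Debase

/-! ### Lattice null-homotopies make homotopy groups vanish -/

section PiVanishes

open unitInterval

variable {G : Type u} [Group G] {ℓ : G → ℕ} {T : Set G}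

lemma coe_projIcc_clamp {R D z : ℝ} (hD : 0 < D) (hR : D ≤ R) :
    Set.projIcc (0 : ℝ) 1 zero_le_one (max (-R) (min R z) / D) =
      Set.projIcc (0 : ℝ) 1 zero_le_one (z / D) := by
  have h1 : 1 ≤ R / D := by rw [one_le_div hD]; exact hR
  rcases le_total z (-R) with hz | hz
  · rw [max_eq_left ((min_le_right _ _).trans hz), Set.projIcc_of_le_left, Set.projIcc_of_le_left]
    · exact div_nonpos_of_nonpos_of_nonneg (by linarith) hD.le
    · exact div_nonpos_of_nonpos_of_nonneg (by linarith) hD.le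
  · rcases le_total z R with hz' | hz'
    · rw [min_eq_right hz', max_eq_right hz]
    · rw [min_eq_left hz', max_eq_right (by linarith), Set.projIcc_of_right_le _ h1,
        Set.projIcc_of_right_le]
      rw [one_le_div hD]; linarith

/-- If all lattice spheres are null-homotopic, then homotopy groups vanish. -/
lemma piVanishes_of_null {q k l : ℕ} (h : k ≤ l)
    (hnull : ∀ t₀ ∈ T, ∀ f : (Fin q → ℤ) → G, Lip ℓ k f → (∀ v, f v ∈ T) →
      (∃ R : ℕ, ∀ v, (∃ i, (R : ℤ) ≤ |v i|) → f v = t₀) → Null ℓ T l t₀ f) :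
    PiVanishes ℓ T q h := by
  classical
  intro x a
  induction a using Quotient.inductionOn with | _ γ
  refine Quotient.sound ?_
  let g₀ : C(Fin q → I, FreeSpace G) := (inclE ℓ T k).comp γ.1
  have hg₀ : ∀ y, Clique ℓ T k (supp (g₀ y)) := fun y => clique_supp_inclE _
  have hg₀b : ∀ y ∈ Cube.boundary (Fin q), g₀ y = inclE ℓ T k x := fun y hy =>
    congrArg (inclE ℓ T k) (γ.2 y hy)
  obtain ⟨L, ε, δ, -, hε, -, hδ, hex, hnear⟩ :=
    exists_discretization g₀ Set.finite_empty one_pos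
  -- The label depends on the point of the free space, not on the parameter, so every parameter sent
  -- to the base point gets the same label `t₀`.
  let A : FreeSpace G → G := fun y =>
    if hy : ∃ t ∈ L, ε ≤ lam y t then hy.choose else (exists_lam_pos y).choose
  have hAsupp : ∀ y, A y ∈ supp y := by
    intro y
    by_cases hy : ∃ t ∈ L, ε ≤ lam y t
    · simp only [A, dif_pos hy]
      exact lt_of_lt_of_le hε hy.choose_spec.2
    · simp only [A, dif_neg hy]
      exact (exists_lam_pos y).choose_spec
  have hA : ∀ y y', dist y y' < δ → A (g₀ y) ∈ supp (g₀ y') := by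
    intro y y' hyy
    simp only [A, dif_pos (hex y)]
    exact hnear y y' hyy _ (hex y).choose_spec.1 (hex y).choose_spec.2
  -- The factor one half leaves room for the later error of `3 / 2` grid units.
  obtain ⟨n, hn⟩ := exists_inv_pow_lt (half_pos hδ)
  let pt : (Fin q → ℤ) → Fin q → I := fun v => clampPt fun i => (v i : ℝ) / 3 ^ n
  let f : (Fin q → ℤ) → G := fun v => A (g₀ (pt v))
  let t₀ : G := A (inclE ℓ T k x)
  have ht₀ : t₀ ∈ supp (inclE ℓ T k x) := hAsupp _
  have hcx : Clique ℓ T k (supp (inclE ℓ T k x)) := clique_supp_inclE _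
  have hfT : ∀ v, f v ∈ T := fun v => (hg₀ _).1 (hAsupp _)
  have hf : Lip ℓ k f := by
    intro v w hvw
    refine (hg₀ (pt w)).2 _ (hA _ _ ?_) _ (hAsupp _)
    refine lt_of_le_of_lt ((dist_pi_le_iff dist_nonneg).2 fun i => ?_)
      ((dist_scaled_lt hn hvw).trans (half_lt_self hδ))
    refine le_trans ?_ (dist_le_pi_dist _ _ i)
    rw [Subtype.dist_eq, Real.dist_eq, Real.dist_eq]
    exact abs_projIcc_sub_projIcc_le _ _
  have hfar : ∀ v : Fin q → ℤ, (∃ i, v i ≤ 0 ∨ 3 ^ n ≤ v i) → f v = t₀ := by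
    rintro v ⟨i, hi⟩
    refine congrArg A (hg₀b _ (clampPt_boundary (i := i) (hi.imp (fun hi => ?_) fun hi => ?_)))
    · exact div_nonpos_of_nonpos_of_nonneg (by exact_mod_cast hi) (by positivity)
    · rw [one_le_div (by positivity)]
      exact_mod_cast hi
  obtain ⟨j, R, S, F, hF, hFT, hF0, hFS, hFR⟩ := hnull t₀ (hcx.1 ht₀) f hf hfT
    ⟨3 ^ n, fun v ⟨i, hi⟩ => hfar v ⟨i, by
      rw [le_abs] at hi
      push_cast at hi
      have : (0 : ℤ) < 3 ^ n := by positivity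
      lia⟩⟩
  let D : ℕ := 3 ^ (n + j)
  have hD : (0 : ℝ) < (D : ℕ) := by positivity
  -- The extra unit is needed because interpolation at a point uses lattice points at distance up to
  -- one.
  let R₀ : ℕ := max D R + 1
  have hR₀ : (D : ℝ) + 1 ≤ R₀ ∧ (R : ℝ) + 1 ≤ R₀ := by
    simp only [R₀]; push_cast
    exact ⟨add_le_add_left (le_max_left _ _) _, add_le_add_left (le_max_right _ _) _⟩
  have hR₀' : (0 : ℝ) ≤ R₀ := Nat.cast_nonneg _
  -- One cube large enough for the time interval `[0, S]` and for the space coordinates shifted from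
  -- `[-R₀, R₀]`.
  let M : ℕ := 2 * R₀ + S
  let cl : ℝ → ℝ := fun z => max (-(R₀ : ℝ)) (min R₀ z)
  have hcl : ∀ z, -(R₀ : ℝ) ≤ cl z ∧ cl z ≤ R₀ := fun z =>
    ⟨le_max_left _ _, max_le (by linarith) (min_le_left _ _)⟩
  let c : C(I × (Fin q → ℝ), box (Fin (q + 1)) (M : ℝ)) :=
    ⟨fun w => ⟨Fin.cons (S * (w.1 : ℝ)) fun i => cl (w.2 i) + R₀, by
      have hS : (0 : ℝ) ≤ S := Nat.cast_nonneg _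
      intro i
      refine Fin.cases ?_ (fun i => ?_) i
      · have := w.1.2
        simp only [Fin.cons_zero, M]
        push_cast
        exact ⟨mul_nonneg hS this.1, by nlinarith [this.2]⟩
      · have := hcl (w.2 i)
        simp only [Fin.cons_succ, M]
        push_cast
        constructor <;> linarith⟩, by
      refine Continuous.subtype_mk (continuous_pi fun i => ?_) _
      refine Fin.cases ?_ (fun i => ?_) i
      · simp only [Fin.cons_zero]; fun_prop
      · simp only [Fin.cons_succ, cl]; fun_prop⟩
  let F' : (Fin (q + 1) → ℤ) → G := fun w => F (Fin.cons (w 0) fun i => w i.succ - R₀)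
  have hlab : ∀ s z (v : Fin (q + 1) → Fin (M + 1)), 0 < boxWeight M (c (s, z)) v →
      ∃ (a : ℤ) (u : Fin q → ℤ), F' (latOf v) = F (Fin.cons a u) ∧ |S * (s : ℝ) - a| < 1 ∧
        ∀ i, |cl (z i) - u i| < 1 := by
    intro s z v hv
    refine ⟨latOf v 0, fun i => latOf v i.succ - R₀, rfl, ?_, fun i => ?_⟩
    · have := abs_sub_lt_of_boxWeight_pos hv 0
      simpa [c, latOf] using this
    · have := abs_sub_lt_of_boxWeight_pos hv i.succ
      have e : cl (z i) - ((latOf v i.succ - R₀ : ℤ) : ℝ) =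
          (c (s, z)).1 i.succ - ((v i.succ : ℕ) : ℝ) := by
        simp [c, latOf]; ring
      rw [e]; exact this
  have hfaru : ∀ (z : Fin q → ℝ) (u : Fin q → ℤ), (∃ i, (R₀ : ℝ) ≤ |z i|) →
      (∀ i, |cl (z i) - u i| < 1) → ∃ i, (D : ℤ) ≤ |u i| ∧ (R : ℤ) ≤ |u i| := by
    rintro z u ⟨i, hi⟩ hu
    have h1 : (R₀ : ℝ) ≤ |cl (z i)| := by
      rw [le_abs] at hi
      rcases hi with hi | hi
      · have : cl (z i) = R₀ := by
          simp only [cl]; rw [min_eq_left hi, max_eq_right (by linarith)]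
        rw [this]; exact le_abs_self _
      · have : cl (z i) = -R₀ := by
          simp only [cl]; rw [max_eq_left ((min_le_right _ _).trans (by linarith))]
        rw [this, abs_neg]; exact le_abs_self _
    have h2 : (R₀ : ℝ) - 1 ≤ |(u i : ℝ)| := by
      have := abs_sub_abs_le_abs_sub (cl (z i)) (u i)
      linarith [hu i]
    refine ⟨i, ?_, ?_⟩
    · have : (D : ℝ) ≤ |(u i : ℝ)| := by linarith
      exact_mod_cast this
    · have : (R : ℝ) ≤ |(u i : ℝ)| := by linarith
      exact_mod_cast this
  let g : C(Fin q → ℝ, FreeSpace G) := ⟨fun z => g₀ (clampPt fun i => z i / D),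
    g₀.continuous.comp (continuous_clampPt.comp (by fun_prop))⟩
  -- At time zero a label comes from a grid point within `3 / 2` grid units of the parameter: one
  -- half from coarsening, at most one from interpolation. So it is a vertex of the simplex carrying
  -- `g z`.
  have hlab0 : ∀ z (v : Fin (q + 1) → Fin (M + 1)), 0 < boxWeight M (c (0, z)) v →
      F' (latOf v) ∈ supp (g z) ∧ ((∃ i, (R₀ : ℝ) ≤ |z i|) → F' (latOf v) = t₀) := by
    intro z v hv
    obtain ⟨a, u, h1, h2, h3⟩ := hlab 0 z v hv
    have ha : a = 0 := by
      have : |a| < 1 := by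
        simp only [Set.Icc.coe_zero, mul_zero, zero_sub, abs_neg] at h2
        exact_mod_cast h2
      exact Int.abs_lt_one_iff.1 this
    rw [h1, ha, hF0 0 le_rfl]
    constructor
    · refine hA _ _ ?_
      have hq : ∀ i, dist (pt (coarse j u) i) (clampPt (fun i => z i / (D : ℝ)) i) ≤
          3 / 2 * (1 / 3 ^ n) := by
        intro i
        have e : clampPt (fun i => z i / (D : ℝ)) i =
            Set.projIcc 0 1 zero_le_one (cl (z i) / D) :=
          (coe_projIcc_clamp hD (by linarith)).symm
        rw [e, Subtype.dist_eq, Real.dist_eq]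
        refine (abs_projIcc_sub_projIcc_le _ _).trans ?_
        have h4 := abs_div_sub_third_le j (u i)
        have h5 := h3 i
        have hDe : (D : ℝ) = 3 ^ n * 3 ^ j := by simp only [D]; push_cast; rw [pow_add]
        have e2 : ((coarse j u i : ℤ) : ℝ) / 3 ^ n - cl (z i) / D =
            (-((u i : ℝ) / 3 ^ j - third^[j] (u i)) - (cl (z i) - u i) / 3 ^ j) / 3 ^ n := by
          rw [hDe]; simp only [coarse]; field_simp; ring
        rw [e2, abs_div, abs_of_pos (by positivity : (0 : ℝ) < 3 ^ n), div_le_iff₀ (by positivity)]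
        have h6 : |(cl (z i) - u i) / 3 ^ j| ≤ 1 := by
          rw [abs_div, abs_of_pos (by positivity : (0 : ℝ) < 3 ^ j), div_le_iff₀ (by positivity)]
          have : (1 : ℝ) ≤ 3 ^ j := one_le_pow₀ (by norm_num)
          linarith
        have h7 : (3 : ℝ) / 2 * (1 / 3 ^ n) * 3 ^ n = 3 / 2 := by field_simp
        rw [h7]
        rw [abs_le] at *
        constructor <;> linarith
      refine lt_of_le_of_lt ((dist_pi_le_iff (by positivity)).2 hq) ?_
      linarith
    · intro hz
      obtain ⟨i, hi, -⟩ := hfaru z u hz h3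
      refine hfar _ ⟨i, ?_⟩
      have hDe : (D : ℤ) = 3 ^ j * 3 ^ n := by simp only [D]; push_cast; rw [add_comm, pow_add]
      rw [le_abs, hDe] at hi
      rcases hi with hi | hi
      · right
        have := third_iterate_mono j hi
        rwa [third_iterate_mul] at this
      · left
        have := third_iterate_mono j (show u i ≤ 0 by
          have : (0 : ℤ) ≤ 3 ^ j * 3 ^ n := by positivity
          lia)
        rwa [third_iterate_zero] at this
  have hmono : ∀ {s : Set G}, Clique ℓ T k s → Clique ℓ T l s := fun hs =>
    ⟨hs.1, fun a ha b hb => (hs.2 a ha b hb).trans h⟩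
  let p' : C(I, FreeSpace G) :=
    (joinVtx t₀).comp ⟨fun s => (inclE ℓ T k x, s), by fun_prop⟩
  have hp' : ∀ s, Clique ℓ T l (supp (p' s)) := fun s => hmono (hcx.mono
    ((supp_joinVtx_subset t₀ _ s).trans
      (Set.union_subset subset_rfl (Set.singleton_subset_iff.2 ht₀))))
  -- The homotopy has two stages: `H₁` moves the loop straight to the interpolation of its labels,
  -- within the simplices that carry it, and `H₂` realizes the lattice null-homotopy. The base point
  -- moves along `p'` in the first stage and rests at the vertex `t₀` in the second.
  let H₁ : C(I × (Fin q → ℝ), FreeSpace G) := (join (F' ∘ latOf)).comp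
    ⟨fun w => (g w.2, boxWeight M (c (0, w.2)), w.1), by
      have := continuous_boxWeight (ι := Fin (q + 1)) M
      fun_prop⟩
  have hH₁ : ∀ w, Clique ℓ T l (supp (H₁ w)) := by
    intro w
    have hs : supp (H₁ w) ⊆ supp (g w.2) := by
      refine (supp_join_subset (F' ∘ latOf) _ _ _).trans (Set.union_subset subset_rfl ?_)
      rintro _ ⟨v, hv, rfl⟩
      exact (hlab0 _ v hv).1
    exact hmono ((hg₀ _).mono hs)
  let H₂ : C(I × (Fin q → ℝ), FreeSpace G) := (boxReal M F').comp c
  have hH₂mem : ∀ w t, t ∈ supp (H₂ w) → ∃ (a : ℤ) (u : Fin q → ℤ), t = F (Fin.cons a u) ∧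
      |S * (w.1 : ℝ) - a| < 1 ∧ ∀ i, |cl (w.2 i) - u i| < 1 := by
    intro w t ht
    obtain ⟨v, h1, h2⟩ := mem_supp_boxReal.1 ht
    rw [← h1]
    exact hlab w.1 w.2 v h2
  have hH₂ : ∀ w, Clique ℓ T l (supp (H₂ w)) := by
    intro w
    constructor
    · intro t ht
      obtain ⟨a, u, rfl, -⟩ := hH₂mem w t ht
      exact hFT _
    · intro t ht t' ht'
      obtain ⟨a, u, rfl, h1, h2⟩ := hH₂mem w t ht
      obtain ⟨a', u', rfl, h1', h2'⟩ := hH₂mem w t' ht'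
      refine hF _ _ (adj_cons.2 ⟨?_, adj_of_near h2 h2'⟩)
      exact adj_of_near (ι := Unit) (y := fun _ => S * (w.1 : ℝ)) (v := fun _ => a)
        (w := fun _ => a') (fun _ => h1) (fun _ => h1') ()
  have hH₂far : ∀ s z, (∃ i, (R₀ : ℝ) ≤ |z i|) → H₂ (s, z) = vtx t₀ := by
    refine fun s z hz => eq_vtx fun t ht => ?_
    obtain ⟨a, u, rfl, h1, h2⟩ := hH₂mem _ t ht
    obtain ⟨i, -, hi⟩ := hfaru z u hz h2
    exact hFR _ _ ⟨i, hi⟩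
  have hH₂one : ∀ z, H₂ (1, z) = vtx t₀ := by
    refine fun z => eq_vtx fun t ht => ?_
    obtain ⟨a, u, rfl, h1, h2⟩ := hH₂mem _ t ht
    have ha : |(S : ℤ) - a| < 1 := by
      simp only [Set.Icc.coe_one, mul_one] at h1
      exact_mod_cast h1
    exact hFS _ (by rw [Int.abs_lt_one_iff] at ha; lia) _
  let K₁ := liftVR H₁ hH₁
  let K₂ := liftVR H₂ hH₂
  let p₁ := liftVR p' hp'
  have hinj : Function.Injective (inclE ℓ T l) := inclE_injective
  have h12 : ∀ z, K₁ (1, z) = K₂ (0, z) := fun z => hinj (by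
    rw [inclE_liftVR, inclE_liftVR]
    exact join_one (F' ∘ latOf) _ _)
  have hK₁far : ∀ s z, (∃ i, (R₀ : ℝ) ≤ |z i|) → K₁ (s, z) = p₁ s := fun s z hz => hinj (by
    rw [inclE_liftVR, inclE_liftVR]
    have e : g z = inclE ℓ T k x := by
      refine hg₀b _ ?_
      obtain ⟨i, hi⟩ := hz
      refine clampPt_boundary (i := i) ?_
      rcases le_abs.1 hi with hi | hi
      · right; rw [one_le_div hD]; linarith
      · left; exact div_nonpos_of_nonpos_of_nonneg (by linarith) hD.le
    change join (F' ∘ latOf) (g z, boxWeight M (c (0, z)), s) = joinVtx t₀ (inclE ℓ T k x, s)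
    rw [← e]
    exact join_eq_joinVtx (fun v hv => (hlab0 z v hv).2 hz) _ _)
  have hp₁one : inclE ℓ T l (p₁ 1) = vtx t₀ := by
    rw [inclE_liftVR]; exact joinVtx_one t₀ _
  have hK₂far : ∀ s z, (∃ i, (R₀ : ℝ) ≤ |z i|) → K₂ (s, z) = p₁ 1 := fun s z hz => hinj (by
    rw [inclE_liftVR, hp₁one, hH₂far s z hz])
  have hK₂one : ∀ z, K₂ (1, z) = p₁ 1 := fun z => hinj (by
    rw [inclE_liftVR, hp₁one, hH₂one z])
  let dbl : ℝ → I := Set.projIcc 0 1 zero_le_one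
  have hdbl : Continuous dbl := continuous_projIcc
  let H : C(I × (Fin q → ℝ), VRSpace ℓ T l) :=
    ⟨fun w => if (w.1 : ℝ) ≤ 1 / 2 then K₁ (dbl (2 * w.1), w.2) else K₂ (dbl (2 * w.1 - 1), w.2), by
      refine Continuous.if_le (by fun_prop) (by fun_prop) (by fun_prop) continuous_const ?_
      intro w hw
      rw [hw]
      have e1 : dbl (2 * (1 / 2)) = 1 := Set.projIcc_of_right_le _ (by norm_num)
      have e2 : dbl (2 * (1 / 2) - 1) = 0 := Set.projIcc_of_le_left _ (by norm_num)
      rw [e1, e2, h12]⟩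
  refine homotopic_const_of_far _ (D := D) (R := R₀) hD (by linarith)
    ⟨fun s => p₁ (dbl (2 * s)), by fun_prop⟩ H ?_ ?_ ?_ ?_
  · have e : dbl (2 * ((0 : I) : ℝ)) = 0 := Set.projIcc_of_le_left _ (by simp)
    refine hinj ?_
    change inclE ℓ T l (p₁ (dbl (2 * ((0 : I) : ℝ)))) = _
    rw [e, inclE_liftVR, inclE_realizationIncl]
    exact joinVtx_zero t₀ _
  · intro z
    have e : dbl (2 * ((0 : I) : ℝ)) = 0 := Set.projIcc_of_le_left _ (by simp)
    have e' : H (0, z) = K₁ (dbl (2 * ((0 : I) : ℝ)), z) := if_pos (by simp)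
    refine hinj ?_
    rw [e', e, inclE_liftVR]
    refine (join_zero (F' ∘ latOf) _ _).trans ?_
    exact (inclE_realizationIncl h _).symm
  · intro z
    have e' : H (1, z) = K₂ (dbl (2 * ((1 : I) : ℝ) - 1), z) := if_neg (by norm_num)
    have e : dbl (2 * ((1 : I) : ℝ) - 1) = 1 := Set.projIcc_of_right_le _ (by norm_num)
    have e2 : dbl (2 * ((1 : I) : ℝ)) = 1 := Set.projIcc_of_right_le _ (by norm_num)
    change _ = p₁ (dbl (2 * ((1 : I) : ℝ)))
    rw [e', e, hK₂one, e2]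
  · intro s z hz
    by_cases hs : (s : ℝ) ≤ 1 / 2
    · have e' : H (s, z) = K₁ (dbl (2 * s), z) := if_pos hs
      rw [e', hK₁far _ _ hz]
      rfl
    · have e' : H (s, z) = K₂ (dbl (2 * s - 1), z) := if_neg hs
      have e2 : dbl (2 * (s : ℝ)) = 1 := Set.projIcc_of_right_le _ (by linarith)
      change _ = p₁ (dbl (2 * s))
      rw [e', hK₂far _ _ hz, e2]

end PiVanishes

/-! ### Restricted word lengths are length functions with finite balls -/

section WordLength

variable {H : Type v} [Group H] {S : Set H}

lemma wordLength_le {w : List H} (hw : ∀ x ∈ w, x ∈ S ∨ x⁻¹ ∈ S) :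
    wordLength S w.prod ≤ w.length :=
  Nat.sInf_le ⟨w, rfl, hw, rfl⟩

lemma exists_word (hgen : Subgroup.closure S = ⊤) (h : H) :
    ∃ w : List H, w.length = wordLength S h ∧ (∀ x ∈ w, x ∈ S ∨ x⁻¹ ∈ S) ∧ w.prod = h := by
  have hh : h ∈ (Subgroup.closure S).toSubmonoid := by rw [hgen]; trivial
  rw [Subgroup.closure_toSubmonoid] at hh
  obtain ⟨w, hw, rfl⟩ := Submonoid.exists_list_of_mem_closure hh
  exact Nat.sInf_mem (s := {n | ∃ w' : List H, w'.length = n ∧ (∀ x ∈ w', x ∈ S ∨ x⁻¹ ∈ S) ∧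
    w'.prod = w.prod}) ⟨w.length, w, rfl, hw, rfl⟩

lemma wordLength_inv_le (hgen : Subgroup.closure S = ⊤) (h : H) :
    wordLength S h⁻¹ ≤ wordLength S h := by
  obtain ⟨w, hw, hw', rfl⟩ := exists_word hgen h
  rw [← hw, List.prod_inv_reverse]
  refine (wordLength_le fun x hx => ?_).trans (by simp)
  simp only [List.mem_reverse, List.mem_map] at hx
  obtain ⟨y, hy, rfl⟩ := hx
  rw [inv_inv]
  exact (hw' y hy).symm

lemma wordLength_mul_le (hgen : Subgroup.closure S = ⊤) (g h : H) :
    wordLength S (g * h) ≤ wordLength S g + wordLength S h := by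
  obtain ⟨w, hw, hw', rfl⟩ := exists_word hgen g
  obtain ⟨z, hz, hz', rfl⟩ := exists_word hgen h
  rw [← hw, ← hz, ← List.prod_append, ← List.length_append]
  refine wordLength_le fun x hx => ?_
  exact (List.mem_append.1 hx).elim (hw' x) (hz' x)

lemma finite_wordLength_le (hfin : S.Finite) (hgen : Subgroup.closure S = ⊤) (n : ℕ) :
    {h | wordLength S h ≤ n}.Finite := by
  let A : Set H := {x | x ∈ S ∨ x⁻¹ ∈ S}
  have hA : A.Finite := hfin.union (hfin.preimage inv_injective.injOn)
  have : Finite A := hA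
  refine ((List.finite_length_le A n).image fun w => (w.map Subtype.val).prod).subset ?_
  intro h hh
  obtain ⟨w, hw, hw', rfl⟩ := exists_word hgen h
  lift w to List A using hw'
  refine ⟨w, ?_, rfl⟩
  rw [Set.mem_ofPred_eq] at hh ⊢
  rwa [← hw, List.length_map] at hh

lemma isLength_inducedLength {G : Type u} [Group G] (hfin : S.Finite)
    (hgen : Subgroup.closure S = ⊤) {j : G →* H} (hj : Function.Injective j) :
    IsLength (inducedLength S j) where
  one := by
    have := wordLength_le (S := S) (w := []) (by simp)
    simpa [inducedLength] using this
  inv g := by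
    simp only [inducedLength, map_inv]
    refine le_antisymm (wordLength_inv_le hgen _) ?_
    have := wordLength_inv_le hgen (j g)⁻¹
    rwa [inv_inv] at this
  mul_le g h := by
    simp only [inducedLength, map_mul]
    exact wordLength_mul_le hgen _ _
  finite_ball n := (finite_wordLength_le hfin hgen n).preimage hj.injOn

end WordLength

/-! ### Cube fillings give null-homotopies -/

section Sphere

variable {G : Type u} [Group G] {ℓ : G → ℕ} {T : Set G}

/-- The clamping of an integer to `[0, M]`. -/
def clampInt (M : ℕ) (x : ℤ) : ℤ := max 0 (min M x)

lemma clampInt_mem (M : ℕ) (x : ℤ) : 0 ≤ clampInt M x ∧ clampInt M x ≤ M := by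
  simp only [clampInt]; lia

lemma clampInt_adj {M : ℕ} {x y : ℤ} (h : |x - y| ≤ 1) : |clampInt M x - clampInt M y| ≤ 1 := by
  simp only [clampInt]; rw [abs_le] at *; lia

/-- If cubes can be filled then lattice spheres are null-homotopic. -/
lemma CubeFill.null (hℓ : IsLength ℓ) {q k l : ℕ} (hfill : CubeFill ℓ T (Fin (q + 1)) k l) {t₀ : G}
    (ht₀ : t₀ ∈ T) {f : (Fin q → ℤ) → G} (hf : Lip ℓ k f) (hfT : ∀ v, f v ∈ T)
    (hfar : ∃ R : ℕ, ∀ v, (∃ i, (R : ℤ) ≤ |v i|) → f v = t₀) : Null ℓ T l t₀ f := by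
  obtain ⟨R₁, hR₁⟩ := hfar
  -- The increment makes the box of side `2 * R` nondegenerate.
  let R : ℕ := R₁ + 1
  have hR : ∀ v, (∃ i, (R : ℤ) ≤ |v i|) → f v = t₀ := fun v ⟨i, hi⟩ =>
    hR₁ v ⟨i, by simp only [R] at hi; push_cast at hi; lia⟩
  let M : ℕ := 2 * R
  -- The map `f` is placed on the bottom face of a box and `t₀` on all the others. A filling of this
  -- sphere, extended to the whole lattice by clamping, is a null-homotopy.
  let b : (Fin (q + 1) → ℤ) → G := fun w => if w 0 ≤ 0 then f (fun i => w i.succ - R) else t₀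
  have hbs : ∀ w : Fin (q + 1) → ℤ, (∃ i : Fin q, w i.succ = 0 ∨ w i.succ = M) → b w = t₀ := by
    rintro w ⟨i, hi⟩
    simp only [b]
    split_ifs
    · refine hR _ ⟨i, ?_⟩
      rw [le_abs]
      simp only [M] at hi; push_cast at hi; lia
    · rfl
  obtain ⟨j, F, hFT, hF, hFb⟩ := hfill M (by simp [M, R]) b
    (fun w _ => by simp only [b]; split_ifs; exacts [hfT _, ht₀])
    (by
      rintro v w ⟨hv, hw, hvw, i, hi, hi'⟩
      induction i using Fin.cases with
      | zero =>
        rcases hi' with hi' | hi'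
        · simp only [b, ← hi, hi', le_refl, if_true]
          exact hf _ _ fun i => by simpa using hvw i.succ
        · have hM : ¬ ((M : ℤ) ≤ 0) := by simp only [M, R]; push_cast; lia
          simp only [b, ← hi, hi', if_neg hM, hℓ.dist_self]
          lia
      | succ i =>
        rw [hbs v ⟨i, hi'⟩, hbs w ⟨i, hi ▸ hi'⟩, hℓ.dist_self]
        lia)
  let c : (Fin (q + 1) → ℤ) → Fin (q + 1) → ℤ := fun w =>
    Fin.cons (clampInt (M * 3 ^ j) (w 0)) fun i => clampInt (M * 3 ^ j) (w i.succ + R * 3 ^ j)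
  have hc : ∀ w, c w ∈ latBox (Fin (q + 1)) (M * 3 ^ j) := by
    intro w i
    induction i using Fin.cases with
    | zero => exact clampInt_mem _ _
    | succ i => exact clampInt_mem _ _
  have hpow : (0 : ℤ) < 3 ^ j := by positivity
  have hMR : ((M * 3 ^ j : ℕ) : ℤ) = 2 * (R * 3 ^ j) := by simp only [M]; push_cast; ring
  have hRp : (0 : ℤ) < R * 3 ^ j := by simp only [R]; positivity
  have hfar2 : ∀ (x : ℤ), ((R * 3 ^ j : ℕ) : ℤ) ≤ |x| →
      (clampInt (M * 3 ^ j) (x + R * 3 ^ j) = 0 ∨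
        clampInt (M * 3 ^ j) (x + R * 3 ^ j) = (M * 3 ^ j : ℕ)) ∧ (R : ℤ) ≤ |third^[j] x| := by
    intro x hx
    push_cast at hx
    rcases le_abs.1 hx with h | h
    · refine ⟨Or.inr ?_, ?_⟩
      · simp only [clampInt]; rw [hMR]; lia
      · have := third_iterate_mono j h
        rw [mul_comm, third_iterate_mul] at this
        exact this.trans (le_abs_self _)
    · refine ⟨Or.inl ?_, ?_⟩
      · simp only [clampInt]; rw [hMR]; lia
      · have := third_iterate_mono j (show x ≤ 3 ^ j * (-R : ℤ) by lia)
        rw [third_iterate_mul] at this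
        exact (show (R : ℤ) ≤ -third^[j] x by lia).trans (neg_le_abs _)
  have hside : ∀ w : Fin (q + 1) → ℤ, (∃ i : Fin q, ((R * 3 ^ j : ℕ) : ℤ) ≤ |w i.succ|) →
      F (c w) = t₀ := by
    rintro w ⟨i, hi⟩
    have h1 := (hfar2 _ hi).1
    rw [hFb _ ⟨hc w, i.succ, h1⟩]
    refine hbs _ ⟨i, h1.imp (fun h => ?_) fun h => ?_⟩
    · simp only [coarse, c, Fin.cons_succ, h, third_iterate_zero]
    · simp only [coarse, c, Fin.cons_succ, h, third_iterate_end]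
  refine ⟨j, R * 3 ^ j, M * 3 ^ j, F ∘ c, ?_, fun w => hFT _ (hc w), ?_, ?_, ?_⟩
  · intro v w hvw
    refine hF _ (hc v) _ (hc w) fun i => ?_
    induction i using Fin.cases with
    | zero => exact clampInt_adj (hvw 0)
    | succ i => exact clampInt_adj (by simpa using hvw i.succ)
  · intro s hs v
    by_cases hv : ∃ i, ((R * 3 ^ j : ℕ) : ℤ) ≤ |v i|
    · obtain ⟨i, hi⟩ := hv
      rw [Function.comp_apply, hside (Fin.cons s v) ⟨i, by simpa using hi⟩]
      exact (hR _ ⟨i, (hfar2 _ hi).2⟩).symm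
    · push Not at hv
      have h0 : c (Fin.cons s v) 0 = 0 := by
        simp only [c, Fin.cons_zero, clampInt]; lia
      rw [Function.comp_apply, hFb _ ⟨hc _, 0, Or.inl h0⟩]
      have h1 : coarse j (c (Fin.cons s v)) 0 ≤ 0 := by rw [coarse, h0, third_iterate_zero]
      simp only [b, if_pos h1]
      congr 1
      funext i
      have h2 : c (Fin.cons s v) i.succ = v i + 3 ^ j * R := by
        have := hv i
        push_cast at this
        rw [abs_lt] at this
        simp only [c, Fin.cons_succ, clampInt, hMR]
        lia
      rw [coarse, h2, third_iterate_add]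
      simp [coarse]
  · intro s hs v
    have h0 : c (Fin.cons s v) 0 = (M * 3 ^ j : ℕ) := by
      simp only [c, Fin.cons_zero, clampInt]; lia
    rw [Function.comp_apply, hFb _ ⟨hc _, 0, Or.inr h0⟩]
    have h1 : ¬ coarse j (c (Fin.cons s v)) 0 ≤ 0 := by
      rw [coarse, h0, third_iterate_end]; simp only [M, R]; push_cast; lia
    simp only [b, if_neg h1]
  · rintro s v ⟨i, hi⟩
    exact hside _ ⟨i, by simpa using hi⟩

lemma CubeFill.piVanishes (hℓ : IsLength ℓ) {q k l : ℕ} (h : k ≤ l)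
    (hfill : CubeFill ℓ T (Fin (q + 1)) k l) : PiVanishes ℓ T q h :=
  piVanishes_of_null h fun _ ht₀ _ hf hfT hfar => hfill.null hℓ ht₀ hf hfT hfar

end Sphere

/-! ### Half spaces of characters -/

section Character

variable {G : Type u} [Group G] {ℓ : G → ℕ}

/-- The subset `G_χ` on which the character `χ` is nonnegative. -/
abbrev halfSpace (χ : Character G) : Set G := {g | 0 ≤ χ (Additive.ofMul g)}

lemma character_mul (χ : Character G) (g h : G) :
    χ (Additive.ofMul (g * h)) = χ (Additive.ofMul g) + χ (Additive.ofMul h) := by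
  rw [ofMul_mul, map_add]

lemma character_inv (χ : Character G) (g : G) :
    χ (Additive.ofMul g⁻¹) = -χ (Additive.ofMul g) := by
  rw [ofMul_inv, map_neg]

lemma character_one (χ : Character G) : χ (Additive.ofMul 1) = 0 := by
  rw [ofMul_one, map_zero]

lemma exists_le_character {χ : Character G} (hχ : χ ≠ 0) (r : ℝ) :
    ∃ g, r ≤ χ (Additive.ofMul g) := by
  obtain ⟨g, hg⟩ : ∃ g : G, 0 < χ (Additive.ofMul g) := by
    by_contra! h
    refine hχ (DFunLike.ext _ _ fun a => le_antisymm (h a.toMul) ?_)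
    have := h a.toMul⁻¹
    rw [character_inv] at this
    exact neg_nonpos.1 this
  obtain ⟨n, hn⟩ := Archimedean.arch r hg
  refine ⟨g ^ n, ?_⟩
  rwa [ofMul_pow, map_nsmul]

/-- Fillings in a half space yield fillings in the group. -/
lemma CubeFill.univ {χ : Character G} {ι : Type} [Finite ι] {k l : ℕ}
    (h : CubeFill ℓ (halfSpace χ) ι k l) : CubeFill ℓ Set.univ ι k l := by
  intro M hM b _ hbk
  -- The sphere has finitely many vertices, so some left translation, an isometry, moves it into the
  -- half space; the filling is translated back.
  obtain ⟨g, hg⟩ : ∃ g, ∀ v ∈ latBdry ι M, g * b v ∈ halfSpace χ := by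
    by_cases hχ : χ = 0
    · exact ⟨1, fun v _ => by simp [halfSpace, hχ]⟩
    · have hfin : (latBdry ι M).Finite := (latBox_finite ι M).subset fun v hv => hv.1
      obtain ⟨C, hC⟩ := (hfin.image fun v => -χ (Additive.ofMul (b v))).bddAbove
      obtain ⟨g, hg⟩ := exists_le_character hχ C
      refine ⟨g, fun v hv => ?_⟩
      have := hC ⟨v, hv, rfl⟩
      rw [Set.mem_ofPred_eq, character_mul]
      simp only at this
      linarith
  obtain ⟨j, F, hFT, hF, hFb⟩ := h M hM (fun v => g * b v) hg fun v w hvw => by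
    rw [dist_translate ℓ]; exact hbk v w hvw
  refine ⟨j, fun v => g⁻¹ * F v, fun _ _ => Set.mem_univ _, fun v hv w hw hvw => ?_,
    fun v hv => ?_⟩
  · rw [dist_translate ℓ]
    exact hF v hv w hw hvw
  · simp only [hFb v hv, inv_mul_cancel_left]

lemma zero_mem_sigmaInvariant (hℓ : IsLength ℓ) {m : ℕ} (h : (sigmaInvariant ℓ m).Nonempty) :
    (0 : Character G) ∈ sigmaInvariant ℓ m := by
  obtain ⟨χ, hχ⟩ := h
  intro q hq k
  obtain ⟨l, hkl, hl⟩ := hχ q hq k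
  have h0 : {g : G | 0 ≤ (0 : Character G) (Additive.ofMul g)} = Set.univ := by
    ext; simp
  rw [h0]
  exact ⟨l, hkl, CubeFill.piVanishes hℓ hkl (CubeFill.univ (χ := χ) (hl.cubeFill (by simp)))⟩

end Character

/-! ### Fillings controlled in distance and valuation -/

section Filling

variable {G : Type u} [Group G] {ℓ : G → ℕ} {χ : Character G} {ι : Type}

/-- A lattice ball filling a lattice sphere, controlled in distance and valuation. -/
structure Filling (ℓ : G → ℕ) (χ : Character G) (M j l B : ℕ) (b F : (ι → ℤ) → G) : Prop where
  lip : ∀ v ∈ latBox ι (M * 3 ^ j), ∀ w ∈ latBox ι (M * 3 ^ j), Adj v w → ℓ ((F v)⁻¹ * F w) ≤ l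
  bdry : ∀ v ∈ latBdry ι (M * 3 ^ j), F v = b (coarse j v)
  dist : ∀ v ∈ latBox ι (M * 3 ^ j), ∀ w ∈ latBdry ι M, ℓ ((b w)⁻¹ * F v) ≤ B
  val : ∀ r, (∀ w ∈ latBdry ι M, r ≤ χ (Additive.ofMul (b w))) →
    ∀ v ∈ latBox ι (M * 3 ^ j), r ≤ χ (Additive.ofMul (F v))
  const : ∀ t, (∀ w ∈ latBdry ι M, b w = t) → ∀ v ∈ latBox ι (M * 3 ^ j), F v = t

lemma Filling.mono {M j l B B' : ℕ} {b F : (ι → ℤ) → G} (h : Filling ℓ χ M j l B b F)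
    (hB : B ≤ B') : Filling ℓ χ M j l B' b F :=
  { h with dist := fun v hv w hw => (h.dist v hv w hw).trans hB }

lemma Filling.refine {M j l B : ℕ} {b F : (ι → ℤ) → G} (h : Filling ℓ χ M j l B b F) (i : ℕ) :
    Filling ℓ χ M (j + i) l B b (F ∘ coarse i) := by
  have e : M * 3 ^ (j + i) = M * 3 ^ j * 3 ^ i := by rw [pow_add, mul_assoc]
  constructor
  · intro v hv w hw hvw
    rw [e] at hv hw
    exact h.lip _ (coarse_mem_latBox i hv) _ (coarse_mem_latBox i hw) (hvw.coarse i)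
  · intro v hv
    rw [e] at hv
    rw [Function.comp_apply, h.bdry _ (coarse_mem_latBdry i hv), coarse_coarse]
  · intro v hv
    rw [e] at hv
    exact h.dist _ (coarse_mem_latBox i hv)
  · intro r hr v hv
    rw [e] at hv
    exact h.val r hr _ (coarse_mem_latBox i hv)
  · intro t ht v hv
    rw [e] at hv
    exact h.const t ht _ (coarse_mem_latBox i hv)

lemma Filling.translate {M j l B : ℕ} {b F : (ι → ℤ) → G} (h : Filling ℓ χ M j l B b F) (g : G) :
    Filling ℓ χ M j l B (fun v => g * b v) (fun v => g * F v) := by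
  constructor
  · intro v hv w hw hvw
    rw [dist_translate ℓ]
    exact h.lip v hv w hw hvw
  · intro v hv
    simp only [h.bdry v hv]
  · intro v hv w hw
    rw [dist_translate ℓ]
    exact h.dist v hv w hw
  · intro r hr v hv
    have := h.val (r - χ (Additive.ofMul g)) (fun w hw => by
      have := hr w hw
      rw [character_mul] at this
      linarith) v hv
    rw [character_mul]
    linarith
  · intro t ht v hv
    have := h.const (g⁻¹ * t) (fun w hw => by rw [← ht w hw, inv_mul_cancel_left]) v hv
    rw [this, mul_inv_cancel_left]

lemma Filling.congr {M j l B : ℕ} {b b' F : (ι → ℤ) → G} (h : Filling ℓ χ M j l B b F)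
    (hb : ∀ v ∈ latBdry ι M, b v = b' v) : Filling ℓ χ M j l B b' F where
  lip := h.lip
  bdry v hv := by rw [h.bdry v hv, hb _ (coarse_mem_latBdry j hv)]
  dist v hv w hw := by rw [← hb w hw]; exact h.dist v hv w hw
  val r hr := h.val r fun w hw => by rw [hb w hw]; exact hr w hw
  const t ht := h.const t fun w hw => by rw [hb w hw]; exact ht w hw

lemma zero_mem_latBdry [Nonempty ι] (M : ℕ) : (0 : ι → ℤ) ∈ latBdry ι M :=
  ⟨fun _ => ⟨le_rfl, Int.natCast_nonneg M⟩, Classical.arbitrary ι, Or.inl rfl⟩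

lemma latBdry_finite (ι : Type) [Finite ι] (M : ℕ) : (latBdry ι M).Finite :=
  (latBox_finite ι M).subset fun _ hv => hv.1

/-- Once the lowest vertex is translated to the identity, the sphere lies in the half space, so a
filling there never drops below the sphere. Constant spheres are filled constantly by hand, because
later constructions must preserve constancy at infinity. -/
lemma exists_filling (hℓ : IsLength ℓ) [Finite ι] [Nonempty ι] {k l : ℕ}
    (hfill : CubeFill ℓ (halfSpace χ) ι k l) {M : ℕ} (hM : 0 < M) {b : (ι → ℤ) → G}
    (hb : ∀ v w, FaceAdj M v w → ℓ ((b v)⁻¹ * b w) ≤ k) :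
    ∃ j B F, Filling ℓ χ M j l B b F := by
  by_cases hc : ∃ t, ∀ w ∈ latBdry ι M, b w = t
  · obtain ⟨t, ht⟩ := hc
    refine ⟨0, 0, fun _ => t, ?_, ?_, ?_, ?_, ?_⟩
    · intros; rw [hℓ.dist_self]; lia
    · intro v hv
      exact (ht _ (coarse_mem_latBdry 0 hv)).symm
    · intro v _ w hw
      rw [ht w hw, hℓ.dist_self]
    · intro r hr v _
      have := hr 0 (zero_mem_latBdry M)
      rwa [ht 0 (zero_mem_latBdry M)] at this
    · intro t' ht' v _
      rw [← ht' 0 (zero_mem_latBdry M), ht 0 (zero_mem_latBdry M)]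
  · obtain ⟨w₀, hw₀, hmin⟩ := Set.exists_min_image (latBdry ι M)
      (fun w => χ (Additive.ofMul (b w))) (latBdry_finite ι M) ⟨0, zero_mem_latBdry M⟩
    obtain ⟨j, F, hFT, hF, hFb⟩ := hfill M hM (fun v => (b w₀)⁻¹ * b v) (fun v hv => by
      have := hmin v hv
      rw [Set.mem_ofPred_eq, character_mul, character_inv]
      linarith) (fun v w hvw => by rw [dist_translate ℓ]; exact hb v w hvw)
    obtain ⟨B, hB⟩ := (((latBox_finite ι (M * 3 ^ j)).prod (latBdry_finite ι M)).image
      fun z => ℓ ((b z.2)⁻¹ * (b w₀ * F z.1))).bddAbove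
    refine ⟨j, B, fun v => b w₀ * F v, ?_, ?_, ?_, ?_, ?_⟩
    · intro v hv w hw hvw
      rw [dist_translate ℓ]
      exact hF v hv w hw hvw
    · intro v hv
      simp only [hFb v hv, mul_inv_cancel_left]
    · exact fun v hv w hw => hB ⟨(v, w), ⟨hv, hw⟩, rfl⟩
    · intro r hr v hv
      have h1 := hFT v hv
      have h2 := hr w₀ hw₀
      rw [Set.mem_ofPred_eq] at h1
      rw [character_mul]
      linarith
    · exact fun t ht => absurd ⟨t, ht⟩ hc

/-- Fillings can be chosen uniformly for all spheres of bounded diameter. -/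
lemma exists_uniform_filling (hℓ : IsLength ℓ) [Finite ι] [Nonempty ι] {k l : ℕ}
    (hfill : CubeFill ℓ (halfSpace χ) ι k l) {M : ℕ} (hM : 0 < M) (C : ℕ) :
    ∃ j₀ B, ∀ j ≥ j₀, ∀ b : (ι → ℤ) → G, (∀ v w, FaceAdj M v w → ℓ ((b v)⁻¹ * b w) ≤ k) →
      (∀ v ∈ latBdry ι M, ∀ w ∈ latBdry ι M, ℓ ((b v)⁻¹ * b w) ≤ C) →
      ∃ F, Filling ℓ χ M j l B b F := by
  classical
  have : Finite (latBdry ι M) := latBdry_finite ι M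
  let ext : (latBdry ι M → G) → (ι → ℤ) → G := fun β v => if hv : v ∈ latBdry ι M then β ⟨v, hv⟩
    else 1
  have key : ∀ β : latBdry ι M → G, ∃ jB : ℕ × ℕ,
      (∀ v w, FaceAdj M v w → ℓ ((ext β v)⁻¹ * ext β w) ≤ k) →
        ∃ F, Filling ℓ χ M jB.1 l jB.2 (ext β) F := by
    intro β
    by_cases hβ : ∀ v w, FaceAdj M v w → ℓ ((ext β v)⁻¹ * ext β w) ≤ k
    · obtain ⟨j, B, F, hF⟩ := exists_filling hℓ hfill hM hβ
      exact ⟨(j, B), fun _ => ⟨F, hF⟩⟩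
    · exact ⟨(0, 0), fun h => absurd h hβ⟩
  choose jB hjB using key
  -- Up to translation only finitely many spheres of bounded diameter exist, since balls are finite;
  -- maxima of their depths and displacement bounds serve for all of them after refinement.
  have hfin : {β : latBdry ι M → G | ∀ v, ℓ (β v) ≤ C}.Finite := by
    have : {β : latBdry ι M → G | ∀ v, ℓ (β v) ≤ C} = Set.univ.pi fun _ => {g | ℓ g ≤ C} := by
      ext β; simp
    rw [this]
    exact Set.Finite.pi fun _ => hℓ.finite_ball C
  obtain ⟨j₀, hj₀⟩ := (hfin.image fun β => (jB β).1).bddAbove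
  obtain ⟨B, hB⟩ := (hfin.image fun β => (jB β).2).bddAbove
  refine ⟨j₀, B, fun j hj b hbk hbC => ?_⟩
  let β : latBdry ι M → G := fun v => (b 0)⁻¹ * b v
  have hext : ∀ v ∈ latBdry ι M, ext β v = (b 0)⁻¹ * b v := fun v hv => dif_pos hv
  have hβ : β ∈ {β : latBdry ι M → G | ∀ v, ℓ (β v) ≤ C} := fun v =>
    hbC 0 (zero_mem_latBdry M) v v.2
  obtain ⟨F, hF⟩ := hjB β fun v w hvw => by
    obtain ⟨hv, hw, -, i, hi, hi'⟩ := id hvw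
    rw [hext v ⟨hv, i, hi'⟩, hext w ⟨hw, i, hi ▸ hi'⟩, dist_translate ℓ]
    exact hbk v w hvw
  obtain ⟨i, rfl⟩ := Nat.exists_eq_add_of_le ((hj₀ ⟨β, hβ, rfl⟩).trans hj)
  refine ⟨_, (((hF.refine i).mono (hB ⟨β, hβ, rfl⟩)).translate (b 0)).congr fun v hv => ?_⟩
  rw [hext v hv, mul_inv_cancel_left]

end Filling

/-! ### Lattice maps shifted by a bounded distance -/

section Shift

variable {G : Type u} [Group G] {ℓ : G → ℕ} {χ : Character G} {n : ℕ}

/-- The lattice point `u` is a vertex of the cell of side `3 ^ a` containing `v`. -/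
def Near (a : ℕ) (v u : Fin n → ℤ) : Prop := ∀ i, |v i - 3 ^ a * u i| < 3 ^ a

lemma Near.adj {a : ℕ} {v u u' : Fin n → ℤ} (h : Near a v u) (h' : Near a v u') : Adj u u' := by
  intro i
  have h1 := h i
  have h2 := h' i
  have hp : (0 : ℤ) < 3 ^ a := by positivity
  have h3 : (3 : ℤ) ^ a * |u i - u' i| < 3 ^ a * 2 := by
    rw [← abs_of_pos hp, ← abs_mul, abs_of_pos hp]
    rw [abs_lt] at *
    constructor <;> linarith
  have := lt_of_mul_lt_mul_left h3 hp.le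
  lia

lemma near_floor (a : ℕ) (v : Fin n → ℤ) : Near a v fun i => v i / 3 ^ a := by
  intro i
  have hp : (0 : ℤ) < 3 ^ a := by positivity
  have h1 := Int.mul_ediv_add_emod (v i) (3 ^ a)
  have h2 := Int.emod_nonneg (v i) hp.ne'
  have h3 := Int.emod_lt_of_pos (v i) hp
  rw [abs_lt]
  constructor <;> linarith

lemma Near.of_coarse {a j : ℕ} {v u : Fin n → ℤ} (h : Near a (coarse j v) u) :
    Near (a + j) v u := by
  intro i
  have h1 := h i
  have h2 := third_iterate_near j (v i)
  have h3 : v i - 3 ^ (a + j) * u i =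
      (v i - 3 ^ j * third^[j] (v i)) + 3 ^ j * (coarse j v i - 3 ^ a * u i) := by
    rw [coarse, pow_add]; ring
  have hp : (0 : ℤ) < 3 ^ j := by positivity
  have h4 : (3 : ℤ) ^ j * |coarse j v i - 3 ^ a * u i| ≤ 3 ^ j * (3 ^ a - 1) :=
    mul_le_mul_of_nonneg_left (by lia) hp.le
  have h5 : |v i - 3 ^ (a + j) * u i| ≤
      |v i - 3 ^ j * third^[j] (v i)| + 3 ^ j * |coarse j v i - 3 ^ a * u i| := by
    rw [h3]
    refine (abs_add_le _ _).trans (by rw [abs_mul, abs_of_pos hp])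
  have h6 : (3 : ℤ) ^ (a + j) = 3 ^ j * 3 ^ a := by rw [pow_add, mul_comm]
  rw [h6]
  rw [h6] at h5
  have h7 : (3 : ℤ) ^ j * (3 ^ a - 1) = 3 ^ j * 3 ^ a - 3 ^ j := by ring
  lia

/-- The lattice map `f'`, on the subset `s` of the lattice subdivided by `3 ^ a`, stays within
distance `B` of `f` and raises the character `χ` by `c`. -/
structure ShiftOn (ℓ : G → ℕ) (χ : Character G) (a B : ℕ) (c : ℝ) (g : G) (s : Set (Fin n → ℤ))
    (f f' : (Fin n → ℤ) → G) : Prop where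
  dist : ∀ v ∈ s, ∀ u, Near a v u → ℓ ((f u)⁻¹ * f' v) ≤ B
  val : ∀ v ∈ s, ∀ r, (∀ u, Near a v u → r ≤ χ (Additive.ofMul (f u))) →
    r + c ≤ χ (Additive.ofMul (f' v))
  const : ∀ v ∈ s, ∀ t, (∀ u, Near a v u → f u = t) → f' v = t * g

/-- The points of the `d`-skeleton of the cubulation of side `3 ^ a`. -/
def skelLat (n a d : ℕ) : Set (Fin n → ℤ) :=
  {v | (Finset.univ.filter fun i => ¬ ((3 : ℤ) ^ a ∣ v i)).card ≤ d}

lemma dvd_coarse {a j : ℕ} {x : ℤ} (h : (3 : ℤ) ^ (a + j) ∣ x) : (3 : ℤ) ^ a ∣ third^[j] x := by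
  obtain ⟨y, rfl⟩ := h
  rw [pow_add, mul_comm ((3 : ℤ) ^ a), mul_assoc, third_iterate_mul]
  exact dvd_mul_right _ _

end Shift

/-! ### Shifting skeleton by skeleton -/

section Build

variable {G : Type u} [Group G] {ℓ : G → ℕ} {χ : Character G} {n : ℕ}

/-- The lattice map `f` moves adjacent points in a common `d`-dimensional face of the cubulation of
side `3 ^ a` at most `k` apart. -/
def SkelLip (ℓ : G → ℕ) (a d k : ℕ) (f : (Fin n → ℤ) → G) : Prop :=
  ∀ v w, Adj v w → (Finset.univ.filter fun i => ¬ (v i = w i ∧ (3 : ℤ) ^ a ∣ v i)).card ≤ d →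
    ℓ ((f v)⁻¹ * f w) ≤ k

/-- The point with local coordinates `w` in the face with base point `c` and directions `D`. -/
def facePt (a : ℕ) (c : Fin n → ℤ) (D : Finset (Fin n)) (w : D → ℤ) : Fin n → ℤ :=
  fun i => 3 ^ a * c i + if h : i ∈ D then w ⟨i, h⟩ else 0

lemma facePt_of_mem {a : ℕ} {c : Fin n → ℤ} {D : Finset (Fin n)} {w : D → ℤ} {i : Fin n}
    (h : i ∈ D) : facePt a c D w i = 3 ^ a * c i + w ⟨i, h⟩ := by simp [facePt, h]

lemma facePt_of_notMem {a : ℕ} {c : Fin n → ℤ} {D : Finset (Fin n)} {w : D → ℤ} {i : Fin n}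
    (h : i ∉ D) : facePt a c D w i = 3 ^ a * c i := by simp [facePt, h]

lemma Near.of_facePt {a : ℕ} {c u : Fin n → ℤ} {D : Finset (Fin n)} {w : D → ℤ}
    (hw : w ∈ latBox D (3 ^ a)) (h : Near a (facePt a c D w) u) (i : Fin n) :
    (i ∉ D → u i = c i) ∧ c i ≤ u i ∧ u i ≤ c i + 1 := by
  have hi := h i
  have hp : (0 : ℤ) < 3 ^ a := by positivity
  by_cases hD : i ∈ D
  · rw [facePt_of_mem hD, abs_lt] at hi
    have h1 := hw ⟨i, hD⟩
    push_cast at h1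
    refine ⟨fun h => absurd hD h, ?_, ?_⟩
    · have : (3 : ℤ) ^ a * (c i - 1) < 3 ^ a * u i := by linarith
      have := lt_of_mul_lt_mul_left this hp.le
      lia
    · have : (3 : ℤ) ^ a * u i < 3 ^ a * (c i + 2) := by linarith
      have := lt_of_mul_lt_mul_left this hp.le
      lia
  · rw [facePt_of_notMem hD, ← mul_sub, abs_mul, abs_of_pos hp] at hi
    have h1 : |c i - u i| < 1 := by
      refine lt_of_mul_lt_mul_left ?_ hp.le
      rwa [mul_one]
    have := Int.abs_lt_one_iff.1 h1
    lia

lemma card_face_le {a d : ℕ} {c : Fin n → ℤ} {D : Finset (Fin n)} (hD : D.card = d + 1)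
    {v w : D → ℤ} (i : D) (hi : v i = w i) (hi' : v i = 0 ∨ v i = (3 ^ a : ℕ)) :
    (Finset.univ.filter fun i =>
      ¬ (facePt a c D v i = facePt a c D w i ∧ (3 : ℤ) ^ a ∣ facePt a c D v i)).card ≤ d := by
  classical
  have : (Finset.univ.filter fun i => ¬ (facePt a c D v i = facePt a c D w i ∧
      (3 : ℤ) ^ a ∣ facePt a c D v i)) ⊆ D.erase i := by
    intro x hx
    rw [Finset.mem_filter] at hx
    by_contra hx'
    refine hx.2 ?_
    rw [Finset.mem_erase, not_and_or, not_not] at hx'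
    by_cases hxD : x ∈ D
    · obtain rfl : x = i.1 := by tauto
      rw [facePt_of_mem hxD, facePt_of_mem hxD]
      refine ⟨by rw [hi], ?_⟩
      rcases hi' with h | h <;> rw [h] <;> simp
    · rw [facePt_of_notMem hxD, facePt_of_notMem hxD]
      simp
  refine (Finset.card_le_card this).trans ?_
  rw [Finset.card_erase_of_mem i.2, hD]
  rfl

lemma facePt_mem_skelLat {a d : ℕ} {c : Fin n → ℤ} {D : Finset (Fin n)} (hD : D.card = d + 1)
    {w : D → ℤ} (hw : w ∈ latBdry D (3 ^ a)) : facePt a c D w ∈ skelLat n a d := by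
  obtain ⟨-, i, hi⟩ := hw
  have := card_face_le (c := c) hD i (rfl : w i = w i) hi
  simpa [skelLat] using this

/-- Extension of a shifted map over the next skeleton. -/
lemma exists_shift_succ (hℓ : IsLength ℓ) {d : ℕ} (hd : d < n) {k l k' : ℕ}
    (hfill : ∀ (ι : Type) [Fintype ι], Fintype.card ι = d + 1 → CubeFill ℓ (halfSpace χ) ι k l)
    {a B : ℕ} {r₀ : ℝ} {g : G} (hprev : ∀ f : (Fin n → ℤ) → G, Lip ℓ k' f →
      ∃ f', ShiftOn ℓ χ a B r₀ g (skelLat n a d) f f' ∧ SkelLip ℓ a d k f') :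
    ∃ a' B', ∀ f : (Fin n → ℤ) → G, Lip ℓ k' f →
      ∃ f', ShiftOn ℓ χ a' B' r₀ g (skelLat n a' (d + 1)) f f' ∧ SkelLip ℓ a' (d + 1) l f' := by
  classical
  have hM : 0 < 3 ^ a := by positivity
  -- All boundary vertices of a face with base point `c` lie within `B + k'` of `f c`, whence the
  -- diameter bound. The depths are maximized over the finitely many sets of directions.
  have huni : ∀ D : Finset (Fin n), ∃ j₀ B₁, D.card = d + 1 → ∀ j ≥ j₀, ∀ b : (D → ℤ) → G,
      (∀ v w, FaceAdj (3 ^ a) v w → ℓ ((b v)⁻¹ * b w) ≤ k) →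
      (∀ v ∈ latBdry D (3 ^ a), ∀ w ∈ latBdry D (3 ^ a), ℓ ((b v)⁻¹ * b w) ≤ 2 * (B + k')) →
      ∃ F, Filling ℓ χ (3 ^ a) j l B₁ b F := by
    intro D
    by_cases hD : D.card = d + 1
    · have : Nonempty D := (Finset.card_pos.1 (by lia)).to_subtype
      obtain ⟨j₀, B₁, h⟩ := exists_uniform_filling hℓ (hfill D (by simpa using hD)) hM
        (2 * (B + k'))
      exact ⟨j₀, B₁, fun _ => h⟩
    · exact ⟨0, 0, fun h => absurd h hD⟩
  choose j₀ B₁ huni using huni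
  let j := Finset.univ.sup j₀
  let B₂ := Finset.univ.sup B₁
  refine ⟨a + j, k' + B + B₂, fun f hf => ?_⟩
  obtain ⟨f₁, hf₁, hf₁L⟩ := hprev f hf
  let b : (Fin n → ℤ) → (D : Finset (Fin n)) → (D → ℤ) → G := fun c D w => f₁ (facePt a c D w)
  have hbc : ∀ c (D : Finset (Fin n)), D.card = d + 1 → ∀ w ∈ latBdry D (3 ^ a),
      ℓ ((f c)⁻¹ * b c D w) ≤ k' + B := by
    intro c D hD w hw
    have h1 := near_floor a (facePt a c D w)
    refine (hℓ.dist_triangle _ (f fun i => facePt a c D w i / 3 ^ a) _).trans (add_le_add ?_ ?_)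
    · refine hf _ _ fun i => ?_
      have := h1.of_facePt hw.1 i
      rw [abs_le]; lia
    · exact hf₁.dist _ (facePt_mem_skelLat hD hw) _ h1
  have hF : ∀ c (D : Finset (Fin n)), ∃ F : (D → ℤ) → G, D.card = d + 1 →
      Filling ℓ χ (3 ^ a) j l B₂ (b c D) F := by
    intro c D
    by_cases hD : D.card = d + 1
    · obtain ⟨F, hF⟩ := huni D hD j (Finset.le_sup (Finset.mem_univ D)) (b c D)
        (fun v w ⟨_, _, hvw, i, hi, hi'⟩ => hf₁L _ _ (fun x => by
          by_cases hx : x ∈ D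
          · rw [facePt_of_mem hx, facePt_of_mem hx, add_sub_add_left_eq_sub]
            exact hvw _
          · rw [facePt_of_notMem hx, facePt_of_notMem hx]; simp) (card_face_le hD i hi hi'))
        (fun v hv w hw => by
          refine (hℓ.dist_triangle _ (f c) _).trans ?_
          have h1 := hbc c D hD v hv
          have h2 := hbc c D hD w hw
          rw [hℓ.dist_comm] at h1
          lia)
      exact ⟨F, fun _ => hF.mono (Finset.le_sup (Finset.mem_univ D))⟩
    · exact ⟨fun _ => 1, fun h => absurd h hD⟩
  choose F hF using hF
  have hN : (0 : ℤ) < 3 ^ (a + j) := by positivity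
  have hN' : ((3 ^ a * 3 ^ j : ℕ) : ℤ) = 3 ^ (a + j) := by push_cast; rw [pow_add]
  let Dv : (Fin n → ℤ) → Finset (Fin n) := fun v =>
    Finset.univ.filter fun i => ¬ ((3 : ℤ) ^ (a + j) ∣ v i)
  have hDv : ∀ {v i}, i ∈ Dv v ↔ ¬ ((3 : ℤ) ^ (a + j) ∣ v i) := by simp [Dv]
  let cv : (Fin n → ℤ) → (Fin n → ℤ) := fun v i => v i / 3 ^ (a + j)
  -- Old faces are merely subdivided, open new faces receive a filling. By `hcell` the filling
  -- formula holds on closed new faces too, because fillings restrict to the subdivided boundary.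
  let f' : (Fin n → ℤ) → G := fun v => if (Dv v).card ≤ d then f₁ (coarse j v) else
    F (cv v) (Dv v) fun i => v i - 3 ^ (a + j) * cv v i
  have hcell : ∀ c (D : Finset (Fin n)), D.card = d + 1 → ∀ v : Fin n → ℤ,
      (∀ i, i ∉ D → v i = 3 ^ (a + j) * c i) →
      (∀ i ∈ D, 3 ^ (a + j) * c i ≤ v i ∧ v i ≤ 3 ^ (a + j) * (c i + 1)) →
      (fun i : D => v i - 3 ^ (a + j) * c i) ∈ latBox D (3 ^ a * 3 ^ j) ∧
      f' v = F c D fun i => v i - 3 ^ (a + j) * c i := by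
    intro c D hD v h1 h2
    have hbox : (fun i : D => v i - 3 ^ (a + j) * c i) ∈ latBox D (3 ^ a * 3 ^ j) := fun i => by
      have := h2 i i.2
      rw [hN']
      constructor <;> linarith
    refine ⟨hbox, ?_⟩
    have hsub : Dv v ⊆ D := by
      intro i hi
      by_contra hiD
      exact hDv.1 hi (by rw [h1 i hiD]; exact dvd_mul_right _ _)
    by_cases hcard : (Dv v).card ≤ d
    · obtain ⟨i, hiD, hi⟩ : ∃ i ∈ D, (3 : ℤ) ^ (a + j) ∣ v i := by
        by_contra! h
        have := Finset.card_le_card (show D ⊆ Dv v from fun i hi => hDv.2 (h i hi))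
        lia
      have hb : (fun i : D => v i - 3 ^ (a + j) * c i) ∈ latBdry D (3 ^ a * 3 ^ j) := by
        refine ⟨hbox, ⟨i, hiD⟩, ?_⟩
        obtain ⟨y, hy⟩ := hi
        have := h2 i hiD
        rw [hy] at this
        have e1 := le_of_mul_le_mul_left this.1 hN
        have e2 := le_of_mul_le_mul_left this.2 hN
        simp only
        rw [hN', hy]
        rcases (show y = c i ∨ y = c i + 1 by lia) with rfl | rfl
        · left; ring
        · right; ring
      rw [(hF c D hD).bdry _ hb]
      simp only [f', if_pos hcard, b]
      congr 1
      funext x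
      by_cases hx : x ∈ D
      · rw [facePt_of_mem hx]
        have : v x = (v x - 3 ^ (a + j) * c x) + 3 ^ j * (3 ^ a * c x) := by
          rw [pow_add]; ring
        conv_lhs => rw [coarse, this, third_iterate_add]
        simp only [coarse]
        ring
      · rw [facePt_of_notMem hx, coarse, h1 x hx, pow_add, mul_comm ((3 : ℤ) ^ a), mul_assoc,
          third_iterate_mul]
    · obtain rfl : Dv v = D := Finset.eq_of_subset_of_card_le hsub (by lia)
      obtain rfl : cv v = c := by
        funext i
        simp only [cv]
        by_cases hi : i ∈ Dv v
        · have h3 := h2 i hi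
          have h4 : v i ≠ 3 ^ (a + j) * (c i + 1) := fun h => hDv.1 hi ⟨_, h⟩
          refine le_antisymm ?_ ?_
          · refine Int.le_of_lt_add_one (Int.ediv_lt_of_lt_mul hN ?_)
            rw [mul_comm]; exact lt_of_le_of_ne h3.2 h4
          · refine Int.le_ediv_of_mul_le hN ?_
            rw [mul_comm]; exact h3.1
        · rw [h1 i hi, Int.mul_ediv_cancel_left _ hN.ne']
      simp only [f', if_neg hcard]
  refine ⟨f', ?_, ?_⟩
  · have hopen : ∀ v, (∀ i ∉ Dv v, v i = 3 ^ (a + j) * cv v i) ∧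
        ∀ i ∈ Dv v, 3 ^ (a + j) * cv v i < v i ∧ v i < 3 ^ (a + j) * (cv v i + 1) := by
      intro v
      constructor
      · intro i hi
        rw [hDv, not_not] at hi
        exact (Int.mul_ediv_cancel' hi).symm
      · intro i hi
        have h1 := Int.mul_ediv_add_emod (v i) (3 ^ (a + j))
        have h2 := Int.emod_nonneg (v i) hN.ne'
        have h3 := Int.emod_lt_of_pos (v i) hN
        have h4 : v i % 3 ^ (a + j) ≠ 0 := fun h => hDv.1 hi (Int.dvd_of_emod_eq_zero h)
        simp only [cv]
        constructor
        · have : 0 < v i % 3 ^ (a + j) := by lia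
          linarith
        · linarith
    -- The coarse points near a boundary point of a face are corners of that face, hence near every
    -- point of its interior. This passes assumptions about `f` from the interior to the boundary.
    have hnear : ∀ v, ∀ w ∈ latBdry (Dv v) (3 ^ a), ∀ u, Near a (facePt a (cv v) (Dv v) w) u →
        Near (a + j) v u := by
      intro v w hw u hu i
      have h1 := hu.of_facePt hw.1 i
      by_cases hi : i ∈ Dv v
      · have h2 := (hopen v).2 i hi
        rcases (show u i = cv v i ∨ u i = cv v i + 1 by lia) with h | h
        · rw [h, abs_lt]; constructor <;> linarith
        · rw [h, abs_lt]; constructor <;> linarith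
      · rw [h1.1 hi, (hopen v).1 i hi]
        simp
    have hbig : ∀ v ∈ skelLat n (a + j) (d + 1), ¬ (Dv v).card ≤ d → (Dv v).card = d + 1 := by
      intro v hv h
      have : (Dv v).card ≤ d + 1 := hv
      lia
    have hbig' : ∀ v, (Dv v).card = d + 1 →
        (fun i : Dv v => v i - 3 ^ (a + j) * cv v i) ∈ latBox (Dv v) (3 ^ a * 3 ^ j) ∧
        f' v = F (cv v) (Dv v) fun i => v i - 3 ^ (a + j) * cv v i := fun v hcard =>
      hcell (cv v) (Dv v) hcard v (hopen v).1 fun i hi =>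
        ⟨((hopen v).2 i hi).1.le, ((hopen v).2 i hi).2.le⟩
    have hsmall : ∀ v, (Dv v).card ≤ d → coarse j v ∈ skelLat n a d := by
      intro v hv
      refine (Finset.card_le_card fun i hi => ?_).trans hv
      rw [Finset.mem_filter] at hi
      exact hDv.2 fun h => hi.2 (dvd_coarse h)
    constructor
    · intro v hv u hu
      by_cases hcard : (Dv v).card ≤ d
      · have h1 := near_floor a (coarse j v)
        simp only [f', if_pos hcard]
        refine (hℓ.dist_triangle _ (f fun i => coarse j v i / 3 ^ a) _).trans ?_
        have h2 := hf _ _ (hu.adj h1.of_coarse)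
        have h3 := hf₁.dist _ (hsmall v hcard) _ h1
        lia
      · have hc := hbig v hv hcard
        have : Nonempty (Dv v) := (Finset.card_pos.1 (by lia)).to_subtype
        have h0 := zero_mem_latBdry (ι := Dv v) (3 ^ a)
        obtain ⟨h1, h2⟩ := hbig' v hc
        rw [h2]
        have h3 : Near (a + j) v (cv v) := near_floor _ _
        refine (hℓ.dist_triangle _ (f (cv v)) _).trans ?_
        have h4 := hℓ.dist_triangle (f (cv v)) (b (cv v) (Dv v) 0)
          (F (cv v) (Dv v) fun i => v i - 3 ^ (a + j) * cv v i)
        have h5 := (hF (cv v) _ hc).dist _ h1 0 h0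
        have h6 := hf _ _ (hu.adj h3)
        have h7 : ℓ ((f (cv v))⁻¹ * b (cv v) (Dv v) 0) ≤ B := by
          refine hf₁.dist _ (facePt_mem_skelLat hc h0) _ fun i => ?_
          have : facePt a (cv v) (Dv v) 0 i = 3 ^ a * cv v i := by simp [facePt]
          rw [this]; simp
        lia
    · intro v hv r hr
      by_cases hcard : (Dv v).card ≤ d
      · simp only [f', if_pos hcard]
        exact hf₁.val _ (hsmall v hcard) r fun u hu => hr u hu.of_coarse
      · have hc := hbig v hv hcard
        obtain ⟨h1, h2⟩ := hbig' v hc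
        rw [h2]
        exact (hF (cv v) _ hc).val _ (fun w hw => hf₁.val _ (facePt_mem_skelLat hc hw) r
          fun u hu => hr u (hnear v w hw u hu)) _ h1
    · intro v hv t ht
      by_cases hcard : (Dv v).card ≤ d
      · simp only [f', if_pos hcard]
        exact hf₁.const _ (hsmall v hcard) t fun u hu => ht u hu.of_coarse
      · have hc := hbig v hv hcard
        obtain ⟨h1, h2⟩ := hbig' v hc
        rw [h2]
        exact (hF (cv v) _ hc).const _ (fun w hw => hf₁.const _ (facePt_mem_skelLat hc hw) t
          fun u hu => ht u (hnear v w hw u hu)) _ h1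
  · intro v w hvw hcard
    -- The directions not confined to a common wall are enlarged to exactly `d + 1`, so the two
    -- adjacent points lie in one closed face and the Lipschitz bound of a single filling applies.
    obtain ⟨D, hED, hD⟩ := Finset.exists_superset_card_eq hcard (by simpa using hd)
    let c : Fin n → ℤ := fun i => min (v i) (w i) / 3 ^ (a + j)
    have hmem : ∀ i, i ∉ D → v i = w i ∧ (3 : ℤ) ^ (a + j) ∣ v i := by
      intro i hi
      by_contra h
      exact hi (hED (by simpa using h))
    have hout : ∀ i, i ∉ D → v i = 3 ^ (a + j) * c i := by
      intro i hi
      obtain ⟨h1, h2⟩ := hmem i hi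
      simp only [c, ← h1, min_self]
      exact (Int.mul_ediv_cancel' h2).symm
    have hin : ∀ i, (3 ^ (a + j) * c i ≤ v i ∧ v i ≤ 3 ^ (a + j) * (c i + 1)) ∧
        (3 ^ (a + j) * c i ≤ w i ∧ w i ≤ 3 ^ (a + j) * (c i + 1)) := by
      intro i
      have h1 := Int.mul_ediv_add_emod (min (v i) (w i)) (3 ^ (a + j))
      have h2 := Int.emod_nonneg (min (v i) (w i)) hN.ne'
      have h3 := Int.emod_lt_of_pos (min (v i) (w i)) hN
      have h4 := hvw i
      rw [abs_le] at h4
      have h5 : (3 : ℤ) ^ (a + j) * c i + min (v i) (w i) % 3 ^ (a + j) = min (v i) (w i) := h1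
      have h6 : (3 : ℤ) ^ (a + j) * (c i + 1) = 3 ^ (a + j) * c i + 3 ^ (a + j) := by ring
      rw [h6]
      lia
    obtain ⟨hv1, hv2⟩ := hcell c D hD v hout fun i _ => (hin i).1
    obtain ⟨hw1, hw2⟩ := hcell c D hD w (fun i hi => (hmem i hi).1 ▸ hout i hi)
      fun i _ => (hin i).2
    rw [hv2, hw2]
    refine (hF c D hD).lip _ hv1 _ hw1 fun i => ?_
    simpa using hvw i

/-- Improvement of the mesh of lattice maps by successive fillings. -/
lemma exists_shift (hℓ : IsLength ℓ) {k : ℕ → ℕ} {d : ℕ} (hd : d ≤ n)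
    (hfill : ∀ e < d, ∀ (ι : Type) [Fintype ι], Fintype.card ι = e + 1 →
      CubeFill ℓ (halfSpace χ) ι (k e) (k (e + 1))) (g : G) (k' : ℕ) :
    ∃ a B, ∀ f : (Fin n → ℤ) → G, Lip ℓ k' f →
      ∃ f', ShiftOn ℓ χ a B (χ (Additive.ofMul g)) g (skelLat n a d) f f' ∧
        SkelLip ℓ a d (k d) f' := by
  induction d with
  | zero =>
    -- For a left-invariant metric, right multiplication by `g` moves every point by exactly `ℓ g`
    -- and raises `χ` by `χ g`. It may ruin the mesh, but in dimension zero there is no mesh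
    -- condition between distinct points.
    refine ⟨0, ℓ g, fun f _ => ⟨fun v => f v * g, ⟨?_, ?_, ?_⟩, ?_⟩⟩
    · intro v _ u hu
      have : u = v := funext fun i => by
        have := hu i
        simp only [pow_zero, one_mul] at this
        have := Int.abs_lt_one_iff.1 this
        lia
      rw [this, inv_mul_cancel_left]
    · intro v _ r hr
      have := hr v fun i => by simp
      rw [character_mul]
      linarith
    · intro v _ t ht
      rw [ht v fun i => by simp]
    · intro v w _ hvw
      have : v = w := funext fun i => by
        by_contra h
        rw [Nat.le_zero, Finset.card_eq_zero, Finset.filter_eq_empty_iff] at hvw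
        exact hvw (Finset.mem_univ i) fun h' => h h'.1
      rw [this, hℓ.dist_self]
      exact Nat.zero_le _
  | succ d ih =>
    obtain ⟨a, B, h⟩ := ih (by lia) fun e he => hfill e (by lia)
    exact exists_shift_succ hℓ (by lia) (hfill d (by lia)) h

end Build

/-! ### Raising a character, an open condition -/

section Raise

variable {G : Type u} [Group G] {ℓ : G → ℕ} {χ : Character G} {n : ℕ}

lemma halfSpace_zero : halfSpace (0 : Character G) = Set.univ := by
  ext; simp [halfSpace]

/-- Lattice maps of dimension `n` and mesh `k` can be moved so as to raise the character `χ`. -/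
def Raise (ℓ : G → ℕ) (χ : Character G) (k n : ℕ) : Prop :=
  ∃ (a B : ℕ) (c : ℝ) (g : G), 0 < c ∧ ∀ f : (Fin n → ℤ) → G, Lip ℓ k f →
    ∃ f', Lip ℓ k f' ∧ ShiftOn ℓ χ a B c g Set.univ f f'

lemma exists_lip_shift (hℓ : IsLength ℓ) {k : ℕ → ℕ}
    (hfill : ∀ e < n, ∀ (ι : Type) [Fintype ι], Fintype.card ι = e + 1 →
      CubeFill ℓ (halfSpace χ) ι (k e) (k (e + 1))) (g : G) (k' : ℕ) :
    ∃ a B, ∀ f : (Fin n → ℤ) → G, Lip ℓ k' f →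
      ∃ f', Lip ℓ (k n) f' ∧ ShiftOn ℓ χ a B (χ (Additive.ofMul g)) g Set.univ f f' := by
  obtain ⟨a, B, h⟩ := exists_shift hℓ le_rfl hfill g k'
  have hcard : ∀ p : Fin n → Prop, ∀ [DecidablePred p], (Finset.univ.filter p).card ≤ n :=
    fun p _ => (Finset.card_le_univ _).trans (by simp)
  refine ⟨a, B, fun f hf => ?_⟩
  obtain ⟨f', h1, h2⟩ := h f hf
  exact ⟨f', fun v w hvw => h2 v w hvw (hcard _), fun v _ => h1.dist v (hcard _),
    fun v _ => h1.val v (hcard _), fun v _ => h1.const v (hcard _)⟩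

/-- This is where the character must be nonzero: the shift uses an element on which it is at least
one. -/
lemma raise_of_cubeFill (hℓ : IsLength ℓ) (hχ : χ ≠ 0) {k : ℕ → ℕ}
    (hfill : ∀ e < n, ∀ (ι : Type) [Fintype ι], Fintype.card ι = e + 1 →
      CubeFill ℓ (halfSpace χ) ι (k e) (k (e + 1))) : Raise ℓ χ (k n) n := by
  obtain ⟨g, hg⟩ := exists_le_character hχ 1
  obtain ⟨a, B, h⟩ := exists_lip_shift hℓ hfill g (k n)
  exact ⟨a, B, _, g, by linarith, h⟩

/-- All values are compared with `f x` at one nearby coarse point `x`. The quotients that occur lie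
in the ball of radius `max B k`, and passing from one character to the other and back costs `c / 4`
twice. -/
lemma ShiftOn.of_near {a B k : ℕ} {c : ℝ} {g : G} {f f' : (Fin n → ℤ) → G} {χ' : Character G}
    (hf : Lip ℓ k f) (h : ShiftOn ℓ χ a B c g Set.univ f f')
    (hχ : ∀ x, ℓ x ≤ max B k → |χ' (Additive.ofMul x) - χ (Additive.ofMul x)| ≤ c / 4) :
    ShiftOn ℓ χ' a B (c / 2) g Set.univ f f' := by
  refine ⟨h.dist, fun v hv r hr => ?_, h.const⟩
  have hx := near_floor a v
  set x : Fin n → ℤ := fun i => v i / 3 ^ a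
  have h1 : ∀ (η : Character G) y, η (Additive.ofMul ((f x)⁻¹ * y)) =
      η (Additive.ofMul y) - η (Additive.ofMul (f x)) := fun η y => by
    rw [character_mul, character_inv]; ring
  have h2 := h.val v hv
    (χ (Additive.ofMul (f x)) + (r - χ' (Additive.ofMul (f x)) - c / 4)) fun u hu => by
      have h3 := hχ _ ((hf x u (hx.adj hu)).trans (le_max_right _ _))
      rw [h1, h1, abs_le] at h3
      linarith [hr u hu]
  have h4 := hχ _ ((h.dist v hv x hx).trans (le_max_left _ _))
  rw [h1, h1, abs_le] at h4
  linarith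

lemma continuous_eval_character (g : G) :
    Continuous fun χ : Character G => χ (Additive.ofMul g) :=
  (continuous_apply g).comp continuous_induced_dom

lemma isOpen_setOf_raise (hℓ : IsLength ℓ) (k n : ℕ) :
    IsOpen {χ : Character G | Raise ℓ χ k n} := by
  rw [isOpen_iff_mem_nhds]
  rintro χ ⟨a, B, c, g, hc, h⟩
  have hev : ∀ᶠ χ' in 𝓝 χ, ∀ x ∈ {x | ℓ x ≤ max B k},
      |χ' (Additive.ofMul x) - χ (Additive.ofMul x)| ≤ c / 4 := by
    refine (hℓ.finite_ball _).eventually_all.2 fun x _ => ?_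
    have h1 : Filter.Tendsto
        (fun χ' : Character G => |χ' (Additive.ofMul x) - χ (Additive.ofMul x)|) (𝓝 χ) (𝓝 0) := by
      have := (((continuous_eval_character x).sub continuous_const).abs).tendsto
        (x := χ) (f := fun χ' : Character G => |χ' (Additive.ofMul x) - χ (Additive.ofMul x)|)
      simpa using this
    exact (h1.eventually (gt_mem_nhds (by positivity : 0 < c / 4))).mono fun _ => le_of_lt
  filter_upwards [hev] with χ' hχ'
  refine ⟨a, B, c / 2, g, by linarith, fun f hf => ?_⟩
  obtain ⟨f', h1, h2⟩ := h f hf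
  exact ⟨f', h1, h2.of_near hf hχ'⟩

end Raise

/-! ### Concatenation of free null-homotopies -/

section Chain

variable {G : Type u} [Group G] {ℓ : G → ℕ} {T : Set G}

/-- Prolonging a null-homotopy by one step. -/
lemma FreeNull.step {l q a : ℕ} {t₀ t₁ : G} {f h : (Fin q → ℤ) → G} (hℓ : IsLength ℓ)
    (hh : FreeNull ℓ T l t₁ h)
    (ht₀ : t₀ ∈ T) (ht : ℓ (t₀⁻¹ * t₁) ≤ l) (hf : Lip ℓ l f) (hfT : ∀ v, f v ∈ T)
    (hfar : ∃ R : ℕ, ∀ v, (∃ i, (R : ℤ) ≤ |v i|) → f v = t₀)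
    (hfh : ∀ v w, Adj v w → ℓ ((f (coarse a v))⁻¹ * h w) ≤ l) : FreeNull ℓ T l t₀ f := by
  obtain ⟨j, R₁, S, p, F, hF, hFT, hp, hpT, hp0, hF0, hFS, hFR⟩ := hh
  obtain ⟨R₂, hR₂⟩ := hfar
  rw [lip_cons_iff] at hF
  -- The subdivided `f` occupies the nonpositive times and the old homotopy starts one step later;
  -- `hfh` bounds the mesh across the seam.
  let F' : (Fin (q + 1) → ℤ) → G := fun z =>
    if z 0 ≤ 0 then f (coarse (a + j) (Fin.tail z)) else F (Fin.cons (z 0 - 1) (Fin.tail z))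
  have hF'0 : ∀ s v, s ≤ 0 → F' (Fin.cons s v) = f (coarse (a + j) v) := fun s v hs => by
    simp [F', hs]
  have hF'1 : ∀ s v, 0 < s → F' (Fin.cons s v) = F (Fin.cons (s - 1) v) := fun s v hs => by
    simp [F', not_le.2 hs]
  let p' : ℤ → G := fun s => if s ≤ 0 then t₀ else p (s - 1)
  have hstep : ∀ v w, Adj v w → ℓ ((f (coarse (a + j) v))⁻¹ * h (coarse j w)) ≤ l := by
    intro v w hvw
    rw [← coarse_coarse]
    exact hfh _ _ (hvw.coarse j)
  refine ⟨a + j, max R₁ (3 ^ (a + j) * R₂), S + 1, p', F', ?_, ?_, ?_, ?_, ?_, ?_, ?_, ?_⟩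
  · rw [lip_cons_iff]
    intro s s' v w hs hvw
    rw [abs_le] at hs
    rcases le_or_gt s 0 with h1 | h1 <;> rcases le_or_gt s' 0 with h2 | h2
    · rw [hF'0 _ _ h1, hF'0 _ _ h2]
      exact hf _ _ (hvw.coarse _)
    · rw [hF'0 _ _ h1, hF'1 _ _ h2, hF0 _ (by lia)]
      exact hstep v w hvw
    · rw [hF'1 _ _ h1, hF'0 _ _ h2, hF0 _ (by lia), hℓ.dist_comm]
      exact hstep w v hvw.symm
    · rw [hF'1 _ _ h1, hF'1 _ _ h2]
      exact hF _ _ _ _ (by rw [abs_le]; lia) hvw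
  · intro z
    simp only [F']
    split_ifs
    · exact hfT _
    · exact hFT _
  · intro s s' hs
    rw [abs_le] at hs
    simp only [p']
    split_ifs with h1 h2 h2
    · rw [hℓ.dist_self]; lia
    · rw [hp0 _ (by lia)]; exact ht
    · rw [hp0 _ (by lia), hℓ.dist_comm]; exact ht
    · exact hp _ _ (by rw [abs_le]; lia)
  · intro s
    simp only [p']
    split_ifs
    · exact ht₀
    · exact hpT _
  · intro s hs
    simp only [p', if_pos hs]
  · exact fun s hs v => hF'0 s v hs
  · intro s hs v
    push_cast at hs
    rw [hF'1 _ _ (by lia), hFS _ (by lia)]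
    simp only [p']
    rw [if_neg (by push_cast; lia)]
    push_cast
    rw [add_sub_cancel_right]
  · rintro s v ⟨i, hi⟩
    push_cast at hi
    rcases le_or_gt s 0 with h1 | h1
    · rw [hF'0 _ _ h1]
      simp only [p', if_pos h1]
      refine hR₂ _ ⟨i, ?_⟩
      have h2 := (le_max_right _ _).trans hi
      rcases le_abs.1 h2 with h | h
      · have := third_iterate_mono (a + j) h
        rw [third_iterate_mul] at this
        exact this.trans (le_abs_self _)
      · have := third_iterate_mono (a + j) (show v i ≤ 3 ^ (a + j) * (-R₂ : ℤ) by lia)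
        rw [third_iterate_mul] at this
        exact (show (R₂ : ℤ) ≤ -third^[a + j] (v i) by lia).trans (neg_le_abs _)
    · rw [hF'1 _ _ h1]
      simp only [p', if_neg (not_le.2 h1)]
      exact hFR _ _ ⟨i, (le_max_left _ _).trans hi⟩

end Chain

/-! ### Raising a null-homotopy into the half space -/

section Criterion

variable {G : Type u} [Group G] {ℓ : G → ℕ} {χ : Character G}

lemma near_coarse {q : ℕ} (a : ℕ) (v : Fin q → ℤ) : Near a v (coarse a v) := by
  intro i
  have := third_iterate_near a (v i)
  rw [coarse]
  have h : 0 ≤ |v i - 3 ^ a * third^[a] (v i)| := abs_nonneg _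
  lia

lemma Near.le_abs {q a : ℕ} {v u : Fin q → ℤ} (h : Near a v u) {i : Fin q} {R : ℕ}
    (hi : ((3 ^ a * (R + 1) : ℕ) : ℤ) ≤ |v i|) : (R : ℤ) ≤ |u i| := by
  have h1 := h i
  have hp : (0 : ℤ) < 3 ^ a := by positivity
  have h2 := abs_sub_abs_le_abs_sub (v i) (3 ^ a * u i)
  rw [abs_mul, abs_of_pos hp] at h2
  push_cast at hi
  have h3 : (3 : ℤ) ^ a * R < 3 ^ a * |u i| := by linarith
  exact (lt_of_mul_lt_mul_left h3 hp.le).le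

lemma Near.nonpos {a : ℕ} {x y : ℤ} (h : |x - 3 ^ a * y| < 3 ^ a) (hx : x ≤ 0) : y ≤ 0 := by
  have hp : (0 : ℤ) < 3 ^ a := by positivity
  rw [abs_lt] at h
  have h3 : (3 : ℤ) ^ a * y < 3 ^ a * 1 := by linarith
  have := lt_of_mul_lt_mul_left h3 hp.le
  lia

lemma Near.large {a : ℕ} {x y : ℤ} {R : ℕ} (h : |x - 3 ^ a * y| < 3 ^ a)
    (hx : ((3 ^ a * (R + 1) : ℕ) : ℤ) ≤ x) : (R : ℤ) ≤ y := by
  have hp : (0 : ℤ) < 3 ^ a := by positivity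
  rw [abs_lt] at h
  push_cast at hx
  have h3 : (3 : ℤ) ^ a * R < 3 ^ a * y := by linarith
  exact (lt_of_mul_lt_mul_left h3 hp.le).le

/-- The criterion: if `χ` can be raised then the half space of `χ` inherits the essential
triviality of homotopy groups from the group. -/
lemma Raise.exists_piVanishes (hℓ : IsLength ℓ) {q k : ℕ} (hraise : Raise ℓ χ k (q + 1))
    {K : ℕ → ℕ} (hK : K (q + 1) ≤ k)
    (hfill : ∀ e < q + 1, ∀ (ι : Type) [Fintype ι], Fintype.card ι = e + 1 →
      CubeFill ℓ (halfSpace (0 : Character G)) ι (K e) (K (e + 1))) (k' : ℕ) :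
    ∃ l, ∃ h : k' ≤ l, PiVanishes ℓ (halfSpace χ) q h := by
  obtain ⟨a, B, c, g, hc, hraise⟩ := hraise
  obtain ⟨a₀, B₀, hbuild⟩ := exists_lip_shift (n := q) (k := K) hℓ
    (fun e he => hfill e (by lia)) 1 k'
  obtain ⟨C, hC⟩ := ((hℓ.finite_ball B₀).image fun x => -χ (Additive.ofMul x)).bddAbove
  have hC : ∀ x, ℓ x ≤ B₀ → -C ≤ χ (Additive.ofMul x) := fun x hx => by
    have := hC ⟨x, hx, rfl⟩
    simp only at this
    linarith
  -- After `N` raises, everything that started within `B₀` of the half space lies in it. The number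
  -- `N` is fixed before any sphere is given.
  obtain ⟨N, hN⟩ := Archimedean.arch C hc
  rw [nsmul_eq_mul] at hN
  -- The constant map at the identity is moved to the constant `g`, so `g` inherits the bounds of
  -- the shift.
  obtain ⟨hgB, hgc⟩ : ℓ g ≤ B ∧ c ≤ χ (Additive.ofMul g) := by
    obtain ⟨f', -, h⟩ := hraise (fun _ => 1) fun v w _ => by rw [hℓ.dist_self]; lia
    have h0 := h.const 0 trivial 1 fun _ _ => rfl
    rw [one_mul] at h0
    constructor
    · have := h.dist 0 trivial _ (near_floor a 0)
      rwa [h0, inv_one, one_mul] at this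
    · have := h.val 0 trivial 0 fun _ _ => by rw [character_one]
      rwa [h0, zero_add] at this
  -- The jump from `f` to the `N`-th raised slice costs `k' + B₀ + N * B`; each later step from
  -- slice to slice costs `k + B`.
  let l := k' + B₀ + N * B + k + B
  refine ⟨l, by simp only [l]; lia, piVanishes_of_null _ fun t₀ ht₀ f hf hfT hfar => ?_⟩
  refine FreeNull.null ?_
  obtain ⟨R, hR⟩ := hfar
  -- improvement of the mesh in the group, and a null-homotopy in the group
  obtain ⟨f₂, hf₂, hf₂s⟩ := hbuild f hf
  have hf₂far : ∀ v, (∃ i, ((3 ^ a₀ * (R + 1) : ℕ) : ℤ) ≤ |v i|) → f₂ v = t₀ := by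
    rintro v ⟨i, hi⟩
    rw [hf₂s.const v trivial t₀ fun u hu => hR u ⟨i, hu.le_abs hi⟩, mul_one]
  obtain ⟨j₁, R₁, S₁, F₀, hF₀, -, hF₀0, hF₀S, hF₀R⟩ := (hfill q (by lia) (Fin (q + 1))
    (by simp)).null hℓ (t₀ := t₀) (by simp [halfSpace]) hf₂ (fun _ => by simp [halfSpace])
    ⟨_, hf₂far⟩
  -- raising the null-homotopy
  have hseq : ∃ Φ : ℕ → (Fin (q + 1) → ℤ) → G, Φ 0 = F₀ ∧
      ∀ j, Lip ℓ k (Φ j) ∧ ShiftOn ℓ χ a B c g Set.univ (Φ j) (Φ (j + 1)) := by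
    choose r hr1 hr2 using hraise
    let Ψ : ℕ → {f : (Fin (q + 1) → ℤ) → G // Lip ℓ k f} := fun j =>
      (fun f => ⟨r f.1 f.2, hr1 f.1 f.2⟩)^[j] ⟨F₀, fun v w hvw => (hF₀ v w hvw).trans hK⟩
    refine ⟨fun j => (Ψ j).1, rfl, fun j => ⟨(Ψ j).2, ?_⟩⟩
    simp only [Ψ, Function.iterate_succ_apply']
    exact hr2 _ _
  obtain ⟨Φ, hΦ0, hΦ⟩ := hseq
  let t : ℕ → G := fun j => t₀ * g ^ j
  have ht_succ : ∀ j, t (j + 1) = t j * g := fun j => by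
    simp only [t, pow_succ, mul_assoc]
  have htT : ∀ j, t j ∈ halfSpace χ := by
    intro j
    rw [Set.mem_ofPred_eq] at ht₀ ⊢
    rw [character_mul, ofMul_pow, map_nsmul, nsmul_eq_mul]
    have : 0 ≤ (j : ℝ) * χ (Additive.ofMul g) := mul_nonneg (Nat.cast_nonneg _) (hc.le.trans hgc)
    linarith
  have hside : ∀ j, ∃ R : ℕ, ∀ s v, (∃ i, (R : ℤ) ≤ |v i|) → Φ j (Fin.cons s v) = t j := by
    intro j
    induction j with
    | zero =>
      refine ⟨R₁, fun s v hv => ?_⟩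
      rw [hΦ0, hF₀R s v hv]
      simp [t]
    | succ j ih =>
      obtain ⟨R, hR⟩ := ih
      refine ⟨3 ^ a * (R + 1), fun s v ⟨i, hi⟩ => ?_⟩
      rw [ht_succ]
      refine (hΦ j).2.const _ trivial _ fun u hu => ?_
      rw [← Fin.cons_self_tail u]
      exact hR _ _ ⟨i, hu.le_abs (i := i.succ) (by simpa using hi)⟩
  have htop : ∀ j, ∃ S : ℕ, ∀ s ≥ (S : ℤ), ∀ v, Φ j (Fin.cons s v) = t j := by
    intro j
    induction j with
    | zero =>
      refine ⟨S₁, fun s hs v => ?_⟩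
      rw [hΦ0, hF₀S s hs]
      simp [t]
    | succ j ih =>
      obtain ⟨S, hS⟩ := ih
      refine ⟨3 ^ a * (S + 1), fun s hs v => ?_⟩
      rw [ht_succ]
      refine (hΦ j).2.const _ trivial _ fun u hu => ?_
      rw [← Fin.cons_self_tail u]
      exact hS _ (Near.large (hu 0) hs) _
  -- The predicate `P` singles out heights stable under passage to nearby coarse points: the
  -- nonpositive ones for the bottom slices, all of them for the whole null-homotopy.
  have hval : ∀ r (P : ℤ → Prop), (∀ s s', P s → |s - 3 ^ a * s'| < 3 ^ a → P s') →
      (∀ s v, P s → r ≤ χ (Additive.ofMul (F₀ (Fin.cons s v)))) →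
      ∀ (j : ℕ) s v, P s → r + j * c ≤ χ (Additive.ofMul (Φ j (Fin.cons s v))) := by
    intro r P hP h0 j
    induction j with
    | zero => intro s v hs; rw [hΦ0]; simpa using h0 s v hs
    | succ j ih =>
      intro s v hs
      have := (hΦ j).2.val (Fin.cons s v) trivial (r + j * c) fun u hu => by
        rw [← Fin.cons_self_tail u]
        exact ih _ _ (hP s _ hs (hu 0))
      push_cast
      linarith
  -- the slices at the bottom
  let φ : ℕ → (Fin q → ℤ) → G := fun j v => Φ j (Fin.cons 0 v)
  have hφ0 : ∀ v, φ 0 v = f₂ (coarse j₁ v) := fun v => by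
    simp only [φ, hΦ0]
    exact hF₀0 0 le_rfl v
  have hφlip : ∀ j, Lip ℓ k (φ j) := fun j v w hvw =>
    (hΦ j).1 _ _ (adj_cons.2 ⟨by simp, hvw⟩)
  have hφT : ∀ j ≥ N, ∀ v, φ j v ∈ halfSpace χ := by
    intro j hj v
    have := hval (-C) (fun s => s ≤ 0) (fun s s' hs h => Near.nonpos h hs) (fun s v hs => by
      rw [hF₀0 s hs]
      have h1 := hC _ (hf₂s.dist (coarse j₁ v) trivial _ (near_floor _ _))
      rw [character_mul, character_inv] at h1
      have h2 := hfT fun i => coarse j₁ v i / 3 ^ a₀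
      rw [Set.mem_ofPred_eq] at h2
      linarith) j 0 v le_rfl
    have h3 : (N : ℝ) * c ≤ j * c := mul_le_mul_of_nonneg_right (by exact_mod_cast hj) hc.le
    rw [Set.mem_ofPred_eq]
    simp only [φ]
    linarith
  have hφstep : ∀ j v, ℓ ((φ j (coarse a v))⁻¹ * φ (j + 1) v) ≤ B := by
    intro j v
    refine (hΦ j).2.dist _ trivial _ fun i => ?_
    induction i using Fin.cases with
    | zero => simp
    | succ i => exact near_coarse a v i
  have hφfar : ∀ j, ∃ R : ℕ, ∀ v, (∃ i, (R : ℤ) ≤ |v i|) → φ j v = t j := fun j => by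
    obtain ⟨R, hR⟩ := hside j
    exact ⟨R, fun v hv => hR 0 v hv⟩
  have hφchain : ∀ j v, ℓ ((φ 0 (coarse (a * j) v))⁻¹ * φ j v) ≤ j * B := by
    intro j
    induction j with
    | zero => intro v; simp [hℓ.one]
    | succ j ih =>
      intro v
      refine (hℓ.dist_triangle _ (φ j (coarse a v)) _).trans ?_
      have h1 := ih (coarse a v)
      rw [coarse_coarse, ← Nat.mul_succ] at h1
      have h2 := hφstep j v
      rw [Nat.succ_mul]
      exact add_le_add h1 h2
  -- a lower bound for the null-homotopy
  obtain ⟨C', hC'⟩ : ∃ C', ∀ w, -C' ≤ χ (Additive.ofMul (F₀ w)) := by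
    -- Outside a finite box `F₀` is `t₀` or repeats its bottom slice, so it has finitely many
    -- values.
    let D := R₁ + S₁
    obtain ⟨C', hC'⟩ := (((latBox_finite (Fin (q + 1)) (2 * D)).image
      fun w => -χ (Additive.ofMul (F₀ fun i => w i - D)))).bddAbove
    refine ⟨max C' (-χ (Additive.ofMul t₀)), fun w => ?_⟩
    rw [← Fin.cons_self_tail w]
    by_cases hv : ∃ i, (R₁ : ℤ) ≤ |Fin.tail w i|
    · rw [hF₀R _ _ hv]
      linarith [le_max_right C' (-χ (Additive.ofMul t₀))]
    · push Not at hv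
      have hbox : ∀ s : ℤ, 0 ≤ s → s ≤ S₁ →
          -C' ≤ χ (Additive.ofMul (F₀ (Fin.cons s (Fin.tail w)))) := by
        intro s hs hs'
        have := hC' ⟨fun i => (Fin.cons s (Fin.tail w) : Fin (q + 1) → ℤ) i + D, fun i => by
          induction i using Fin.cases with
          | zero => simp only [Fin.cons_zero, D]; push_cast; lia
          | succ i =>
            have := hv i
            rw [abs_lt] at this
            simp only [Fin.cons_succ, D]; push_cast; lia, rfl⟩
        simp only [add_sub_cancel_right] at this
        linarith
      have hle := le_max_left C' (-χ (Additive.ofMul t₀))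
      rcases le_or_gt (w 0) 0 with h0 | h0
      · rw [hF₀0 _ h0, ← hF₀0 0 le_rfl]
        linarith [hbox 0 le_rfl (by lia)]
      · rcases le_or_gt (w 0) S₁ with h1 | h1
        · linarith [hbox _ h0.le h1]
        · rw [hF₀S _ h1.le]
          linarith [le_max_right C' (-χ (Additive.ofMul t₀))]
  obtain ⟨J₀, hJ₀⟩ := Archimedean.arch C' hc
  rw [nsmul_eq_mul] at hJ₀
  -- Unlike `N`, the number `J₀` depends on the sphere, but it only affects the number of steps in
  -- the descent and not their mesh.
  let J := N + J₀
  have hJ : ∀ s v, Φ J (Fin.cons s v) ∈ halfSpace χ := by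
    intro s v
    have := hval (-C') (fun _ => True) (fun _ _ _ _ => trivial) (fun _ _ _ => hC' _) J s v trivial
    have h3 : (J₀ : ℝ) * c ≤ J * c :=
      mul_le_mul_of_nonneg_right (by simp only [J]; exact_mod_cast Nat.le_add_left _ _) hc.le
    rw [Set.mem_ofPred_eq]
    linarith
  -- the last null-homotopy
  have hlast : FreeNull ℓ (halfSpace χ) l (t J) (φ J) := by
    obtain ⟨R', hR'⟩ := hside J
    obtain ⟨S', hS'⟩ := htop J
    refine ⟨0, R', S', fun _ => t J, fun z => Φ J (Fin.cons (max (z 0) 0) (Fin.tail z)),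
      ?_, fun _ => hJ _ _, fun _ _ _ => by rw [hℓ.dist_self]; lia, fun _ => htT J, fun _ _ => rfl,
      ?_, ?_, ?_⟩
    · rw [lip_cons_iff]
      intro s s' v w hs hvw
      simp only [Fin.cons_zero, Fin.tail_cons]
      refine ((hΦ J).1 _ _ (adj_cons.2 ⟨?_, hvw⟩)).trans (by simp only [l]; lia)
      rw [abs_le] at *
      lia
    · intro s hs v
      simp only [Fin.cons_zero, Fin.tail_cons, max_eq_right hs, coarse_zero, φ]
    · intro s hs v
      simp only [Fin.cons_zero, Fin.tail_cons]
      exact hS' _ (by lia) _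
    · intro s v hv
      simp only [Fin.cons_zero, Fin.tail_cons]
      exact hR' _ _ hv
  -- descending along the slices
  have hdesc : ∀ i ≤ J₀, FreeNull ℓ (halfSpace χ) l (t (J - i)) (φ (J - i)) := by
    intro i
    induction i with
    | zero => exact fun _ => hlast
    | succ i ih =>
      intro hi
      obtain ⟨j, hj1, hj2⟩ : ∃ j, J - i = j + 1 ∧ J - (i + 1) = j := ⟨J - (i + 1), by lia, rfl⟩
      have h := ih (by lia)
      rw [hj1] at h
      rw [hj2]
      refine h.step hℓ (a := a) (htT j) ?_ (fun v w hvw => (hφlip j v w hvw).trans ?_)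
        (hφT j (by lia)) (hφfar j) fun v w hvw => ?_
      · rw [ht_succ, inv_mul_cancel_left]
        exact hgB.trans (by simp only [l]; lia)
      · simp only [l]; lia
      · refine (hℓ.dist_triangle _ (φ j (coarse a w)) _).trans ?_
        have h1 := hφlip j _ _ (hvw.coarse a)
        have h2 := hφstep j w
        simp only [l]; lia
  have hN' := hdesc J₀ le_rfl
  rw [show J - J₀ = N by lia] at hN'
  refine hN'.step hℓ (a := a₀ + (j₁ + a * N)) ht₀ ?_ (fun v w hvw => (hf v w hvw).trans ?_) hfT
    ⟨R, hR⟩ fun v w hvw => ?_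
  · have : ∀ i : ℕ, ℓ (g ^ i) ≤ i * B := by
      intro i
      induction i with
      | zero => simp [hℓ.one]
      | succ i ih =>
        rw [pow_succ, Nat.succ_mul]
        exact (hℓ.mul_le _ _).trans (add_le_add ih hgB)
    simp only [t, inv_mul_cancel_left]
    refine (this N).trans ?_
    simp only [l]; lia
  · simp only [l]; lia
  · have h1 := hf _ _ (hvw.coarse (a₀ + (j₁ + a * N)))
    have h2 := hf₂s.dist _ trivial _ (near_coarse a₀ (coarse (j₁ + a * N) w))
    have h3 := hφchain N w
    rw [hφ0] at h3
    rw [coarse_coarse] at h2 h3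
    have h4 := hℓ.dist_triangle (f (coarse (a₀ + (j₁ + a * N)) v))
      (f (coarse (a₀ + (j₁ + a * N)) w)) (φ N w)
    have h5 := hℓ.dist_triangle (f (coarse (a₀ + (j₁ + a * N)) w))
      (f₂ (coarse (j₁ + a * N) w)) (φ N w)
    simp only [l]; lia

end Criterion

/-! ### Consequences for the invariant -/

section Sigma

variable {G : Type u} [Group G] {ℓ : G → ℕ} {χ : Character G} {m : ℕ}

lemma mem_sigmaInvariant_of_raise (hℓ : IsLength ℓ) {K : ℕ → ℕ}
    (hfill : ∀ e < m, ∀ (ι : Type) [Fintype ι], Fintype.card ι = e + 1 →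
      CubeFill ℓ (halfSpace (0 : Character G)) ι (K e) (K (e + 1)))
    (hraise : ∀ q < m, ∃ k, K (q + 1) ≤ k ∧ Raise ℓ χ k (q + 1)) : χ ∈ sigmaInvariant ℓ m := by
  intro q hq k'
  obtain ⟨k, hk, h⟩ := hraise q hq
  exact h.exists_piVanishes hℓ hk (fun e he => hfill e (by lia)) k'

/-- The meshes are chosen recursively from an arbitrary start: each is one in which the spheres of
the previous mesh become trivial. -/
lemma exists_connecting (h : χ ∈ sigmaInvariant ℓ m) : ∃ K : ℕ → ℕ, ∀ e < m, ∀ (ι : Type)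
    [Fintype ι], Fintype.card ι = e + 1 → CubeFill ℓ (halfSpace χ) ι (K e) (K (e + 1)) := by
  choose! l hl using h
  refine ⟨fun e => Nat.rec 0 l e, fun e he ι _ hι => ?_⟩
  obtain ⟨h1, h2⟩ := hl e he (Nat.rec 0 l e)
  exact h2.cubeFill hι

lemma isClosed_zero_character : IsClosed ({0} : Set (Character G)) := by
  have : ({0} : Set (Character G)) = ⋂ g : G, {χ | χ (Additive.ofMul g) = 0} := by
    ext χ
    simp only [Set.mem_singleton_iff, Set.mem_iInter, Set.mem_ofPred_eq]
    exact ⟨fun h g => by rw [h]; rfl, fun h => AddMonoidHom.ext fun g => h g.toMul⟩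
  rw [this]
  exact isClosed_iInter fun g => isClosed_eq (continuous_eval_character g) continuous_const

/-- Fillings in the half space of one nonzero character make it raisable in dimensions one to `m`,
and nearby characters inherit this. The same fillings, translated, fill spheres in the group, so the
criterion applies to all these neighbours. -/
lemma isOpen_sigmaInvariant_diff (hℓ : IsLength ℓ) :
    IsOpen (sigmaInvariant ℓ m \ {(0 : Character G)}) := by
  rw [isOpen_iff_forall_mem_open]
  rintro χ ⟨hχ, hχ0⟩
  obtain ⟨K, hK⟩ := exists_connecting hχ
  refine ⟨(⋂ q ∈ Set.Iio m, {χ | Raise ℓ χ (K (q + 1)) (q + 1)}) ∩ {0}ᶜ, ?_, ?_, ?_⟩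
  · rintro χ' ⟨h1, h2⟩
    refine ⟨mem_sigmaInvariant_of_raise hℓ (fun e he ι _ hι => ?_)
      fun q hq => ⟨_, le_rfl, Set.mem_iInter₂.1 h1 q hq⟩, h2⟩
    rw [halfSpace_zero]
    exact (hK e he ι hι).univ
  · exact ((Set.finite_Iio m).isOpen_biInter fun q _ => isOpen_setOf_raise hℓ _ _).inter
      isClosed_zero_character.isOpen_compl
  · exact ⟨Set.mem_iInter₂.2 fun q hq => raise_of_cubeFill hℓ hχ0
      fun e he => hK e (he.trans_le hq), hχ0⟩

lemma smul_mem_sigmaInvariant_iff {c : ℝ} (hc : 0 < c) :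
    c • χ ∈ sigmaInvariant ℓ m ↔ χ ∈ sigmaInvariant ℓ m := by
  have : {g : G | 0 ≤ (c • χ) (Additive.ofMul g)} = {g | 0 ≤ χ (Additive.ofMul g)} := by
    ext g
    exact mul_nonneg_iff_of_pos_left hc
  simp only [sigmaInvariant, Set.mem_ofPred_eq, this]

lemma IsConnectingVector.mem_sigmaInvariant (hℓ : IsLength ℓ) {k : Fin (m + 1) → ℕ}
    (hk : IsConnectingVector ℓ k) (hraise : ∀ n ≤ m, Raise ℓ χ (Finset.univ.sup k) n) :
    χ ∈ sigmaInvariant ℓ m := by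
  let K : ℕ → ℕ := fun e => if h : e < m + 1 then k ⟨e, h⟩ else 0
  refine mem_sigmaInvariant_of_raise (K := K) hℓ (fun e he ι _ hι => ?_)
    fun q hq => ⟨_, ?_, hraise (q + 1) hq⟩
  · obtain ⟨h1, h2⟩ := hk ⟨e, he⟩
    rw [halfSpace_zero]
    have := h2.cubeFill hι
    simp only [K, dif_pos (show e < m + 1 by lia), dif_pos (show e + 1 < m + 1 by lia)]
    exact this
  · simp only [K, dif_pos (show q + 1 < m + 1 by lia)]
    exact Finset.le_sup (Finset.mem_univ _)

end Sigma

/-! ### Finiteness and points under simplicial subdivision -/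

section Subdivision

open scoped Simplicial

/-- The subdivided simplex of `sd X` given by a simplex of `X`. -/
def sdCell {X : SSet.{u}} {s : ℕ} (x : X _⦋s⦌) : SimplexCategory.sd.{u}.obj ⦋s⦌ ⟶ SSet.sd.obj X :=
  SSet.stdSimplex.sdIso.inv.app ⦋s⦌ ≫ SSet.sd.map (SSet.yonedaEquiv.symm x)

lemma sdCell_map {X : SSet.{u}} {s t : ℕ} (x : X _⦋s⦌) (θ : ⦋t⦌ ⟶ ⦋s⦌) :
    sdCell (X.map θ.op x) = SimplexCategory.sd.map θ ≫ sdCell x := by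
  have h : SimplexCategory.sd.map θ ≫ SSet.stdSimplex.sdIso.{u}.inv.app ⦋s⦌ =
    SSet.stdSimplex.sdIso.{u}.inv.app ⦋t⦌ ≫ SSet.sd.map (SSet.stdSimplex.map θ) :=
      SSet.stdSimplex.sdIso.{u}.inv.naturality θ
  rw [sdCell, ← SSet.yonedaEquiv_symm_naturality_left, Functor.map_comp, sdCell, reassoc_of% h]

/-- By the adjunction with `Ex`, equality can be tested after transposition, and there simplex by
simplex. -/
lemma sd_hom_ext {X Z : SSet.{u}} {f g : SSet.sd.obj X ⟶ Z}
    (h : ∀ (s : ℕ) (x : X _⦋s⦌), SSet.sd.map (SSet.yonedaEquiv.symm x) ≫ f =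
      SSet.sd.map (SSet.yonedaEquiv.symm x) ≫ g) : f = g := by
  apply (SSet.sdExAdjunction.homEquiv X Z).injective
  ext n x
  induction n using Opposite.rec with | _ n
  induction n using SimplexCategory.rec with | _ n
  have h1 := congrArg (SSet.sdExAdjunction.homEquiv _ Z) (h n x)
  rw [Adjunction.homEquiv_naturality_left, Adjunction.homEquiv_naturality_left] at h1
  have h2 := congrArg SSet.yonedaEquiv h1
  rw [SSet.yonedaEquiv_symm_comp, SSet.yonedaEquiv_symm_comp, Equiv.apply_symm_apply,
    Equiv.apply_symm_apply] at h2
  exact h2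

/-- By `sd_hom_ext` the inclusion of the union of the subdivided nondegenerate simplices is an
epimorphism. This reduces finiteness of a subdivision to that of subdivided simplices, which are
nerves of finite posets. -/
lemma iSup_range_sd (X : SSet.{u}) : ⨆ x : X.N, SSet.Subcomplex.range
    (SSet.sd.map (SSet.yonedaEquiv.symm x.simplex)) = (⊤ : (SSet.sd.obj X).Subcomplex) := by
  set A := ⨆ x : X.N, SSet.Subcomplex.range (SSet.sd.map (SSet.yonedaEquiv.symm x.simplex))
  have hA : Epi A.ι := by
    constructor
    intro Z f g hfg
    refine sd_hom_ext fun s x => ?_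
    obtain ⟨m, θ, hθ, y, rfl⟩ := X.exists_nonDegenerate x
    rw [← SSet.yonedaEquiv_symm_naturality_left, Functor.map_comp, Category.assoc, Category.assoc]
    congr 1
    have hle : SSet.Subcomplex.range (SSet.sd.map (SSet.yonedaEquiv.symm y.1)) ≤ A :=
      le_iSup (fun x : X.N => SSet.Subcomplex.range
        (SSet.sd.map (SSet.yonedaEquiv.symm x.simplex))) (SSet.N.mk y.1 y.2)
    have : SSet.sd.map (SSet.yonedaEquiv.symm y.1) =
      SSet.Subcomplex.lift (SSet.sd.map (SSet.yonedaEquiv.symm y.1)) hle ≫ A.ι := by simp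
    rw [this, Category.assoc, Category.assoc, hfg]
  rw [← A.range_ι]
  exact SSet.Subcomplex.range_eq_top A.ι

lemma finite_nerve (P : Type u) [PartialOrder P] [Finite P] : (nerve P).Finite := by
  have hcard : ∀ d, Nat.card P ≤ d → (nerve P).nonDegenerate d = ∅ := by
    intro d hd
    rw [Set.eq_empty_iff_forall_notMem]
    intro s hs
    rw [PartialOrder.mem_nerve_nonDegenerate_iff_injective] at hs
    have := Nat.card_le_card_of_injective _ hs
    simp at this
    lia
  have : (nerve P).HasDimensionLT (Nat.card P) := ⟨fun d hd => by
    have := hcard d hd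
    rw [SSet.nonDegenerate, Set.compl_empty_iff] at this
    exact this⟩
  refine SSet.finite_of_hasDimensionLT _ (Nat.card P) fun i _ => ?_
  have : Finite ((nerve P) _⦋i⦌) :=
    Finite.of_injective (fun x (j : Fin (i + 1)) => x.obj j) fun x y h =>
      nerve.ext_of_isThin h
  infer_instance

instance finite_sd (X : SSet.{u}) [X.Finite] : (SSet.sd.obj X).Finite := by
  rw [← SSet.finite_subcomplex_top_iff, ← iSup_range_sd, SSet.finite_iSup_iff]
  intro x
  have : Finite (PartialOrder.NonemptyFiniteChains (ULift.{u} (Fin (x.dim + 1)))) :=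
    Finite.of_injective (fun C => C.finset) fun _ _ h => PartialOrder.NonemptyFiniteChains.ext h
  have : (SimplexCategory.sd.{u}.obj ⦋x.dim⦌).Finite :=
    finite_nerve (PartialOrder.NonemptyFiniteChains (ULift.{u} (Fin (x.dim + 1))))
  have : (SSet.sd.obj Δ[x.dim]).Finite := SSet.finite_of_iso (SSet.stdSimplex.sdIso.symm.app ⦋x.dim⦌)
  infer_instance

lemma finite_sdIter (N : ℕ) (X : SSet.{u}) [X.Finite] : ((sdIter N).obj X).Finite := by
  induction N with
  | zero => assumption
  | succ N ih => exact finite_sd ((sdIter N).obj X)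

lemma nonempty_sd (X : SSet.{u}) [X.Nonempty] : (SSet.sd.obj X).Nonempty := by
  have : Nonempty (PartialOrder.NonemptyFiniteChains (ULift.{u} (Fin 1))) :=
    ⟨{ finset := Finset.univ, comparable := fun a b => le_total a b }⟩
  have : (SimplexCategory.sd.{u}.obj ⦋0⦌).Nonempty :=
    inferInstanceAs (nerve (PartialOrder.NonemptyFiniteChains (ULift.{u} (Fin 1)))).Nonempty
  exact SSet.nonempty_of_hom (sdCell (Classical.arbitrary (X _⦋0⦌)))

lemma nonempty_sdIter (N : ℕ) (X : SSet.{u}) [X.Nonempty] : ((sdIter N).obj X).Nonempty := by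
  induction N with
  | zero => assumption
  | succ N ih => exact nonempty_sd ((sdIter N).obj X)

/-- Such an `X` is a quotient of a point, subdivision preserves this epimorphism, and the
subdivision of a point is a point. Hence the image of a 0-simplex under `φ` has a single vertex. -/
lemma subsingleton_sd (X : SSet.{u}) [X.Nonempty] (h : ∀ n, Subsingleton (X.obj n))
    (n : SimplexCategoryᵒᵖ) : Subsingleton ((SSet.sd.obj X).obj n) := by
  have hP : Subsingleton (PartialOrder.NonemptyFiniteChains (ULift.{u} (Fin 1))) := by
    refine ⟨fun A B => PartialOrder.NonemptyFiniteChains.ext ?_⟩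
    obtain ⟨a, ha⟩ := A.nonempty
    obtain ⟨b, hb⟩ := B.nonempty
    ext i
    exact iff_of_true (Subsingleton.elim a i ▸ ha) (Subsingleton.elim b i ▸ hb)
  have h1 : Subsingleton ((SimplexCategory.sd.{u}.obj ⦋0⦌).obj n) :=
    ⟨fun x y => nerve.ext_of_isThin (C := PartialOrder.NonemptyFiniteChains (ULift.{u} (Fin 1)))
      (funext fun i => hP.elim _ _)⟩
  have h2 : Epi (SSet.yonedaEquiv.symm (Classical.arbitrary (X _⦋0⦌))) := by
    rw [NatTrans.epi_iff_epi_app]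
    intro d
    rw [epi_iff_surjective]
    exact fun x => ⟨Classical.arbitrary _, (h d).elim _ _⟩
  have h3 : Epi (sdCell (Classical.arbitrary (X _⦋0⦌))) := by
    unfold sdCell
    infer_instance
  rw [NatTrans.epi_iff_epi_app] at h3
  exact ((epi_iff_surjective _).1 (h3 n)).subsingleton

lemma subsingleton_sdIter (N : ℕ) (X : SSet.{u}) [X.Nonempty] (h : ∀ n, Subsingleton (X.obj n))
    (n : SimplexCategoryᵒᵖ) : Subsingleton (((sdIter N).obj X).obj n) := by
  induction N generalizing n with
  | zero => exact h n
  | succ N ih =>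
    have := nonempty_sdIter N X
    exact subsingleton_sd ((sdIter N).obj X) ih n

end Subdivision

/-! ### Image vertices, valuations and the witness set -/

section ImageVertices

open scoped Simplicial

variable {G : Type u} [Group G] {ℓ : G → ℕ} {m k q : ℕ} {φ : SkelMap ℓ m k} {χ : Character G}

lemma imageVertices_finite (φ : SkelMap ℓ m k) (hq : q ≤ m) (σ : (VR ℓ k) _⦋q⦌) :
    (imageVertices φ hq σ).Finite := by
  have : (Δ[q] : SSet.{u}).Finite := inferInstance
  have := finite_sdIter φ.depth Δ[q]
  exact Set.finite_range _

lemma imageVertices_nonempty (φ : SkelMap ℓ m k) (hq : q ≤ m) (σ : (VR ℓ k) _⦋q⦌) :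
    (imageVertices φ hq σ).Nonempty := by
  have := nonempty_sdIter φ.depth Δ[q]
  exact Set.range_nonempty _

lemma imageVertices_map_subset {t : ℕ} (hq : q ≤ m) (ht : t ≤ m) (σ : (VR ℓ k) _⦋q⦌)
    (θ : ⦋t⦌ ⟶ ⦋q⦌) :
    imageVertices φ ht ((VR ℓ k).map θ.op σ) ⊆ imageVertices φ hq σ := by
  rintro _ ⟨x, rfl⟩
  refine ⟨((sdIter φ.depth).map (SSet.stdSimplex.map θ)).app _ x, ?_⟩
  have h : toSkel ht ((VR ℓ k).map θ.op σ) = (skel (VR ℓ k) m).map θ.op (toSkel hq σ) := rfl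
  have h2 : (sdIter φ.depth).map (SSet.stdSimplex.map θ) ≫ (φ.restrict (toSkel hq σ)).hom =
      (φ.restrict (toSkel ht ((VR ℓ k).map θ.op σ))).hom := by
    rw [h]
    dsimp only [SdMap.restrict]
    rw [← SSet.yonedaEquiv_symm_naturality_left, Functor.map_comp, Category.assoc]
  exact congrArg (fun σ => vertex σ 0)
    (ConcreteCategory.congr_hom (NatTrans.congr_app h2 (op ⦋0⦌)) x)

lemma imageVertices_subsingleton (hq : 0 ≤ m) (σ : (VR ℓ k) _⦋0⦌) :
    (imageVertices φ hq σ).Subsingleton := by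
  have h : ∀ n, Subsingleton ((Δ[0] : SSet.{u}).obj n) := fun n =>
    ⟨fun x y => SSet.stdSimplex.ext (d := n.unop.len) x y fun _ => Fin.subsingleton_one.elim _ _⟩
  have := subsingleton_sdIter φ.depth Δ[0] h (op ⦋0⦌)
  rintro _ ⟨x, rfl⟩ _ ⟨y, rfl⟩
  rw [this.elim x y]

lemma vertex_translateVR (g : G) (σ : (VR ℓ k) _⦋q⦌) (i : Fin (q + 1)) :
    vertex ((translateVR ℓ k g).app _ σ) i = g * vertex σ i := rfl

lemma IsEquivariant.imageVertices (hφ : IsEquivariant φ) (g : G) (hq : q ≤ m)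
    (σ : (VR ℓ k) _⦋q⦌) :
    imageVertices φ hq ((translateVR ℓ k g).app _ σ) = (g * ·) '' imageVertices φ hq σ := by
  rw [BNSR.imageVertices, BNSR.imageVertices, ← Set.range_comp]
  congr 1
  ext x
  have h : toSkel hq ((translateVR ℓ k g).app _ σ) =
      (skelMap (translateVR ℓ k g) m).app _ (toSkel hq σ) := rfl
  have h2 : (φ.restrict (toSkel hq ((translateVR ℓ k g).app _ σ))).hom =
      (φ.restrict (toSkel hq σ)).hom ≫ translateVR ℓ k g := by
    rw [h]
    dsimp only [SdMap.restrict]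
    rw [← SSet.yonedaEquiv_symm_comp, Functor.map_comp, Category.assoc, hφ g, Category.assoc]
  exact congrArg (fun σ => vertex σ 0)
    (ConcreteCategory.congr_hom (NatTrans.congr_app h2 (op ⦋0⦌)) x)

lemma val_le (χ : Character G) (σ : (VR ℓ k) _⦋q⦌) (i : Fin (q + 1)) :
    val χ σ ≤ χ (Additive.ofMul (vertex σ i)) :=
  ciInf_le (Set.finite_range _).bddBelow i

lemma le_val {r : ℝ} {σ : (VR ℓ k) _⦋q⦌} (h : ∀ i, r ≤ χ (Additive.ofMul (vertex σ i))) :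
    r ≤ val χ σ :=
  le_ciInf h

lemma valImage_le (χ : Character G) {hq : q ≤ m} {σ : (VR ℓ k) _⦋q⦌} {g : G}
    (hg : g ∈ imageVertices φ hq σ) : valImage χ φ hq σ ≤ χ (Additive.ofMul g) := by
  have : Finite (imageVertices φ hq σ) := imageVertices_finite φ hq σ
  exact ciInf_le (Set.finite_range _).bddBelow (⟨g, hg⟩ : imageVertices φ hq σ)

/-- The comparison of two finite minima becomes a finite combination of strict inequalities between
evaluations of `χ`, from which openness of the witness set can be read off. -/
lemma val_lt_valImage_iff {hq : q ≤ m} {σ : (VR ℓ k) _⦋q⦌} :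
    0 < valImage χ φ hq σ - val χ σ ↔ ∀ g ∈ imageVertices φ hq σ, ∃ i,
      χ (Additive.ofMul (vertex σ i)) < χ (Additive.ofMul g) := by
  have h1 : Finite (imageVertices φ hq σ) := imageVertices_finite φ hq σ
  have h2 : Nonempty (imageVertices φ hq σ) := (imageVertices_nonempty φ hq σ).to_subtype
  rw [sub_pos]
  constructor
  · intro h g hg
    by_contra! hn
    exact absurd (le_val hn) (not_le.2 (h.trans_le (valImage_le χ hg)))
  · intro h
    obtain ⟨g, hg⟩ := exists_eq_ciInf_of_finite
      (f := fun g : imageVertices φ hq σ => χ (Additive.ofMul g.1))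
    obtain ⟨i, hi⟩ := h g g.2
    rw [valImage, ← hg]
    exact (val_le χ σ i).trans_lt hi

/-- Translation by `g` adds `χ g` to both valuations, so the finitely many simplices based at the
identity decide about all simplices. -/
lemma IsEquivariant.raise_translate (hφ : IsEquivariant φ) (g : G) (hq : q ≤ m)
    (σ : (VR ℓ k) _⦋q⦌) :
    valImage χ φ hq ((translateVR ℓ k g).app _ σ) - val χ ((translateVR ℓ k g).app _ σ) =
      valImage χ φ hq σ - val χ σ := by
  have h1 : Finite (BNSR.imageVertices φ hq σ) := imageVertices_finite φ hq σ
  have h2 : Nonempty (BNSR.imageVertices φ hq σ) := (imageVertices_nonempty φ hq σ).to_subtype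
  have e1 : val χ ((translateVR ℓ k g).app _ σ) = χ (Additive.ofMul g) + val χ σ := by
    simp only [val, vertex_translateVR, character_mul]
    exact (add_ciInf (Set.finite_range _).bddBelow _).symm
  have e2 : valImage χ φ hq ((translateVR ℓ k g).app _ σ) =
      χ (Additive.ofMul g) + valImage χ φ hq σ := by
    rw [valImage, valImage, add_ciInf (Set.finite_range _).bddBelow]
    rw [iInf, iInf]
    congr 1
    ext r
    simp only [Set.mem_range, Subtype.exists, hφ.imageVertices, Set.mem_image, exists_prop,
      exists_exists_and_eq_and, character_mul]
  rw [e1, e2]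
  ring

/-- The simplex translated so that its first vertex becomes the identity. -/
def toBased (hq : q ≤ m) (σ : (VR ℓ k) _⦋q⦌) : BasedSimplex ℓ m k :=
  ⟨⟨q, Nat.lt_succ_of_le hq⟩, (translateVR ℓ k (vertex σ 0)⁻¹).app _ σ,
    by rw [vertex_translateVR, inv_mul_cancel]⟩

lemma finite_basedSimplex (hℓ : IsLength ℓ) (m k : ℕ) : Finite (BasedSimplex ℓ m k) := by
  have : ∀ q : Fin (m + 1), Finite {σ : (VR ℓ k) _⦋q⦌ // vertex σ 0 = 1} := fun q => by
    have h1 : Finite {g : G // ℓ g ≤ k} := hℓ.finite_ball k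
    refine Finite.of_injective (β := Fin (q + 1) → {g : G // ℓ g ≤ k})
      (fun σ i => ⟨vertex σ.1 i, ?_⟩) fun σ τ h => ?_
    · have := σ.1.2.2 0 i
      have h0 : vertex σ.1 0 = 1 := σ.2
      change ℓ ((vertex σ.1 0)⁻¹ * vertex σ.1 i) ≤ k at this
      rwa [h0, inv_one, one_mul] at this
    · exact Subtype.ext (Subtype.ext (funext fun i => congrArg Subtype.val (congrFun h i)))
  unfold BasedSimplex
  infer_instance

lemma nonempty_basedSimplex (hℓ : IsLength ℓ) (m k : ℕ) : Nonempty (BasedSimplex ℓ m k) :=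
  ⟨⟨0, ⟨fun _ => 1, fun _ => Set.mem_univ _, fun _ _ => by
    rw [hℓ.dist_self]; exact Nat.zero_le k⟩, rfl⟩⟩

lemma IsEquivariant.minRaise_le (hφ : IsEquivariant φ) (hℓ : IsLength ℓ) (hq : q ≤ m)
    (σ : (VR ℓ k) _⦋q⦌) : minRaise φ χ ≤ valImage χ φ hq σ - val χ σ := by
  have := finite_basedSimplex hℓ m k
  rw [← hφ.raise_translate (vertex σ 0)⁻¹ hq σ]
  exact ciInf_le (Set.finite_range _).bddBelow (toBased hq σ)

lemma mem_witnessSet_iff (hℓ : IsLength ℓ) : χ ∈ witnessSet φ ↔ ∀ s : BasedSimplex ℓ m k,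
    0 < valImage χ φ (Nat.le_of_lt_succ s.1.2) s.2.1 - val χ s.2.1 := by
  have := finite_basedSimplex hℓ m k
  have := nonempty_basedSimplex hℓ m k
  constructor
  · exact fun h s => (Set.mem_Ioi.1 h).trans_le (ciInf_le (Set.finite_range _).bddBelow s)
  · intro h
    obtain ⟨s, hs⟩ := exists_eq_ciInf_of_finite (f := fun s : BasedSimplex ℓ m k =>
      valImage χ φ (Nat.le_of_lt_succ s.1.2) s.2.1 - val χ s.2.1)
    change 0 < minRaise φ χ
    rw [minRaise, ← hs]
    exact h s

lemma IsEquivariant.mem_witnessSet_iff_raisesVal (hφ : IsEquivariant φ) (hℓ : IsLength ℓ) :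
    χ ∈ witnessSet φ ↔ RaisesVal φ χ := by
  refine ⟨fun h q hq σ => (Set.mem_Ioi.1 h).trans_le (hφ.minRaise_le hℓ hq σ), fun h => ?_⟩
  exact (mem_witnessSet_iff hℓ).2 fun s => h _ _ _

lemma isOpen_witnessSet (hℓ : IsLength ℓ) : IsOpen (witnessSet φ) := by
  have := finite_basedSimplex hℓ m k
  have h : witnessSet φ = ⋂ s : BasedSimplex ℓ m k,
      ⋂ g ∈ imageVertices φ (Nat.le_of_lt_succ s.1.2) s.2.1,
        ⋃ i, {χ | χ (Additive.ofMul (vertex s.2.1 i)) < χ (Additive.ofMul g)} := by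
    ext χ
    simp only [mem_witnessSet_iff hℓ, val_lt_valImage_iff, Set.mem_iInter, Set.mem_iUnion,
      Set.mem_ofPred_eq]
  rw [h]
  exact isOpen_iInter_of_finite fun s => (imageVertices_finite φ _ _).isOpen_biInter fun g _ =>
    isOpen_iUnion fun i => isOpen_lt (continuous_eval_character _) (continuous_eval_character _)

end ImageVertices

/-! ### A combinatorial model of iterated barycentric subdivision -/

/-- A flag complex: a partially ordered vertex set with a reflexive and symmetric adjacency
relation, adjacent vertices being comparable. -/
structure FlagComplex : Type (u + 1) where
  /-- The vertices. -/
  carrier : Type u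
  /-- The order of the vertices. -/
  [order : PartialOrder carrier]
  /-- Adjacency. -/
  adj : carrier → carrier → Prop
  refl : ∀ p, adj p p
  symm : ∀ {p q}, adj p q → adj q p
  comparable : ∀ {p q}, adj p q → p ≤ q ∨ q ≤ p

namespace FlagComplex

attribute [instance] FlagComplex.order

section Simplices

open scoped Simplicial

variable (K : FlagComplex.{u})

/-- The simplicial set of a flag complex: its simplices are the increasing tuples of pairwise
adjacent vertices. -/
def sset : SSet.{u} where
  obj n := {y : Fin (n.unop.len + 1) → K.carrier // Monotone y ∧ ∀ i j, K.adj (y i) (y j)}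
  map f := ↾fun y => ⟨y.1 ∘ f.unop.toOrderHom, y.2.1.comp f.unop.toOrderHom.monotone,
    fun _ _ => y.2.2 _ _⟩
  map_id _ := rfl
  map_comp _ _ := rfl

/-- The barycentric subdivision of a flag complex. -/
def sd : FlagComplex.{u} where
  carrier := {c : Finset K.carrier // c.Nonempty ∧ ∀ p ∈ c, ∀ q ∈ c, K.adj p q}
  adj c d := c ≤ d ∨ d ≤ c
  refl _ := Or.inl le_rfl
  symm h := h.symm
  comparable h := h

variable {K}

/-- The tuple of vertices of a simplex. -/
def vert {n : SimplexCategoryᵒᵖ} (y : K.sset.obj n) : Fin (n.unop.len + 1) → K.carrier := y.1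

lemma exists_enum (c : Finset K.carrier) (hc : c.Nonempty) (hadj : ∀ p ∈ c, ∀ q ∈ c, K.adj p q) :
    ∃ (s : ℕ) (x : K.sset _⦋s⦌), StrictMono (vert x) ∧ ∀ p, p ∈ c ↔ p ∈ Set.range (vert x) := by
  classical
  let L : LinearOrder c :=
    { (inferInstance : PartialOrder c) with
      le_total := fun a b => K.comparable (hadj a a.2 b b.2)
      toDecidableLE := Classical.decRel _ }
  have hcard : Fintype.card c = c.card - 1 + 1 := by
    have := hc.card_pos
    rw [Fintype.card_coe]
    lia
  let e : Fin (c.card - 1 + 1) ≃o c := Fintype.orderIsoFinOfCardEq c hcard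
  have he : StrictMono fun i => (e i : K.carrier) := fun i j hij => e.strictMono hij
  refine ⟨c.card - 1, ⟨fun i => (e i : K.carrier), he.monotone,
    fun i j => hadj _ (e i).2 _ (e j).2⟩, he, fun p => ⟨fun hp => ?_, ?_⟩⟩
  · obtain ⟨i, hi⟩ := e.surjective ⟨p, hp⟩
    exact ⟨i, congrArg Subtype.val hi⟩
  · rintro ⟨i, rfl⟩
    exact (e i).2

/-- The set of indices of the entries of a tuple lying in a given finite set. -/
def pullChain {s : ℕ} (x : K.sset _⦋s⦌) (c : Finset K.carrier) (hc : c.Nonempty)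
    (h : ∀ p ∈ c, p ∈ Set.range (vert x)) :
    PartialOrder.NonemptyFiniteChains (ULift.{u} (Fin (s + 1))) where
  finset := open Classical in Finset.univ.filter fun t => vert x t.down ∈ c
  nonempty := by
    obtain ⟨p, hp⟩ := hc
    obtain ⟨t, rfl⟩ := h p hp
    exact ⟨⟨t⟩, by simpa using hp⟩
  comparable a b := le_total a b

lemma mem_pullChain {s : ℕ} {x : K.sset _⦋s⦌} {c : Finset K.carrier} {hc : c.Nonempty}
    {h : ∀ p ∈ c, p ∈ Set.range (vert x)} {t : ULift.{u} (Fin (s + 1))} :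
    t ∈ (pullChain x c hc h).finset ↔ vert x t.down ∈ c := by
  simp [pullChain]

/-- The sets of indices of the entries of a tuple lying in the members of a chain. -/
def pull {s : ℕ} {n : SimplexCategoryᵒᵖ} (x : K.sset _⦋s⦌) (D : K.sd.sset.obj n)
    (h : ∀ i, ∀ p ∈ (vert D i).1, p ∈ Set.range (vert x)) :
    (SimplexCategory.sd.{u}.obj ⦋s⦌).obj n :=
  have hmono : Monotone fun i => pullChain x (vert D i).1 (vert D i).2.1 (h i) :=
    fun _ _ hij _ ht => mem_pullChain.2 (D.2.1 hij (mem_pullChain.1 ht))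
  hmono.functor

/-- The subdivided simplex determined by a chain does not depend on the ambient simplex: `y` is a
face of `x`, and `sdCell` is natural for the face operator. Naturality of `toSd` rests on this. -/
lemma sdCell_pull {s t : ℕ} {n : SimplexCategoryᵒᵖ} {x : K.sset _⦋s⦌} {y : K.sset _⦋t⦌}
    (hx : StrictMono (vert x)) (hy : StrictMono (vert y)) {D : K.sd.sset.obj n}
    (hxy : Set.range (vert y) ⊆ Set.range (vert x))
    (h : ∀ i, ∀ p ∈ (vert D i).1, p ∈ Set.range (vert y)) :
    (sdCell x).app n (pull x D fun i p hp => hxy (h i p hp)) =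
      (sdCell y).app n (pull y D h) := by
  choose θ hθ using fun j => hxy ⟨j, rfl⟩
  have hθm : Monotone θ := fun i j hij => by
    rw [← hx.le_iff_le, hθ, hθ]
    exact hy.monotone hij
  let Θ : ⦋t⦌ ⟶ ⦋s⦌ := SimplexCategory.mkHom ⟨θ, hθm⟩
  have e : y = K.sset.map Θ.op x := Subtype.ext (funext fun j => (hθ j).symm)
  have h1 : (sdCell y).app n (pull y D h) =
      (sdCell x).app n ((SimplexCategory.sd.map Θ).app n (pull y D h)) := by
    conv_lhs => rw [show sdCell y = SimplexCategory.sd.map Θ ≫ sdCell x by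
      rw [← sdCell_map]; exact congrArg sdCell e]
    rfl
  rw [h1]
  congr 1
  refine nerve.ext_of_isThin (C := PartialOrder.NonemptyFiniteChains (ULift.{u} (Fin (s + 1))))
    (funext fun i => PartialOrder.NonemptyFiniteChains.ext (Finset.ext fun a => ?_))
  refine Iff.trans ?_ (PartialOrder.NonemptyFiniteChains.mem_map_iff (X := ULift.{u} (Fin (t + 1)))
    (Y := ULift.{u} (Fin (s + 1))) ((pull y D h).obj i)
    (SimplexCategory.toPartOrd.{u}.map Θ).hom a).symm
  refine (mem_pullChain (hc := (vert D i).2.1) (h := fun p hp => hxy (h i p hp))).trans ⟨fun ha => ?_, ?_⟩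
  · obtain ⟨j, hj⟩ := h i _ ha
    refine ⟨⟨j⟩, (mem_pullChain (hc := (vert D i).2.1) (h := h i)).2 (by rw [hj]; exact ha), ?_⟩
    exact congrArg ULift.up (show θ j = a.down from hx.injective (by rw [hθ, hj]))
  · rintro ⟨j, hj, rfl⟩
    have hj := (mem_pullChain (hc := (vert D i).2.1) (h := h i)).1 hj
    rw [← hθ j.down] at hj
    exact hj

lemma mem_range_of_last {n : SimplexCategoryᵒᵖ} (D : K.sd.sset.obj n) {s : ℕ} {x : K.sset _⦋s⦌}
    (hx : ∀ p, p ∈ (vert D (Fin.last _)).1 ↔ p ∈ Set.range (vert x)) (i) (p)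
    (hp : p ∈ (vert D i).1) : p ∈ Set.range (vert x) :=
  (hx p).1 (D.2.1 (Fin.le_last i) hp)

lemma exists_topCell {n : SimplexCategoryᵒᵖ} (D : K.sd.sset.obj n) :
    ∃ z : Σ s : ℕ, K.sset _⦋s⦌, StrictMono (vert z.2) ∧
      ∀ p, p ∈ (vert D (Fin.last _)).1 ↔ p ∈ Set.range (vert z.2) := by
  obtain ⟨s, x, h⟩ := exists_enum (vert D (Fin.last _)).1 (vert D (Fin.last _)).2.1
    (vert D (Fin.last _)).2.2
  exact ⟨⟨s, x⟩, h⟩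

/-- The vertices of the last member of a chain, in increasing order. -/
def topCell {n : SimplexCategoryᵒᵖ} (D : K.sd.sset.obj n) : Σ s : ℕ, K.sset _⦋s⦌ :=
  (exists_topCell D).choose

lemma topCell_strictMono {n : SimplexCategoryᵒᵖ} (D : K.sd.sset.obj n) :
    StrictMono (vert (topCell D).2) := (exists_topCell D).choose_spec.1

lemma mem_topCell {n : SimplexCategoryᵒᵖ} (D : K.sd.sset.obj n) (p : K.carrier) :
    p ∈ (vert D (Fin.last _)).1 ↔ p ∈ Set.range (vert (topCell D).2) :=
  (exists_topCell D).choose_spec.2 p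

variable (K) in
/-- The comparison of the combinatorial with the simplicial subdivision. -/
def toSd : K.sd.sset ⟶ SSet.sd.obj K.sset where
  -- A chain of vertex sets is a chain of faces of the simplex spanned by its last member.
  app n := ↾fun D => (sdCell (topCell D).2).app n
    (pull (topCell D).2 D (mem_range_of_last D (mem_topCell D)))
  naturality n n' f := by
    ext D
    have hsub : Set.range (vert (topCell (K.sd.sset.map f D)).2) ⊆
        Set.range (vert (topCell D).2) := by
      intro p hp
      rw [← mem_topCell] at hp
      exact mem_range_of_last D (mem_topCell D) _ p hp
    refine (sdCell_pull (topCell_strictMono D) (topCell_strictMono (K.sd.sset.map f D)) hsub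
      (mem_range_of_last _ (mem_topCell _))).symm.trans ?_
    exact ConcreteCategory.congr_hom ((sdCell (topCell D).2).naturality f)
      (pull (topCell D).2 D (mem_range_of_last D (mem_topCell D)))

end Simplices

/-- The iterated barycentric subdivision of a flag complex. -/
def iter (K : FlagComplex.{u}) : ℕ → FlagComplex.{u}
  | 0 => K
  | N + 1 => (iter K N).sd

/-- The comparison of the combinatorial with the simplicial iterated subdivision. -/
def toSdIter (K : FlagComplex.{u}) : ∀ N, (K.iter N).sset ⟶ (sdIter N).obj K.sset
  | 0 => 𝟙 _
  | N + 1 => toSd (K.iter N) ≫ SSet.sd.map (toSdIter K N)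

/-- The vertices of the carrier of a vertex of the iterated subdivision. -/
def support {K : FlagComplex.{u}} : ∀ N, (K.iter N).carrier → Set K.carrier
  | 0, p => {p}
  | N + 1, c => ⋃ p ∈ (show Finset (K.iter N).carrier from c.1), support N p

section Carrier

open scoped Simplicial

variable {K : FlagComplex.{u}}

/-- This is a carrier estimate: each simplex of the combinatorial subdivision lands in the
subdivision of one simplex spanned by vertices in its support. Choosing that simplex strictly
increasing keeps its dimension at most `n`. -/
lemma toSdIter_mem {n : ℕ} (hK : ∀ (r : ℕ) (y : K.sset _⦋r⦌), StrictMono (vert y) → r ≤ n)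
    (N r : ℕ) (y : (K.iter N).sset _⦋r⦌) :
    ∃ (q : ℕ) (_ : q ≤ n) (τ : K.sset _⦋q⦌) (z : ((sdIter N).obj Δ[q]) _⦋r⦌),
      (∀ i, vert τ i ∈ ⋃ j, support N (vert y j)) ∧ (toSdIter K N).app _ y =
        ((sdIter N).map (SSet.yonedaEquiv.symm τ)).app _ z := by
  classical
  induction N generalizing r with
  | zero =>
    obtain ⟨s, x, hx, hxy⟩ := exists_enum (K := K) (Finset.univ.image (vert y)) (by simp)
      (fun p hp q hq => by
        simp only [Finset.mem_image, Finset.mem_univ, true_and] at hp hq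
        obtain ⟨i, rfl⟩ := hp
        obtain ⟨j, rfl⟩ := hq
        exact y.2.2 i j)
    simp only [Finset.mem_image, Finset.mem_univ, true_and] at hxy
    choose θ hθ using fun j => (hxy (vert y j)).1 ⟨j, rfl⟩
    have hθm : Monotone θ := fun i j hij => by
      rw [← hx.le_iff_le, hθ, hθ]
      exact y.2.1 hij
    let Θ : ⦋r⦌ ⟶ ⦋s⦌ := SimplexCategory.mkHom ⟨θ, hθm⟩
    refine ⟨s, hK s x hx, x, SSet.stdSimplex.objEquiv.symm Θ, fun i => ?_, ?_⟩
    · obtain ⟨j, hj⟩ := (hxy (vert x i)).2 ⟨i, rfl⟩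
      exact Set.mem_iUnion.2 ⟨j, hj.symm⟩
    · exact Subtype.ext (funext fun j => (hθ j).symm)
  | succ N ih =>
    obtain ⟨q, hq, τ, z, h1, h2⟩ := ih _ (topCell (K := K.iter N) y).2
    refine ⟨q, hq, τ, (SSet.sd.map (SSet.yonedaEquiv.symm z)).app _
      ((SSet.stdSimplex.sdIso.inv.app ⦋_⦌).app _
        (pull _ y (mem_range_of_last y (mem_topCell y)))), fun i => ?_, ?_⟩
    · obtain ⟨j, hj⟩ := Set.mem_iUnion.1 (h1 i)
      refine Set.mem_iUnion.2 ⟨Fin.last _, Set.mem_iUnion₂.2 ⟨_, ?_, hj⟩⟩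
      exact (mem_topCell (K := K.iter N) y _).2 ⟨j, rfl⟩
    · have h3 : sdCell (topCell (K := K.iter N) y).2 ≫ SSet.sd.map (toSdIter K N) =
          SSet.stdSimplex.sdIso.inv.app ⦋_⦌ ≫ SSet.sd.map (SSet.yonedaEquiv.symm z) ≫
            SSet.sd.map ((sdIter N).map (SSet.yonedaEquiv.symm τ)) := by
        rw [sdCell, Category.assoc, ← Functor.map_comp, ← Functor.map_comp,
          SSet.yonedaEquiv_symm_comp, SSet.yonedaEquiv_symm_comp, h2]
      exact ConcreteCategory.congr_hom (NatTrans.congr_app h3 _)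
        (pull _ y (mem_range_of_last y (mem_topCell y)))

end Carrier

end FlagComplex

/-! ### Nested chains of coarse lattice points -/

section Window

variable {n : ℕ}

lemma Near.trans {a a' : ℕ} {v u w : Fin n → ℤ} (h : Near a v u) (h' : Near a' u w) :
    Near (a + a') v w := by
  intro i
  have hp : (0 : ℤ) < 3 ^ a := by positivity
  have h3 : v i - 3 ^ (a + a') * w i = (v i - 3 ^ a * u i) + 3 ^ a * (u i - 3 ^ a' * w i) := by
    rw [pow_add]; ring
  have h4 : (3 : ℤ) ^ a * |u i - 3 ^ a' * w i| ≤ 3 ^ a * (3 ^ a' - 1) :=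
    mul_le_mul_of_nonneg_left (by have := h' i; lia) hp.le
  have h5 := abs_add_le (v i - 3 ^ a * u i) (3 ^ a * (u i - 3 ^ a' * w i))
  rw [abs_mul, abs_of_pos hp] at h5
  have h6 := h i
  have h7 : (3 : ℤ) ^ (a + a') = 3 ^ a * (3 ^ a' - 1) + 3 ^ a := by rw [pow_add]; ring
  rw [h3, h7]
  lia

/-- The coordinate sum is injective on a chain, and adjacency confines it to `n + 1` consecutive
integers. -/
lemma card_le_of_chain {c : Finset (Fin n → ℤ)} (hadj : ∀ u ∈ c, ∀ w ∈ c, Adj u w)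
    (hcomp : ∀ u ∈ c, ∀ w ∈ c, u ≤ w ∨ w ≤ u) : c.card ≤ n + 1 := by
  rcases c.eq_empty_or_nonempty with rfl | hc
  · simp
  obtain ⟨m, hm, hmin⟩ := c.exists_min_image (fun u => ∑ i, u i) hc
  have hinj : Set.InjOn (fun u : Fin n → ℤ => ∑ i, u i) c := by
    have key : ∀ u w : Fin n → ℤ, u ≤ w → ∑ i, u i = ∑ i, w i → u = w := fun u w huw h =>
      funext fun i => (Finset.sum_eq_sum_iff_of_le fun i _ => huw i).1 h i (Finset.mem_univ i)
    intro u hu w hw h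
    rcases hcomp u hu w hw with h1 | h1
    · exact key u w h1 h
    · exact (key w u h1 h.symm).symm
  have hmaps : ∀ u ∈ c, ∑ i, u i ∈ Finset.Icc (∑ i, m i) (∑ i, m i + n) := by
    intro u hu
    refine Finset.mem_Icc.2 ⟨hmin u hu, ?_⟩
    have : ∑ i, u i ≤ ∑ i, (m i + 1) := Finset.sum_le_sum fun i _ => by
      have := hadj u hu m hm i
      rw [abs_le] at this
      lia
    simpa [Finset.sum_add_distrib] using this
  have := Finset.card_le_card_of_injOn _ hmaps hinj
  rw [Int.card_Icc] at this
  lia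

lemma ediv_natCast_mono (R : ℕ) {x y : ℤ} (h : x ≤ y) : x / (R : ℤ) ≤ y / R := by
  rcases R.eq_zero_or_pos with rfl | hR
  · simp
  · exact Int.ediv_le_ediv (by exact_mod_cast hR) h

/-- The lattice points of mesh `R` seen from `v` along the diagonal, away from the cell walls by
more than `r`. -/
def window (R r : ℕ) (v : Fin n → ℤ) : Finset (Fin n → ℤ) :=
  ((Finset.range R).filter fun s : ℕ => ∀ i, (v i + s - r) / (R : ℤ) = (v i + s + r) / R).image
    fun (s : ℕ) i => (v i + s) / (R : ℤ)

lemma mem_window {R r : ℕ} {v u : Fin n → ℤ} : u ∈ window R r v ↔ ∃ s : ℕ, s < R ∧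
    (∀ i, (v i + s - r) / (R : ℤ) = (v i + s + r) / R) ∧ ∀ i, (v i + s) / (R : ℤ) = u i := by
  simp only [window, Finset.mem_image, Finset.mem_filter, Finset.mem_range, and_assoc, funext_iff]

/-- Moving to an adjacent point uses up at most one unit of clearance from the walls. -/
lemma window_succ_subset {R r : ℕ} {v w : Fin n → ℤ} (h : Adj v w) :
    window R (r + 1) v ⊆ window R r w := by
  intro u hu
  rw [mem_window] at hu ⊢
  obtain ⟨s, hs, h1, h2⟩ := hu
  have key : ∀ i x, v i + s - (r + 1 : ℕ) ≤ x → x ≤ v i + s + (r + 1 : ℕ) →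
      x / (R : ℤ) = (v i + s - (r + 1 : ℕ)) / R := fun i x hx hx' =>
    le_antisymm (h1 i ▸ ediv_natCast_mono R hx') (ediv_natCast_mono R hx)
  have hi : ∀ i, -1 ≤ v i - w i ∧ v i - w i ≤ 1 := fun i => abs_le.1 (h i)
  refine ⟨s, hs, fun i => ?_, fun i => ?_⟩ <;> have := hi i
  · rw [key i _ (by lia) (by lia), key i (w i + s + r) (by lia) (by lia)]
  · rw [← h2, key i _ (by lia) (by lia), key i (v i + s) (by lia) (by lia)]

lemma near_of_mem_window {e r : ℕ} {v u : Fin n → ℤ} (hu : u ∈ window (3 ^ e) r v) :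
    Near e v u := by
  obtain ⟨s, hs, -, h⟩ := mem_window.1 hu
  intro i
  have h1 := Int.mul_ediv_add_emod (v i + s) (3 ^ e)
  have hp : (0 : ℤ) < 3 ^ e := by positivity
  have h2 := Int.emod_nonneg (v i + s) hp.ne'
  have h3 := Int.emod_lt_of_pos (v i + s) hp
  have h4 : (s : ℤ) < 3 ^ e := by exact_mod_cast hs
  have h5 := h i
  push_cast at h5
  rw [h5] at h1
  rw [abs_lt]
  constructor <;> linarith

lemma window_comparable {R r : ℕ} {v u w : Fin n → ℤ} (hu : u ∈ window R r v)
    (hw : w ∈ window R r v) : u ≤ w ∨ w ≤ u := by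
  obtain ⟨s, -, -, hs⟩ := mem_window.1 hu
  obtain ⟨t, -, -, ht⟩ := mem_window.1 hw
  rcases le_total s t with h | h
  · exact Or.inl fun i => by
      rw [← hs, ← ht]; exact ediv_natCast_mono R (by lia)
  · exact Or.inr fun i => by
      rw [← hs, ← ht]; exact ediv_natCast_mono R (by lia)

/-- Among `n + 1` shifts spaced by `2 * r + 1`, all failing would make one of the `n` coordinates
fail twice. That coordinate would cross two walls at distance `R` within a stretch shorter than `R`.
-/
lemma window_nonempty {R r : ℕ} (h : (2 * r + 1) * (n + 1) ≤ R) (v : Fin n → ℤ) :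
    (window R r v).Nonempty := by
  by_contra hne
  have hR : (0 : ℤ) < R := by
    have : 0 < (2 * r + 1) * (n + 1) := by positivity
    exact_mod_cast this.trans_le h
  have hb : ∀ j : Fin (n + 1), ∃ i, (v i + ((2 * r + 1) * j : ℕ) - r) / (R : ℤ) <
      (v i + ((2 * r + 1) * j : ℕ) + r) / R := by
    intro j
    by_contra! hj
    refine hne ⟨_, mem_window.2 ⟨(2 * r + 1) * j, ?_, fun i => le_antisymm ?_ (hj i),
      fun i => rfl⟩⟩
    · refine lt_of_lt_of_le ?_ h
      exact Nat.mul_lt_mul_of_pos_left j.2 (by lia)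
    · exact ediv_natCast_mono R (by lia)
  choose c hc using hb
  obtain ⟨j, j', hjj, hcc⟩ := Fintype.exists_ne_map_eq_of_card_lt c (by simp)
  wlog hlt : j < j' generalizing j j'
  · exact this j' j hjj.symm hcc.symm (lt_of_le_of_ne (not_lt.1 hlt) hjj.symm)
  have h1 := hc j
  have h2 := hc j'
  rw [← hcc] at h2
  have hstep : (2 * r + 1) * (j : ℕ) + (2 * r + 1) ≤ (2 * r + 1) * (j' : ℕ) := by
    rw [← Nat.mul_succ]
    exact Nat.mul_le_mul_left _ hlt
  have hend : (2 * r + 1) * (j' : ℕ) + (2 * r + 1) ≤ R := by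
    rw [← Nat.mul_succ]
    exact (Nat.mul_le_mul_left _ j'.2).trans h
  have h3 : (v (c j) + ((2 * r + 1) * j : ℕ) + r) / (R : ℤ) ≤
      (v (c j) + ((2 * r + 1) * j' : ℕ) - r) / R := by
    have : (((2 * r + 1) * j : ℕ) : ℤ) + (2 * r + 1) ≤ ((2 * r + 1) * j' : ℕ) := by
      exact_mod_cast hstep
    exact ediv_natCast_mono R (by linarith)
  have h4 := Int.mul_ediv_add_emod (v (c j) + ((2 * r + 1) * j : ℕ) - r) R
  have h5 := Int.mul_ediv_add_emod (v (c j) + ((2 * r + 1) * j' : ℕ) + r) R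
  have h6 := Int.emod_lt_of_pos (v (c j) + ((2 * r + 1) * j : ℕ) - r) hR
  have h7 := Int.emod_nonneg (v (c j) + ((2 * r + 1) * j' : ℕ) + r) hR.ne'
  have h8 : (R : ℤ) * ((v (c j) + ((2 * r + 1) * j : ℕ) - r) / R + 2) ≤
      R * ((v (c j) + ((2 * r + 1) * j' : ℕ) + r) / R) :=
    mul_le_mul_of_nonneg_left (by lia) hR.le
  rw [mul_add] at h8
  have h9 : (((2 * r + 1) * j' : ℕ) : ℤ) + (2 * r + 1) ≤ R := by exact_mod_cast hend
  have h10 := Int.natCast_nonneg ((2 * r + 1) * j)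
  linarith

/-- The windows decrease with `r` and start with at most `n + 1` elements, so they cannot shrink
strictly `n + 2` times. -/
lemma exists_window_stable {e : ℕ} (v : Fin n → ℤ) :
    ∃ r, r ≤ n + 1 ∧ window (3 ^ e) r v = window (3 ^ e) (r + 1) v := by
  by_contra! h
  have key : ∀ r ≤ n + 2, (window (3 ^ e) r v).card + r ≤ n + 1 := by
    intro r
    induction r with
    | zero =>
      intro _
      exact card_le_of_chain (fun u hu w hw => (near_of_mem_window hu).adj (near_of_mem_window hw))
        fun u hu w hw => window_comparable hu hw
    | succ r ih =>
      intro hr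
      have h1 := ih (by lia)
      have h2 := Finset.card_lt_card ((window_succ_subset (Adj.refl v)).ssubset_of_ne
        (h r (by lia)).symm)
      lia
  have := key (n + 2) le_rfl
  lia

lemma window_anti {R : ℕ} (v : Fin n → ℤ) : Antitone fun r => window R r v :=
  antitone_nat_of_succ_le fun _ => window_succ_subset (Adj.refl v)

variable (n) in
/-- Every lattice point is assigned a chain of nearby points of a coarser lattice, such that the
chains of adjacent points are nested. -/
lemma exists_nested_chains : ∃ (e : ℕ) (b : (Fin n → ℤ) → Finset (Fin n → ℤ)),
    (∀ v, (b v).Nonempty) ∧ (∀ v, ∀ u ∈ b v, Near e v u) ∧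
    (∀ v, ∀ u ∈ b v, ∀ w ∈ b v, u ≤ w ∨ w ≤ u) ∧
    ∀ v w, Adj v w → b v ⊆ b w ∨ b w ⊆ b v := by
  -- This bounds `(2 * r + 1) * (n + 1)` for every stable radius `r ≤ n + 1`, and `e ≤ 3 ^ e`.
  let e := (2 * (n + 1) + 1) * (n + 1)
  choose r hr hstab using exists_window_stable (n := n) (e := e)
  refine ⟨e, fun v => window (3 ^ e) (r v) v, fun v => window_nonempty ?_ v,
    fun v u hu => near_of_mem_window hu, fun v u hu w hw => window_comparable hu hw,
    fun v w hvw => ?_⟩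
  · have h1 : (2 * r v + 1) * (n + 1) ≤ e := Nat.mul_le_mul_right _ (by have := hr v; lia)
    exact h1.trans (Nat.lt_pow_self (by norm_num)).le
  · have key : ∀ v w, Adj v w → r v ≤ r w →
        window (3 ^ e) (r w) w ⊆ window (3 ^ e) (r v) v := fun v w hvw h => by
      rw [hstab w]
      exact (window_succ_subset hvw.symm).trans (window_anti v h)
    rcases le_total (r v) (r w) with h | h
    · exact Or.inr (key v w hvw h)
    · exact Or.inl (key w v hvw.symm h)

end Window

/-! ### Simplicial approximation of the identity of Euclidean space -/

section Cubes

open scoped Simplicial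

/-- The standard triangulation of the cubulated Euclidean space. -/
def cubes (n : ℕ) : FlagComplex.{u} where
  carrier := ULift.{u} (Fin n → ℤ)
  adj p q := Adj p.down q.down ∧ (p.down ≤ q.down ∨ q.down ≤ p.down)
  refl _ := ⟨Adj.refl _, Or.inl le_rfl⟩
  symm h := ⟨h.1.symm, h.2.symm⟩
  comparable h := h.2

variable {n : ℕ}

lemma cubes_dim_le (r : ℕ) (y : (cubes.{u} n).sset _⦋r⦌)
    (hy : StrictMono (FlagComplex.vert y)) : r ≤ n := by
  classical
  have hinj : Function.Injective fun i => (FlagComplex.vert y i).down :=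
    fun i j h => hy.injective (ULift.ext _ _ h)
  have := card_le_of_chain (c := Finset.univ.image fun i => (FlagComplex.vert y i).down) (by
    simp only [Finset.mem_image, Finset.mem_univ, true_and]
    rintro _ ⟨i, rfl⟩ _ ⟨j, rfl⟩
    exact (y.2.2 i j).1) (by
    simp only [Finset.mem_image, Finset.mem_univ, true_and]
    rintro _ ⟨i, rfl⟩ _ ⟨j, rfl⟩
    exact (y.2.2 i j).2)
  rw [Finset.card_image_of_injective _ hinj] at this
  simpa using this

lemma exists_max_of_chain {P : Type*} [PartialOrder P] {c : Finset P} (hc : c.Nonempty)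
    (h : ∀ u ∈ c, ∀ w ∈ c, u ≤ w ∨ w ≤ u) : ∃ t ∈ c, ∀ u ∈ c, u ≤ t := by
  obtain ⟨t, ht, hmax⟩ := c.exists_maximal hc
  exact ⟨t, ht, fun u hu => (h u hu t ht).elim id fun h' => hmax hu h'⟩

variable (n) in
/-- Simplicial approximation of the identity by a map of the lattice to the iterated subdivision
of a coarser lattice. -/
lemma exists_approximation (N : ℕ) :
    ∃ (A : ℕ) (a : (Fin n → ℤ) → ((cubes.{u} n).iter N).carrier),
      (∀ v w, Adj v w → ((cubes.{u} n).iter N).adj (a v) (a w)) ∧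
      ∀ v, ∀ p ∈ FlagComplex.support N (a v), Near A v p.down := by
  classical
  obtain ⟨e, b, hb, hnear, hcomp, hnest⟩ := exists_nested_chains n
  induction N with
  | zero =>
    -- With no subdivision a point goes to the top of its chain; nestedness makes the tops of
    -- adjacent points comparable.
    choose t ht hmax using fun v => exists_max_of_chain (hb v) (hcomp v)
    refine ⟨e, fun v => ⟨t v⟩, fun v w hvw => ?_, fun v p hp => ?_⟩
    · rcases hnest v w hvw with h | h
      · exact ⟨(hnear w _ (h (ht v))).adj (hnear w _ (ht w)), Or.inl (hmax w _ (h (ht v)))⟩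
      · exact ⟨(hnear v _ (ht v)).adj (hnear v _ (h (ht w))), Or.inr (hmax v _ (h (ht w)))⟩
    · obtain rfl : p = ⟨t v⟩ := hp
      exact hnear v _ (ht v)
  | succ N ih =>
    obtain ⟨A, a, ha, hA⟩ := ih
    -- The image of a chain under the previous approximation is a simplex, thus a vertex of the next
    -- subdivision; nested chains give comparable vertices.
    refine ⟨e + A, fun v => ⟨(b v).image a, (hb v).image a, ?_⟩, fun v w hvw => ?_,
      fun v p hp => ?_⟩
    · simp only [Finset.mem_image]
      rintro _ ⟨u, hu, rfl⟩ _ ⟨w, hw, rfl⟩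
      exact ha u w ((hnear v u hu).adj (hnear v w hw))
    · exact (hnest v w hvw).imp (fun h => Finset.image_subset_image h)
        fun h => Finset.image_subset_image h
    · obtain ⟨q, hq, hp⟩ := Set.mem_iUnion₂.1 hp
      obtain ⟨u, hu, rfl⟩ := Finset.mem_image.1 hq
      exact (hnear v u hu).trans (hA u p hp)

end Cubes

/-! ### Equivariant maps that raise the valuation -/

section Witness

open scoped Simplicial

variable {G : Type u} [Group G] {ℓ : G → ℕ} {m k n : ℕ} {φ : SkelMap ℓ m k} {χ : Character G}

/-- The simplicial map given by a lattice map of mesh `k`. -/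
def Lip.toVR {f : (Fin n → ℤ) → G} (hf : Lip ℓ k f) : (cubes.{u} n).sset ⟶ VR ℓ k where
  app _ := ↾fun y => ⟨fun i => f (FlagComplex.vert y i).down, fun _ => Set.mem_univ _,
    fun i j => hf _ _ (y.2.2 i j).1⟩
  naturality _ _ _ := rfl

/-- Every simplex of the triangulated space is a degeneracy of one of dimension at most `n`, so the
image lies in the skeleton on which `φ` is defined. -/
lemma Lip.range_toVR_le {f : (Fin n → ℤ) → G} (hf : Lip ℓ k f) (hn : n ≤ m) :
    SSet.Subcomplex.range hf.toVR ≤ (VR ℓ k).skeleton (m + 1) := by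
  rintro d _ ⟨y, rfl⟩
  obtain ⟨q, hq, τ, z, -, h⟩ := FlagComplex.toSdIter_mem cubes_dim_le 0 d.unop.len y
  have h1 : hf.toVR.app d y =
      (VR ℓ k).map (SSet.stdSimplex.objEquiv z).op (hf.toVR.app (op ⦋q⦌) τ) :=
    congrArg (fun y => hf.toVR.app d y) h
  rw [h1]
  exact ((VR ℓ k).skeleton (m + 1)).map _ ((VR ℓ k).mem_skeleton _ (by lia))

/-- The simplicial map to the skeleton given by a lattice map of mesh `k`. -/
def Lip.toSkel {f : (Fin n → ℤ) → G} (hf : Lip ℓ k f) (hn : n ≤ m) :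
    (cubes.{u} n).sset ⟶ skel (VR ℓ k) m :=
  SSet.Subcomplex.lift hf.toVR (hf.range_toVR_le hn)

/-- The effect of a map of a subdivision on lattice maps. -/
lemma exists_lattice_image (φ : SkelMap ℓ m k) (hn : n ≤ m) :
    ∃ A, ∀ f : (Fin n → ℤ) → G, Lip ℓ k f → ∃ f', Lip ℓ k f' ∧
      ∀ v, ∃ (q : ℕ) (hq : q ≤ m) (σ : (VR ℓ k) _⦋q⦌) (w : Fin (q + 1) → Fin n → ℤ),
        (∀ i, Near A v (w i)) ∧ (∀ i, vertex σ i = f (w i)) ∧ f' v ∈ imageVertices φ hq σ := by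
  obtain ⟨A, a, ha, hA⟩ := exists_approximation.{u} n φ.depth
  refine ⟨A, fun f hf => ?_⟩
  let Φ : ((cubes.{u} n).iter φ.depth).sset ⟶ VR ℓ k :=
    (cubes.{u} n).toSdIter φ.depth ≫ (sdIter φ.depth).map (hf.toSkel hn) ≫ φ.hom
  let pt : (Fin n → ℤ) → ((cubes.{u} n).iter φ.depth).sset _⦋0⦌ := fun v =>
    ⟨fun _ => a v, monotone_const, fun _ _ => FlagComplex.refl _ _⟩
  -- Edges of the subdivision are increasing pairs, so adjacency is treated for `a v ≤ a w` and the
  -- other order follows by exchanging the points.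
  have key : ∀ v w, Adj v w → a v ≤ a w → ∀ i j : Fin 2,
      ℓ ((vertex (Φ.app _ (pt (![v, w] i))) 0)⁻¹ * vertex (Φ.app _ (pt (![v, w] j))) 0) ≤ k := by
    intro v w hvw hle
    let e : ((cubes.{u} n).iter φ.depth).sset _⦋1⦌ := ⟨fun i => a (![v, w] i), by
      rw [Fin.monotone_iff_le_succ]
      intro i
      fin_cases i
      exact hle, by
      intro i j
      fin_cases i <;> fin_cases j
      · exact FlagComplex.refl _ _
      · exact ha _ _ hvw
      · exact ha _ _ hvw.symm
      · exact FlagComplex.refl _ _⟩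
    have hpt : ∀ i : Fin 2, vertex (Φ.app _ (pt (![v, w] i))) 0 = vertex (Φ.app _ e) i := by
      intro i
      let θ : ⦋0⦌ ⟶ ⦋1⦌ := SimplexCategory.const _ _ i
      have h1 : pt (![v, w] i) = ((cubes.{u} n).iter φ.depth).sset.map θ.op e := rfl
      rw [h1]
      exact congrArg (fun σ => vertex σ 0) (ConcreteCategory.congr_hom (Φ.naturality θ.op) e)
    intro i j
    rw [hpt, hpt]
    exact (Φ.app _ e).2.2 i j
  refine ⟨fun v => vertex (Φ.app _ (pt v)) 0, fun v w hvw => ?_, fun v => ?_⟩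
  · rcases FlagComplex.comparable _ (ha v w hvw) with h | h
    · exact key v w hvw h 0 1
    · exact key w v hvw.symm h 1 0
  · obtain ⟨q, hq, τ, z, h1, h2⟩ := FlagComplex.toSdIter_mem cubes_dim_le φ.depth 0 (pt v)
    refine ⟨q, hq.trans hn, hf.toVR.app _ τ, fun i => (FlagComplex.vert τ i).down, fun i => ?_,
      fun i => rfl, z, ?_⟩
    · obtain ⟨j, hj⟩ := Set.mem_iUnion.1 (h1 i)
      exact hA v _ hj
    · have h3 : (φ.restrict (toSkel (hq.trans hn) (hf.toVR.app _ τ))).hom =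
          (sdIter φ.depth).map (SSet.yonedaEquiv.symm τ) ≫
            (sdIter φ.depth).map (hf.toSkel hn) ≫ φ.hom := by
        rw [← Category.assoc, ← Functor.map_comp, SSet.yonedaEquiv_symm_comp]
        rfl
      have h4 := ConcreteCategory.congr_hom (NatTrans.congr_app h3 (op ⦋0⦌)) z
      refine congrArg (fun σ => vertex σ 0) (h4.trans ?_)
      exact congrArg (fun x => ((sdIter φ.depth).map (hf.toSkel hn) ≫ φ.hom).app (op ⦋0⦌) x) h2.symm

/-- The constant simplex. -/
def constSimplex (hℓ : IsLength ℓ) (k q : ℕ) (t : G) : (VR ℓ k) _⦋q⦌ :=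
  ⟨fun _ => t, fun _ => Set.mem_univ _, fun _ _ => by rw [hℓ.dist_self]; exact Nat.zero_le k⟩

lemma IsEquivariant.raise (hφ : IsEquivariant φ) (hℓ : IsLength ℓ) (hχ : χ ∈ witnessSet φ)
    (hn : n ≤ m) : Raise ℓ χ k n := by
  obtain ⟨A, h⟩ := exists_lattice_image φ hn
  have hfin := finite_basedSimplex hℓ m k
  obtain ⟨B, hB⟩ : BddAbove (⋃ s : BasedSimplex ℓ m k,
      ℓ '' BNSR.imageVertices φ (Nat.le_of_lt_succ s.1.2) s.2.1) :=
    (Set.finite_iUnion fun s => (imageVertices_finite φ _ _).image ℓ).bddAbove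
  -- The only vertex of the image of the 0-simplex at the identity; by equivariance the point `t`
  -- goes to `t * g`.
  obtain ⟨g, hg⟩ := imageVertices_nonempty φ (Nat.zero_le m) (constSimplex hℓ k 0 1)
  refine ⟨A, k + B, minRaise φ χ, g, hχ, fun f hf => ?_⟩
  obtain ⟨f', hf', H⟩ := h f hf
  refine ⟨f', hf', fun v _ u hu => ?_, fun v _ r hr => ?_, fun v _ t ht => ?_⟩
  · obtain ⟨q, hq, σ, w, hw, hσ, hv⟩ := H v
    refine (hℓ.dist_triangle _ (f (w 0)) _).trans (add_le_add (hf _ _ (hu.adj (hw 0))) ?_)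
    refine hB (Set.mem_iUnion.2 ⟨toBased hq σ, _, ?_, rfl⟩)
    change _ ∈ BNSR.imageVertices φ hq ((translateVR ℓ k (vertex σ 0)⁻¹).app _ σ)
    rw [hφ.imageVertices, ← hσ]
    exact ⟨_, hv, rfl⟩
  · obtain ⟨q, hq, σ, w, hw, hσ, hv⟩ := H v
    have h1 := valImage_le χ hv
    have h2 : r ≤ val χ σ := le_val fun i => by rw [hσ]; exact hr _ (hw i)
    linarith [hφ.minRaise_le (χ := χ) hℓ hq σ]
  · obtain ⟨q, hq, σ, w, hw, hσ, hv⟩ := H v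
    -- A constant simplex is degenerate, so its image vertices are among those of a 0-simplex, of
    -- which there is just one.
    have h1 : σ = (VR ℓ k).map (SimplexCategory.const ⦋q⦌ ⦋0⦌ 0).op
        ((translateVR ℓ k t).app _ (constSimplex hℓ k 0 1)) :=
      Subtype.ext (funext fun i => by
        change vertex σ i = t * 1
        rw [hσ, ht _ (hw i), mul_one])
    rw [h1] at hv
    have h2 := imageVertices_map_subset (Nat.zero_le m) hq _ _ hv
    exact imageVertices_subsingleton (Nat.zero_le m) _ h2
      (by rw [hφ.imageVertices]; exact ⟨g, hg, rfl⟩)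

end Witness

end BNSR

end

theorem mainTheorem8 {G : Type u} {H : Type v} [Group G] [Group H]
    (S : Set H) (hfin : S.Finite) (hgen : Subgroup.closure S = ⊤)
    (j : G →* H) (hj : Function.Injective j) (m : ℕ) :
    -- away from the zero character the invariant is open
    IsOpen (BNSR.sigmaInvariant (BNSR.inducedLength S j) m \ {0}) ∧
    -- the invariant is a cone, containing zero as soon as it is nonempty
    (∀ c : ℝ, 0 < c → ∀ χ : BNSR.Character G,
      c • χ ∈ BNSR.sigmaInvariant (BNSR.inducedLength S j) m ↔
        χ ∈ BNSR.sigmaInvariant (BNSR.inducedLength S j) m) ∧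
    ((BNSR.sigmaInvariant (BNSR.inducedLength S j) m).Nonempty →
      (0 : BNSR.Character G) ∈ BNSR.sigmaInvariant (BNSR.inducedLength S j) m) ∧
    -- a witness for one character is a witness on an open set of characters
    (∀ k : Fin (m + 1) → ℕ, BNSR.IsConnectingVector (BNSR.inducedLength S j) k →
      ∀ φ : BNSR.SkelMap (BNSR.inducedLength S j) m (Finset.univ.sup k),
        BNSR.IsEquivariant φ →
          IsOpen (BNSR.witnessSet φ) ∧
          (∀ χ : BNSR.Character G, χ ∈ BNSR.witnessSet φ ↔ BNSR.RaisesVal φ χ) ∧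
          BNSR.witnessSet φ ⊆ BNSR.sigmaInvariant (BNSR.inducedLength S j) m) := by
  have hℓ := BNSR.isLength_inducedLength hfin hgen hj
  refine ⟨BNSR.isOpen_sigmaInvariant_diff hℓ, fun c hc χ => BNSR.smul_mem_sigmaInvariant_iff hc,
    BNSR.zero_mem_sigmaInvariant hℓ, fun k hk φ hφ => ⟨BNSR.isOpen_witnessSet hℓ,
      fun χ => hφ.mem_witnessSet_iff_raisesVal hℓ, fun χ hχ => ?_⟩⟩
  exact hk.mem_sigmaInvariant hℓ fun n hn => hφ.raise hℓ hχ hn
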